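/- Let $(M,I_1,I_2,I_3,g)$ be an HKT manifold: $M$ is a smooth (Hausdorff, second countable) manifold, $I_1,I_2,I_3$ are smooth integrable almost complex structures with $I_1I_2=I_3=-I_2I_1$, $g$ is a Riemannian metric that is Hermitian for each $I_a$, and there is a connection $\nabla$ with $\nabla g=0$, $\nabla I_1=\nabla I_2=\nabla I_3=0$ whose torsion $T$ is a 3-form, i.e. $g(T(u,v),w)$ is totally skew-symmetric. Let $G$ be a compact Lie group with Lie algebra $\mathfrak g$ acting smoothly on $M$ by isometries that preserve $I_1,I_2,I_3$; for $X\in\mathfrak g$ write $X$ also for the vector field on $M$ it generates. For a 1-form $\alpha$ put $(I_a\alpha)(v)=-\alpha(I_av)$. Let $\nu=(\nu_1,\nu_2,\nu_3):M\to\mathbb R^3\otimes\mathfrak g^*$ be a $G$-moment map, i.e. a smooth map such that (i) $\nu_a(\gamma\cdot x)=\mathrm{Ad}_\gamma^*\,\nu_a(x)$ for all $\gamma\in G$, $x\in M$, where $\mathrm{Ad}^*$ is the coadjoint action; (ii) $I_1d\nu_1=I_2d\nu_2=I_3d\nu_3$ (Cauchy–Riemann condition); (iii) $(I_ad\nu_a)(X)\in\mathfrak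 g^*$ is nonzero at every point of $M$ for every $0\ne X\in\mathfrak g$ (transversality). Let $\zeta\in\mathbb R^3\otimes\mathfrak g^*$, and assume that the level set $P=\nu^{-1}(\zeta)$ is $G$-invariant and that $G$ acts freely on $P$. Then: 1. $P$ is an embedded submanifold of $M$ of dimension $\dim M-3\dim G$, and $N=P/G$ with the quotient topology is Hausdorff and second countable and carries a smooth structure of dimension $\dim M-4\dim G$ for which the projection $\pi:P\to N$ is a submersion. 2. For $p\in P$ let $\mathcal U_p=\{t\in T_pP: I_1d\nu_1(t)=I_2d\nu_2(t)=I_3d\nu_3(t)=0\}$ be the space of horizontal vectors. It is preserved by $I_1,I_2,I_3$, and every $\hat A\in T_{\pi(p)}N$ has a unique horizontal lift $A^u\in\mathcal U_p$, $d\pi(A^u)=\hat A$. There are a hypercomplex structure $(\hat I_1,\hat I_2,\hat I_3)$ and a Riemannian metric $\hat g$ on $N$ with $\hat I_a\hat A=d\pi(I_aA^u)$ and $\hat g_{\pi(p)}(\hat A,\hat B)=g_p(A^u,B^u)$ for all $p\in P$ and $\hat A,\hat B\in T_{\pi(p)}N$. 3. $(N,\hat I_1,\hat I_2,\hat I_3,\hat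 g)$ is an HKT manifold. Moreover, with $\hat F_a(\cdot,\cdot)=\hat g(\hat I_a\cdot,\cdot)$ and $\hat\omega_1=\hat F_2-i\hat F_3$, one has $\bar\partial\hat\omega_1=0$, i.e. the $(0,3)$-part of $d\hat\omega_1$ with respect to $\hat I_1$ vanishes. -/

import Mathlib

open scoped Manifold ContDiff Topology
open VectorField

noncomputable section

namespace HKT

/-! ### Tensors and vector fields on a manifold without boundary -/

section Manifolds

variable {E : Type*} [NormedAddCommGroup E] [NormedSpace ℝ E]
  {M : Type*} [TopologicalSpace M] [ChartedSpace E M] [IsManifold 𝓘(ℝ, E) ∞ M]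

/-- The (not necessarily continuous) vector field `X` is smooth near the point `x`. -/
def SmoothAt (X : (x : M) → TangentSpace 𝓘(ℝ, E) x) (x : M) : Prop :=
  ContMDiffAt 𝓘(ℝ, E) 𝓘(ℝ, E).tangent ∞
    (fun y => (⟨y, X y⟩ : TangentBundle 𝓘(ℝ, E) M)) x

/-- The vector field `J X` for an endomorphism field `J` and a vector field `X`. -/
def applyField (J : (x : M) → TangentSpace 𝓘(ℝ, E) x →L[ℝ] TangentSpace 𝓘(ℝ, E) x)
    (X : (x : M) → TangentSpace 𝓘(ℝ, E) x) : (x : M) → TangentSpace 𝓘(ℝ, E) x :=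
  fun x => J x (X x)

/-- The Nijenhuis tensor `N_J(X, Y) = [JX, JY] - J[JX, Y] - J[X, JY] - [X, Y]`, evaluated on
two vector fields at a point. -/
def nijenhuis (J : (x : M) → TangentSpace 𝓘(ℝ, E) x →L[ℝ] TangentSpace 𝓘(ℝ, E) x)
    (X Y : (x : M) → TangentSpace 𝓘(ℝ, E) x) (x : M) : TangentSpace 𝓘(ℝ, E) x :=
  mlieBracket 𝓘(ℝ, E) (applyField J X) (applyField J Y) x
    - J x (mlieBracket 𝓘(ℝ, E) (applyField J X) Y x)
    - J x (mlieBracket 𝓘(ℝ, E) X (applyField J Y) x)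
    - mlieBracket 𝓘(ℝ, E) X Y x

/-- The derivative at `x` of a complex-valued function in the direction of a tangent vector. -/
def dirDeriv (f : M → ℂ) (x : M) (v : TangentSpace 𝓘(ℝ, E) x) : ℂ :=
  mfderiv 𝓘(ℝ, E) 𝓘(ℝ, ℂ) f x v

/-- The exterior derivative of a complex-valued 2-form, evaluated on three vector fields:
`dθ(X,Y,Z) = X θ(Y,Z) + Y θ(Z,X) + Z θ(X,Y) - θ([X,Y],Z) - θ([Y,Z],X) - θ([Z,X],Y)`. -/
def extDerivTwo (θ : (x : M) → TangentSpace 𝓘(ℝ, E) x → TangentSpace 𝓘(ℝ, E) x → ℂ)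
    (X Y Z : (x : M) → TangentSpace 𝓘(ℝ, E) x) (x : M) : ℂ :=
  dirDeriv (fun y => θ y (Y y) (Z y)) x (X x)
    + dirDeriv (fun y => θ y (Z y) (X y)) x (Y x)
    + dirDeriv (fun y => θ y (X y) (Y y)) x (Z x)
    - θ x (mlieBracket 𝓘(ℝ, E) X Y x) (Z x)
    - θ x (mlieBracket 𝓘(ℝ, E) Y Z x) (X x)
    - θ x (mlieBracket 𝓘(ℝ, E) Z X x) (Y x)

/-- The `ℂ`-trilinear extension of `dθ` evaluated on the complex vector fields `X + iX'`,
`Y + iY'`, `Z + iZ'`. -/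
def extDerivTwoComplex
    (θ : (x : M) → TangentSpace 𝓘(ℝ, E) x → TangentSpace 𝓘(ℝ, E) x → ℂ)
    (X X' Y Y' Z Z' : (x : M) → TangentSpace 𝓘(ℝ, E) x) (x : M) : ℂ :=
  extDerivTwo θ X Y Z x
    + Complex.I * (extDerivTwo θ X' Y Z x + extDerivTwo θ X Y' Z x + extDerivTwo θ X Y Z' x)
    - (extDerivTwo θ X' Y' Z x + extDerivTwo θ X' Y Z' x + extDerivTwo θ X Y' Z' x)
    - Complex.I * extDerivTwo θ X' Y' Z' x

/-- The `(0,3)`-part of `dθ` with respect to `J` vanishes: `dθ` vanishes on all triples of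
vectors of type `(0,1)`. The `(0,1)`-vectors are exactly those of the form `X + i J X` with
`X` real. -/
def ZeroThreePartVanishes
    (J : (x : M) → TangentSpace 𝓘(ℝ, E) x →L[ℝ] TangentSpace 𝓘(ℝ, E) x)
    (θ : (x : M) → TangentSpace 𝓘(ℝ, E) x → TangentSpace 𝓘(ℝ, E) x → ℂ) : Prop :=
  ∀ (x : M) (X Y Z : (x : M) → TangentSpace 𝓘(ℝ, E) x),
    SmoothAt X x → SmoothAt Y x → SmoothAt Z x →
      extDerivTwoComplex θ X (applyField J X) Y (applyField J Y) Z (applyField J Z) x = 0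

end Manifolds

/-! ### Hypercomplex and HKT structures -/

/-- A hypercomplex structure: three smooth integrable almost complex structures
`I₁ = J 0`, `I₂ = J 1`, `I₃ = J 2` satisfying the quaternion relations
(`I₁² = I₂² = I₃² = -1` and `I₁I₂ = I₃ = -I₂I₁`). -/
structure HypercomplexStructure (E : Type*) [NormedAddCommGroup E] [NormedSpace ℝ E]
    (M : Type*) [TopologicalSpace M] [ChartedSpace E M] [IsManifold 𝓘(ℝ, E) ∞ M] where
  J : Fin 3 → (x : M) → TangentSpace 𝓘(ℝ, E) x →L[ℝ] TangentSpace 𝓘(ℝ, E) x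
  smooth : ∀ a, ContMDiff 𝓘(ℝ, E) (𝓘(ℝ, E).prod 𝓘(ℝ, E →L[ℝ] E)) ∞
    (fun x => Bundle.TotalSpace.mk' (E →L[ℝ] E)
      (E := fun x : M => TangentSpace 𝓘(ℝ, E) x →L[ℝ] TangentSpace 𝓘(ℝ, E) x) x (J a x))
  sq : ∀ a x v, J a x (J a x v) = -v
  mul : ∀ x v, J 0 x (J 1 x v) = J 2 x v
  mul_rev : ∀ x v, J 1 x (J 0 x v) = -J 2 x v
  integrable : ∀ a x (X Y : (x : M) → TangentSpace 𝓘(ℝ, E) x),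
    SmoothAt X x → SmoothAt Y x → nijenhuis (J a) X Y x = 0

/-- Smooth Riemannian metrics. -/
abbrev Metric (E : Type*) [NormedAddCommGroup E] [NormedSpace ℝ E]
    (M : Type*) [TopologicalSpace M] [ChartedSpace E M] [IsManifold 𝓘(ℝ, E) ∞ M] : Type _ :=
  Bundle.ContMDiffRiemannianMetric 𝓘(ℝ, E) ∞ E (fun x : M => TangentSpace 𝓘(ℝ, E) x)

section HKTStructures

variable {E : Type*} [NormedAddCommGroup E] [NormedSpace ℝ E]
  {M : Type*} [TopologicalSpace M] [ChartedSpace E M] [IsManifold 𝓘(ℝ, E) ∞ M]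

/-- The metric is Hermitian with respect to each of `I₁, I₂, I₃`. -/
def IsHyperHermitian (H : HypercomplexStructure E M) (g : Metric E M) : Prop :=
  ∀ a x (v w : TangentSpace 𝓘(ℝ, E) x), g.inner x (H.J a x v) (H.J a x w) = g.inner x v w

/-- `F_a(X, Y) = g(I_a X, Y)`. -/
def kahlerForm (H : HypercomplexStructure E M) (g : Metric E M) (a : Fin 3) (x : M)
    (v w : TangentSpace 𝓘(ℝ, E) x) : ℝ :=
  g.inner x (H.J a x v) w

/-- The complex 2-form `ω₁ = F₂ - i F₃`, of type `(0,2)` with respect to `I₁`. -/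
def omegaOne (H : HypercomplexStructure E M) (g : Metric E M) (x : M)
    (v w : TangentSpace 𝓘(ℝ, E) x) : ℂ :=
  (kahlerForm H g 1 x v w : ℂ) - Complex.I * (kahlerForm H g 2 x v w : ℂ)

variable [FiniteDimensional ℝ E]

/-- A (smooth) affine connection `∇` is an HKT connection of `(H, g)` if it is hyper-Hermitian,
`∇g = 0` and `∇I₁ = ∇I₂ = ∇I₃ = 0`, and its torsion is a 3-form, i.e. `g(T(u, v), w)` is
totally skew-symmetric. (Skew-symmetry in `u, v` is automatic; in Mathlib's convention
`D Y x v` is `∇_v Y` at `x`.) -/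
structure IsHKTConnection (H : HypercomplexStructure E M) (g : Metric E M)
    (D : CovariantDerivative 𝓘(ℝ, E) E (fun x : M => TangentSpace 𝓘(ℝ, E) x)) : Prop where
  smooth : CovariantDerivative.ContMDiffCovariantDerivative D ∞
  metric : ∀ x (v : TangentSpace 𝓘(ℝ, E) x) (Y Z : (x : M) → TangentSpace 𝓘(ℝ, E) x),
    SmoothAt Y x → SmoothAt Z x →
      mfderiv 𝓘(ℝ, E) 𝓘(ℝ, ℝ) (fun y => g.inner y (Y y) (Z y)) x v
        = g.inner x (D Y x v) (Z x) + g.inner x (Y x) (D Z x v)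
  complex : ∀ a x (v : TangentSpace 𝓘(ℝ, E) x) (Y : (x : M) → TangentSpace 𝓘(ℝ, E) x),
    SmoothAt Y x → D (applyField (H.J a) Y) x v = H.J a x (D Y x v)
  torsion : ∀ x (u v w : TangentSpace 𝓘(ℝ, E) x),
    g.inner x (D.torsion x u v) w = -g.inner x (D.torsion x u w) v

/-- `(M, H, g)` is an HKT manifold: `g` is hyper-Hermitian and there is a hyper-Hermitian
connection whose torsion is a 3-form. -/
def IsHKT (H : HypercomplexStructure E M) (g : Metric E M) : Prop :=
  IsHyperHermitian H g ∧
    ∃ D : CovariantDerivative 𝓘(ℝ, E) E (fun x : M => TangentSpace 𝓘(ℝ, E) x),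
      IsHKTConnection H g D

end HKTStructures

/-! ### Group actions and moment maps -/

section Actions

variable {E : Type*} [NormedAddCommGroup E] [NormedSpace ℝ E]
  {M : Type*} [TopologicalSpace M] [ChartedSpace E M]
  {EG : Type*} [NormedAddCommGroup EG] [NormedSpace ℝ EG]
  {G : Type*} [TopologicalSpace G] [ChartedSpace EG G] [Group G]

/-- The differential `dL_γ` at `x` of the action `L_γ : M → M` of a group element `γ`. -/
def dAction [MulAction G M] (γ : G) (x : M) :
    TangentSpace 𝓘(ℝ, E) x →L[ℝ] TangentSpace 𝓘(ℝ, E) (γ • x) :=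
  mfderiv 𝓘(ℝ, E) 𝓘(ℝ, E) (fun y : M => γ • y) x

/-- The value at `x` of the vector field generated by `X ∈ 𝔤`: the derivative at `1` of
`γ ↦ γ • x` in the direction `X` (using `1 • x = x`). -/
def fundamentalVector [MulAction G M] (X : GroupLieAlgebra 𝓘(ℝ, EG) G) (x : M) :
    TangentSpace 𝓘(ℝ, E) x :=
  mfderiv 𝓘(ℝ, EG) 𝓘(ℝ, E) (fun γ : G => γ • x) 1 X

/-- The adjoint action of `γ` on `𝔤 = T₁G`, the derivative at `1` of `h ↦ γ h γ⁻¹`. As a vector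
space `T₁G` is the model space `EG`. -/
def adjoint (γ : G) : EG →L[ℝ] EG :=
  mfderiv 𝓘(ℝ, EG) 𝓘(ℝ, EG) (fun h : G => γ * h * γ⁻¹) 1

/-- The coadjoint action of `γ` on `𝔤* = (EG →L[ℝ] ℝ)`: `ξ ↦ ξ ∘ Ad(γ⁻¹)`. -/
def coadjoint (γ : G) (ξ : EG →L[ℝ] ℝ) : EG →L[ℝ] ℝ :=
  ξ.comp (adjoint γ⁻¹)

variable [IsManifold 𝓘(ℝ, E) ∞ M] [MulAction G M]

variable (G) in
/-- `G` acts by hypercomplex automorphisms: `dL_γ ∘ I_a = I_a ∘ dL_γ`. -/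
def PreservesHypercomplex (H : HypercomplexStructure E M) : Prop :=
  ∀ (γ : G) a x (v : TangentSpace 𝓘(ℝ, E) x),
    dAction γ x (H.J a x v) = H.J a (γ • x) (dAction γ x v)

variable (G) in
/-- `G` acts by isometries. -/
def PreservesMetric (g : Metric E M) : Prop :=
  ∀ (γ : G) x (v w : TangentSpace 𝓘(ℝ, E) x),
    g.inner (γ • x) (dAction γ x v) (dAction γ x w) = g.inner x v w

/-- The `𝔤*`-valued 1-form `I_a dν_a`, with `(I_a α)(v) = -α(I_a v)`. -/
def twistedDifferential (H : HypercomplexStructure E M) (ν : Fin 3 → M → (EG →L[ℝ] ℝ))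
    (a : Fin 3) (x : M) : TangentSpace 𝓘(ℝ, E) x →L[ℝ] (EG →L[ℝ] ℝ) :=
  -((mfderiv 𝓘(ℝ, E) 𝓘(ℝ, EG →L[ℝ] ℝ) (ν a) x).comp (H.J a x))

variable (G) in
/-- `ν = (ν₁, ν₂, ν₃) : M → ℝ³ ⊗ 𝔤*` is a `G`-moment map. -/
structure IsGMomentMap (H : HypercomplexStructure E M) (ν : Fin 3 → M → (EG →L[ℝ] ℝ)) :
    Prop where
  smooth : ∀ a, ContMDiff 𝓘(ℝ, E) 𝓘(ℝ, EG →L[ℝ] ℝ) ∞ (ν a)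
  equivariant : ∀ (γ : G) a x, ν a (γ • x) = coadjoint γ (ν a x)
  cauchyRiemann : ∀ a b x, twistedDifferential H ν a x = twistedDifferential H ν b x
  transversal : ∀ a x (X : GroupLieAlgebra 𝓘(ℝ, EG) G), X ≠ 0 →
    twistedDifferential H ν a x (fundamentalVector X x) ≠ 0

variable (G) in
/-- The level set `P = ν⁻¹(ζ)`, as a `G`-invariant subset. -/
def levelSet (ν : Fin 3 → M → (EG →L[ℝ] ℝ)) (ζ : Fin 3 → (EG →L[ℝ] ℝ))
    (hinv : ∀ (γ : G) (x : M), (∀ a, ν a x = ζ a) → ∀ a, ν a (γ • x) = ζ a) :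
    SubMulAction G M where
  carrier := {x | ∀ a, ν a x = ζ a}
  smul_mem' := fun γ {x} hx => hinv γ x hx

/-- The reduced space `N = P / G` with the quotient topology. -/
abbrev ReducedSpace (P : SubMulAction G M) : Type _ := MulAction.orbitRel.Quotient G P

/-- The quotient map `π : P → N`. -/
def quotientMap (P : SubMulAction G M) : P → ReducedSpace P := Quotient.mk _

/-- The model space of the level set, of dimension `dim M - 3 dim G`. -/
abbrev LevelModel (E EG : Type*) [NormedAddCommGroup E] [NormedSpace ℝ E]
    [NormedAddCommGroup EG] [NormedSpace ℝ EG] : Type :=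
  EuclideanSpace ℝ (Fin (Module.finrank ℝ E - 3 * Module.finrank ℝ EG))

/-- The model space of the reduced space, of dimension `dim M - 4 dim G`. -/
abbrev ReducedModel (E EG : Type*) [NormedAddCommGroup E] [NormedSpace ℝ E]
    [NormedAddCommGroup EG] [NormedSpace ℝ EG] : Type :=
  EuclideanSpace ℝ (Fin (Module.finrank ℝ E - 4 * Module.finrank ℝ EG))

end Actions

/-! ### Horizontal vectors and the induced structure -/

section Reduction

variable {E : Type*} [NormedAddCommGroup E] [NormedSpace ℝ E]
  {M : Type*} [TopologicalSpace M] [ChartedSpace E M] [IsManifold 𝓘(ℝ, E) ∞ M]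
  {EG : Type*} [NormedAddCommGroup EG] [NormedSpace ℝ EG]
  {G : Type*} [Group G] [MulAction G M]
  {EP : Type*} [NormedAddCommGroup EP] [NormedSpace ℝ EP]
  {EN : Type*} [NormedAddCommGroup EN] [NormedSpace ℝ EN]

/-- The differential `T_pP → T_pM` of the inclusion of the level set. -/
def dIncl (P : SubMulAction G M) [ChartedSpace EP P] (p : P) :
    TangentSpace 𝓘(ℝ, EP) p →L[ℝ] TangentSpace 𝓘(ℝ, E) (p : M) :=
  mfderiv 𝓘(ℝ, EP) 𝓘(ℝ, E) (fun q : P => (q : M)) p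

/-- The differential `T_pP → T_{π(p)}N` of the quotient map. -/
def dQuot (P : SubMulAction G M) [ChartedSpace EP P] [ChartedSpace EN (ReducedSpace P)] (p : P) :
    TangentSpace 𝓘(ℝ, EP) p →L[ℝ] TangentSpace 𝓘(ℝ, EN) (quotientMap P p) :=
  mfderiv 𝓘(ℝ, EP) 𝓘(ℝ, EN) (quotientMap P) p

/-- The horizontal space `U_p = {t ∈ T_pP : I₁dν₁(t) = I₂dν₂(t) = I₃dν₃(t) = 0}`. -/
def IsHorizontal (H : HypercomplexStructure E M) (ν : Fin 3 → M → (EG →L[ℝ] ℝ))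
    (P : SubMulAction G M) [ChartedSpace EP P] (p : P) (t : TangentSpace 𝓘(ℝ, EP) p) : Prop :=
  ∀ a, twistedDifferential H ν a (p : M) (dIncl P p t) = 0

/-- The hypercomplex structure `H'` and the metric `g'` on `N = P / G` are induced by `H` and `g`
through horizontal lifts: each tangent vector of `N` at `π(p)` has a unique horizontal lift to
`T_pP`; if `u` is horizontal, so is `I_a u`, and `I_a (dπ u) = dπ (I_a u)`; and
`g'(dπ u, dπ v) = g(u, v)` for horizontal `u`, `v`. -/
structure IsInducedByHorizontalLifts (H : HypercomplexStructure E M) (g : Metric E M)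
    (ν : Fin 3 → M → (EG →L[ℝ] ℝ)) (P : SubMulAction G M) [ChartedSpace EP P]
    [ChartedSpace EN (ReducedSpace P)] [IsManifold 𝓘(ℝ, EN) ∞ (ReducedSpace P)]
    (H' : HypercomplexStructure EN (ReducedSpace P)) (g' : Metric EN (ReducedSpace P)) :
    Prop where
  lift : ∀ (p : P) (A : TangentSpace 𝓘(ℝ, EN) (quotientMap P p)),
    ∃! u : TangentSpace 𝓘(ℝ, EP) p, IsHorizontal H ν P p u ∧ dQuot P p u = A
  complex : ∀ a (p : P) (u : TangentSpace 𝓘(ℝ, EP) p), IsHorizontal H ν P p u →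
    ∃ u' : TangentSpace 𝓘(ℝ, EP) p, IsHorizontal H ν P p u' ∧
      dIncl P p u' = H.J a (p : M) (dIncl P p u) ∧
      H'.J a (quotientMap P p) (dQuot P p u) = dQuot P p u'
  metric : ∀ (p : P) (u v : TangentSpace 𝓘(ℝ, EP) p),
    IsHorizontal H ν P p u → IsHorizontal H ν P p v →
      g'.inner (quotientMap P p) (dQuot P p u) (dQuot P p v)
        = g.inner (p : M) (dIncl P p u) (dIncl P p v)

end Reduction

end HKT

end

set_option linter.unusedSectionVars false

/-! Write α for the common value of the I_a dν_a, V for the tangent spaces of the orbits and U for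
the horizontal spaces. Everything rests on the form (α, dν₁, dν₂, dν₃), called `momentForm`.
Precomposition with I_a permutes its components up to sign: α ∘ I_a = dν_a, dν_a ∘ I_a = −α and dν_b
∘ I_a = ±dν_c otherwise. At points of P the dν_a vanish on V, while transversality makes α an
isomorphism from V onto 𝔤*. Hence V together with the I_a V already fills the target
(`momentForm_surjective`), P has codimension 3 dim G, and TP = U ⊕ V with U the kernel of the form,
a quaternionic subspace.

The manifold structures come from slice charts of M adapted both to P and to its orbits
(`exists_isSliceChart`): a transversal is spread out by G, and compactness and freeness make a small
transversal meet each orbit in P at most once.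

Horizontal lifts are carried to horizontal lifts by G, so I_a and g descend. The bracket of two
lifts is tangent to P; its U-part lifts the bracket on N, and its V-part is measured by Ω = dα on U.
Integrability of I_a on M says [I_a W, I_a W'] − [W, W'] = I_a([I_a W, W'] + [W, I_a W']). Applying
dν_a and α to it (`IsMomentReduction.momentForm_nijenhuis`) yields both the integrability of the
reduced structure and the fact that Ω is of type (1,1) for every I_a.

Since U need not be orthogonal to V, projecting the connection of M to U does not suffice. The
reduced connection is ĝ(∇̂_A Y, C) = g(∇_A Y, C) − g(A, Ψ(Y, C)), with lifts understood, where Ψ(Y,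
C) is the vertical vector whose α-value is Ω(Y, C). Skewness of Ψ keeps the metric parallel, type
(1,1) keeps the I_a parallel, and the torsion changes by a cyclic sum, again a 3-form
(`IsMomentReduction.exists_hktConnAt`).

This is done at one point at a time, for an operator with the properties `HKTConnAt`. No patching is
needed: the Koszul formula, whose torsion term equals dF_a(I_a·, I_a·, I_a·), determines the
operator on smooth fields from the metric and I_a, so pointwise choices form a smooth connection
(`isHKT_of_hktConnAt`). The same relation between dF_a and the torsion reduces the vanishing of the
(0,3)-part to linear algebra (`torsionCyclic_zeroThree`). -/

noncomputable section

namespace HKT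

universe u

/-! ### Vector fields in charts and the Lie bracket as a commutator -/

section Calculus

variable {E : Type*} [NormedAddCommGroup E] [NormedSpace ℝ E]
  {M : Type*} [TopologicalSpace M] [ChartedSpace E M] [IsManifold 𝓘(ℝ, E) ∞ M]
  {F : Type*} [NormedAddCommGroup F] [NormedSpace ℝ F]

/-- The (not necessarily continuous) vector field `X` is differentiable at the point `x`. -/
abbrev DiffAt (X : (x : M) → TangentSpace 𝓘(ℝ, E) x) (x : M) : Prop :=
  MDifferentiableAt 𝓘(ℝ, E) 𝓘(ℝ, E).tangent
    (fun y => (⟨y, X y⟩ : TangentBundle 𝓘(ℝ, E) M)) x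

theorem SmoothAt.diffAt {X : (x : M) → TangentSpace 𝓘(ℝ, E) x} {x : M} (h : SmoothAt X x) :
    DiffAt X x :=
  ContMDiffAt.mdifferentiableAt h (by simp)

/-- The derivative of a vector-valued function along a vector field. -/
def der (f : M → F) (X : (x : M) → TangentSpace 𝓘(ℝ, E) x) (x : M) : F :=
  mfderiv 𝓘(ℝ, E) 𝓘(ℝ, F) f x (X x)

/-- The representation of a vector field in the preferred chart at `x₀`. -/
def chartField (x₀ : M) (X : (x : M) → TangentSpace 𝓘(ℝ, E) x) : E → E :=
  mpullbackWithin 𝓘(ℝ, E) 𝓘(ℝ, E) (extChartAt 𝓘(ℝ, E) x₀).symm X (Set.range 𝓘(ℝ, E))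

theorem chartField_apply {x₀ y : M} (hy : y ∈ (extChartAt 𝓘(ℝ, E) x₀).source)
    (X : (x : M) → TangentSpace 𝓘(ℝ, E) x) :
    chartField x₀ X (extChartAt 𝓘(ℝ, E) x₀ y) =
      mfderiv 𝓘(ℝ, E) 𝓘(ℝ, E) (extChartAt 𝓘(ℝ, E) x₀) y (X y) := by
  have h1 : (extChartAt 𝓘(ℝ, E) x₀).symm (extChartAt 𝓘(ℝ, E) x₀ y) = y :=
    (extChartAt 𝓘(ℝ, E) x₀).left_inv hy
  have key : (mfderivWithin 𝓘(ℝ, E) 𝓘(ℝ, E) (extChartAt 𝓘(ℝ, E) x₀).symm (Set.range 𝓘(ℝ, E))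
      (extChartAt 𝓘(ℝ, E) x₀ y)).inverse =
      mfderiv 𝓘(ℝ, E) 𝓘(ℝ, E) (extChartAt 𝓘(ℝ, E) x₀)
        ((extChartAt 𝓘(ℝ, E) x₀).symm (extChartAt 𝓘(ℝ, E) x₀ y)) := by
    apply ContinuousLinearMap.inverse_eq
    · exact mfderivWithin_extChartAt_symm_comp_mfderiv_extChartAt
        ((extChartAt 𝓘(ℝ, E) x₀).map_source hy)
    · exact mfderiv_extChartAt_comp_mfderivWithin_extChartAt_symm
        ((extChartAt 𝓘(ℝ, E) x₀).map_source hy)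
  unfold chartField
  rw [mpullbackWithin_apply, key, h1]

theorem mfderiv_eq_fderiv_chart {x₀ y : M} (hy : y ∈ (extChartAt 𝓘(ℝ, E) x₀).source)
    {f : M → F} (hf : MDifferentiableAt 𝓘(ℝ, E) 𝓘(ℝ, F) f y) (v : TangentSpace 𝓘(ℝ, E) y) :
    mfderiv 𝓘(ℝ, E) 𝓘(ℝ, F) f y v =
      fderiv ℝ (f ∘ (extChartAt 𝓘(ℝ, E) x₀).symm) (extChartAt 𝓘(ℝ, E) x₀ y)
        (mfderiv 𝓘(ℝ, E) 𝓘(ℝ, E) (extChartAt 𝓘(ℝ, E) x₀) y v) := by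
  have h1 : (extChartAt 𝓘(ℝ, E) x₀).symm (extChartAt 𝓘(ℝ, E) x₀ y) = y :=
    (extChartAt 𝓘(ℝ, E) x₀).left_inv hy
  have hy' : y ∈ (chartAt E x₀).source := by simpa using hy
  have hφ : MDifferentiableAt 𝓘(ℝ, E) 𝓘(ℝ, E) (extChartAt 𝓘(ℝ, E) x₀) y :=
    mdifferentiableAt_extChartAt hy'
  have hs : MDifferentiableAt 𝓘(ℝ, E) 𝓘(ℝ, E) (extChartAt 𝓘(ℝ, E) x₀).symm
      (extChartAt 𝓘(ℝ, E) x₀ y) := by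
    have := mdifferentiableWithinAt_extChartAt_symm (I := 𝓘(ℝ, E)) (x := x₀)
      ((extChartAt 𝓘(ℝ, E) x₀).map_source hy)
    rwa [modelWithCornersSelf_coe, Set.range_id, mdifferentiableWithinAt_univ] at this
  have hf' : MDifferentiableAt 𝓘(ℝ, E) 𝓘(ℝ, F) (f ∘ (extChartAt 𝓘(ℝ, E) x₀).symm)
      (extChartAt 𝓘(ℝ, E) x₀ y) := by
    apply MDifferentiableAt.comp _ _ hs
    rw [h1]; exact hf
  have hev : f =ᶠ[𝓝 y] (f ∘ (extChartAt 𝓘(ℝ, E) x₀).symm) ∘ (extChartAt 𝓘(ℝ, E) x₀) := by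
    filter_upwards [extChartAt_source_mem_nhds' (I := 𝓘(ℝ, E)) hy] with z hz
    exact congrArg f ((extChartAt 𝓘(ℝ, E) x₀).left_inv hz).symm
  rw [hev.mfderiv_eq, mfderiv_comp y hf' hφ, ← mfderiv_eq_fderiv]
  rfl

theorem trivializationAt_snd_eq {x₀ y : M} (hy : y ∈ (extChartAt 𝓘(ℝ, E) x₀).source)
    (v : TangentSpace 𝓘(ℝ, E) y) :
    (trivializationAt E (TangentSpace 𝓘(ℝ, E) : M → Type _) x₀ ⟨y, v⟩).2 =
      mfderiv 𝓘(ℝ, E) 𝓘(ℝ, E) (extChartAt 𝓘(ℝ, E) x₀) y v := by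
  have hy' : y ∈ (chartAt E x₀).source := by simpa using hy
  have h1 := TangentBundle.continuousLinearMapAt_trivializationAt (I := 𝓘(ℝ, E)) hy'
  have hb : y ∈ (trivializationAt E (TangentSpace 𝓘(ℝ, E) : M → Type _) x₀).baseSet := by
    simpa using hy
  refine Eq.trans ?_ (DFunLike.congr_fun h1 v)
  rw [Bundle.Trivialization.continuousLinearMapAt_apply,
    Bundle.Trivialization.coe_linearMapAt_of_mem _ hb]

theorem diffAt_iff {X : (x : M) → TangentSpace 𝓘(ℝ, E) x} {x₀ x : M}
    (hx : x ∈ (extChartAt 𝓘(ℝ, E) x₀).source) :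
    DiffAt X x ↔ MDifferentiableAt 𝓘(ℝ, E) 𝓘(ℝ, E)
      (fun y => chartField x₀ X (extChartAt 𝓘(ℝ, E) x₀ y)) x := by
  have hx' : x ∈ (trivializationAt E (TangentSpace 𝓘(ℝ, E) : M → Type _) x₀).baseSet := by
    simpa using hx
  refine (Bundle.Trivialization.mdifferentiableAt_section_iff 𝓘(ℝ, E)
    (trivializationAt E (TangentSpace 𝓘(ℝ, E) : M → Type _) x₀) X hx').trans ?_
  apply Filter.EventuallyEq.mdifferentiableAt_iff
  filter_upwards [extChartAt_source_mem_nhds' (I := 𝓘(ℝ, E)) hx] with y hy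
  rw [trivializationAt_snd_eq hy, chartField_apply hy]

theorem smoothAt_iff {X : (x : M) → TangentSpace 𝓘(ℝ, E) x} {x₀ x : M}
    (hx : x ∈ (extChartAt 𝓘(ℝ, E) x₀).source) :
    SmoothAt X x ↔ ContMDiffAt 𝓘(ℝ, E) 𝓘(ℝ, E) ∞
      (fun y => chartField x₀ X (extChartAt 𝓘(ℝ, E) x₀ y)) x := by
  have hx' : x ∈ (trivializationAt E (TangentSpace 𝓘(ℝ, E) : M → Type _) x₀).baseSet := by
    simpa using hx
  refine (Bundle.Trivialization.contMDiffAt_section_iff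
    (trivializationAt E (TangentSpace 𝓘(ℝ, E) : M → Type _) x₀) hx').trans ?_
  apply Filter.EventuallyEq.contMDiffAt_iff
  filter_upwards [extChartAt_source_mem_nhds' (I := 𝓘(ℝ, E)) hx] with y hy
  rw [trivializationAt_snd_eq hy, chartField_apply hy]

theorem mdifferentiableAt_extChartAt_symm_self (x₀ : M) {z : E}
    (hz : z ∈ (extChartAt 𝓘(ℝ, E) x₀).target) :
    MDifferentiableAt 𝓘(ℝ, E) 𝓘(ℝ, E) (extChartAt 𝓘(ℝ, E) x₀).symm z := by
  have := mdifferentiableWithinAt_extChartAt_symm (I := 𝓘(ℝ, E)) (x := x₀) hz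
  rwa [modelWithCornersSelf_coe, Set.range_id, mdifferentiableWithinAt_univ] at this

theorem contMDiffAt_extChartAt_symm_self (x₀ : M) {z : E}
    (hz : z ∈ (extChartAt 𝓘(ℝ, E) x₀).target) :
    ContMDiffAt 𝓘(ℝ, E) 𝓘(ℝ, E) ∞ (extChartAt 𝓘(ℝ, E) x₀).symm z :=
  (contMDiffOn_extChartAt_symm x₀).contMDiffAt ((isOpen_extChartAt_target x₀).mem_nhds hz)

theorem DiffAt.chartField {X : (x : M) → TangentSpace 𝓘(ℝ, E) x} {x : M} (h : DiffAt X x) :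
    DifferentiableAt ℝ (chartField x X) (extChartAt 𝓘(ℝ, E) x x) := by
  have h1 := (diffAt_iff (mem_extChartAt_source x)).1 h
  rw [← mdifferentiableAt_iff_differentiableAt]
  have h2 := mdifferentiableAt_extChartAt_symm_self x (mem_extChartAt_target (I := 𝓘(ℝ, E)) x)
  have h3 := MDifferentiableAt.comp_of_eq (extChartAt 𝓘(ℝ, E) x x) h1 h2
    (extChartAt_to_inv (I := 𝓘(ℝ, E)) x)
  refine h3.congr_of_eventuallyEq ?_
  filter_upwards [(isOpen_extChartAt_target (I := 𝓘(ℝ, E)) x).mem_nhds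
    (mem_extChartAt_target (I := 𝓘(ℝ, E)) x)] with z hz
  exact congrArg _ ((extChartAt 𝓘(ℝ, E) x).right_inv hz).symm

theorem contDiffAt_comp_extChartAt_symm {f : M → F} {x : M} {n : ℕ∞}
    (hf : ContMDiffAt 𝓘(ℝ, E) 𝓘(ℝ, F) n f x) :
    ContDiffAt ℝ n (f ∘ (extChartAt 𝓘(ℝ, E) x).symm) (extChartAt 𝓘(ℝ, E) x x) := by
  rw [← contMDiffAt_iff_contDiffAt]
  apply ContMDiffAt.comp_of_eq (x := extChartAt 𝓘(ℝ, E) x x) hf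
  · exact (contMDiffAt_extChartAt_symm_self x (mem_extChartAt_target x)).of_le (by exact_mod_cast le_top)
  · exact extChartAt_to_inv x

/-- The manifold bracket is the vector-space bracket transported through this very chart, so only
the derivative of the chart and its inverse have to be cancelled. -/
theorem chartField_mlieBracket (X Y : (x : M) → TangentSpace 𝓘(ℝ, E) x) (x : M) :
    mfderiv 𝓘(ℝ, E) 𝓘(ℝ, E) (extChartAt 𝓘(ℝ, E) x) x (mlieBracket 𝓘(ℝ, E) X Y x) =
      lieBracket ℝ (chartField x X) (chartField x Y) (extChartAt 𝓘(ℝ, E) x x) := by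
  refine ((isInvertible_mfderiv_extChartAt (I := 𝓘(ℝ, E)) (mem_extChartAt_source x)).self_apply_inverse
    _).trans ?_
  refine (congrArg (fun s => lieBracketWithin ℝ (chartField x X) (chartField x Y) s
    (extChartAt 𝓘(ℝ, E) x x)) ?_).trans (congrFun (lieBracketWithin_univ ..) _)
  simp

theorem der_eq_chart {f : M → F} {x : M} (hf : ContMDiffAt 𝓘(ℝ, E) 𝓘(ℝ, F) 1 f x)
    (X : (x : M) → TangentSpace 𝓘(ℝ, E) x) :
    der f X =ᶠ[𝓝 x] (fun z => fderiv ℝ (f ∘ (extChartAt 𝓘(ℝ, E) x).symm) z (chartField x X z)) ∘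
      extChartAt 𝓘(ℝ, E) x := by
  have hf' : ∀ᶠ y in 𝓝 x, ContMDiffAt 𝓘(ℝ, E) 𝓘(ℝ, F) 1 f y :=
    (contMDiffAt_iff_contMDiffAt_nhds (by simp)).1 hf
  filter_upwards [hf', extChartAt_source_mem_nhds (I := 𝓘(ℝ, E)) x]
    with y hy hys
  rw [der, mfderiv_eq_fderiv_chart hys (hy.mdifferentiableAt (by simp)), Function.comp_apply,
    chartField_apply hys]

theorem differentiableAt_fderiv_apply {f : E → F} {X : E → E} {z : E} (hf : ContDiffAt ℝ 2 f z)
    (hX : DifferentiableAt ℝ X z) : DifferentiableAt ℝ (fun w => fderiv ℝ f w (X w)) z :=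
  ((hf.fderiv_right (m := 1) (by norm_num)).differentiableAt (by simp)).clm_apply hX

theorem DiffAt.der {f : M → F} {x : M} (hf : ContMDiffAt 𝓘(ℝ, E) 𝓘(ℝ, F) 2 f x)
    {X : (x : M) → TangentSpace 𝓘(ℝ, E) x} (hX : DiffAt X x) :
    MDifferentiableAt 𝓘(ℝ, E) 𝓘(ℝ, F) (der f X) x := by
  refine MDifferentiableAt.congr_of_eventuallyEq ?_ (der_eq_chart (hf.of_le (by norm_num)) X)
  exact MDifferentiableAt.comp x (differentiableAt_fderiv_apply
    (contDiffAt_comp_extChartAt_symm hf) hX.chartField).mdifferentiableAt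
    (mdifferentiableAt_extChartAt (mem_chart_source E x))

theorem der_der {f : M → F} {x : M} (hf : ContMDiffAt 𝓘(ℝ, E) 𝓘(ℝ, F) 2 f x)
    {X : (x : M) → TangentSpace 𝓘(ℝ, E) x} (hX : DiffAt X x)
    (Y : (x : M) → TangentSpace 𝓘(ℝ, E) x) :
    HKT.der (HKT.der f X) Y x =
      fderiv ℝ (fun z => fderiv ℝ (f ∘ (extChartAt 𝓘(ℝ, E) x).symm) z (HKT.chartField x X z))
        (extChartAt 𝓘(ℝ, E) x x) (HKT.chartField x Y (extChartAt 𝓘(ℝ, E) x x)) := by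
  rw [HKT.der, (der_eq_chart (hf.of_le (by norm_num)) X).mfderiv_eq,
    mfderiv_comp x (differentiableAt_fderiv_apply
    (contDiffAt_comp_extChartAt_symm hf) hX.chartField).mdifferentiableAt
    (mdifferentiableAt_extChartAt (mem_chart_source E x)),
    mfderiv_eq_fderiv]
  exact congrArg _ (chartField_apply (mem_extChartAt_source x) Y).symm

/-- The Lie bracket of vector fields is the commutator of derivations. -/
theorem mfderiv_mlieBracket {f : M → F} {x : M} (hf : ContMDiffAt 𝓘(ℝ, E) 𝓘(ℝ, F) 2 f x)
    {X Y : (x : M) → TangentSpace 𝓘(ℝ, E) x} (hX : DiffAt X x) (hY : DiffAt Y x) :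
    mfderiv 𝓘(ℝ, E) 𝓘(ℝ, F) f x (mlieBracket 𝓘(ℝ, E) X Y x) =
      der (der f Y) X x - der (der f X) Y x := by
  rw [mfderiv_eq_fderiv_chart (mem_extChartAt_source x)
    (hf.mdifferentiableAt (by norm_num)), chartField_mlieBracket, der_der hf hY, der_der hf hX]
  have h2 := contDiffAt_comp_extChartAt_symm (n := 2) hf
  have hd := (h2.fderiv_right (m := 1) (by norm_num)).differentiableAt (by simp)
  rw [fderiv_clm_apply hd hX.chartField, fderiv_clm_apply hd hY.chartField]
  -- The second-order terms cancel by symmetry of the second derivative; what survives is the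
  -- bracket.
  have hs := (h2.isSymmSndFDerivAt (by simp)).eq (chartField x X (extChartAt 𝓘(ℝ, E) x x))
    (chartField x Y (extChartAt 𝓘(ℝ, E) x x))
  simp only [lieBracket, map_sub, add_apply, ContinuousLinearMap.comp_apply,
    ContinuousLinearMap.flip_apply]
  rw [hs]
  abel

end Calculus

/-! ### Smoothness of sections of homomorphism bundles -/

section HomSections

variable {E : Type*} [NormedAddCommGroup E] [NormedSpace ℝ E]
  {M : Type*} [TopologicalSpace M] [ChartedSpace E M]

/-- In finite dimension a family of linear maps is the finite sum of its values on a basis times the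
coordinate functionals. -/
theorem contMDiffAt_clm_of_apply {F₁ F₂ : Type*} [NormedAddCommGroup F₁] [NormedSpace ℝ F₁]
    [FiniteDimensional ℝ F₁] [NormedAddCommGroup F₂] [NormedSpace ℝ F₂] {n : ℕ∞}
    {A : M → F₁ →L[ℝ] F₂} {x : M}
    (h : ∀ w, ContMDiffAt 𝓘(ℝ, E) 𝓘(ℝ, F₂) n (fun y => A y w) x) :
    ContMDiffAt 𝓘(ℝ, E) 𝓘(ℝ, F₁ →L[ℝ] F₂) n A x := by
  let b := Module.finBasis ℝ F₁
  let c : Fin (Module.finrank ℝ F₁) → F₁ →L[ℝ] ℝ := fun i => LinearMap.toContinuousLinearMap (b.coord i)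
  have hA : A = fun y => ∑ i, ContinuousLinearMap.smulRightL ℝ F₁ F₂ (c i) (A y (b i)) := by
    funext y
    ext w
    calc A y w = A y (∑ i, b.repr w i • b i) := by rw [b.sum_repr]
      _ = _ := by rw [map_sum]; simp [c, sum_apply]
  rw [hA]
  apply ContMDiffAt.sum
  intro i _
  exact (ContinuousLinearMap.contMDiff (ContinuousLinearMap.smulRightL ℝ F₁ F₂ (c i))).contMDiffAt.comp x
    (h (b i))

variable {F₁ F₂ : Type*} [NormedAddCommGroup F₁] [NormedSpace ℝ F₁] [FiniteDimensional ℝ F₁]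
  [NormedAddCommGroup F₂] [NormedSpace ℝ F₂]
  {V₁ V₂ : M → Type*} [TopologicalSpace (Bundle.TotalSpace F₁ V₁)]
  [∀ x, AddCommGroup (V₁ x)] [∀ x, Module ℝ (V₁ x)] [∀ x, TopologicalSpace (V₁ x)]
  [FiberBundle F₁ V₁] [VectorBundle ℝ F₁ V₁]
  [TopologicalSpace (Bundle.TotalSpace F₂ V₂)]
  [∀ x, AddCommGroup (V₂ x)] [∀ x, Module ℝ (V₂ x)] [∀ x, TopologicalSpace (V₂ x)]
  [∀ x, IsTopologicalAddGroup (V₂ x)] [∀ x, ContinuousSMul ℝ (V₂ x)]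
  [FiberBundle F₂ V₂] [VectorBundle ℝ F₂ V₂]

/-- A section of a bundle of homomorphisms is smooth if it maps smooth sections to smooth
sections. -/
theorem contMDiffAt_hom_of_apply {n : ℕ∞} [ContMDiffVectorBundle n F₁ V₁ 𝓘(ℝ, E)]
    [ContMDiffVectorBundle n F₂ V₂ 𝓘(ℝ, E)] {φ : ∀ x, V₁ x →L[ℝ] V₂ x} {x₀ : M}
    (h : ∀ v : ∀ x, V₁ x, (∀ᶠ y in 𝓝 x₀, ContMDiffAt 𝓘(ℝ, E) (𝓘(ℝ, E).prod 𝓘(ℝ, F₁)) n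
      (fun x => Bundle.TotalSpace.mk' F₁ x (v x)) y) →
      ContMDiffAt 𝓘(ℝ, E) (𝓘(ℝ, E).prod 𝓘(ℝ, F₂)) n
      (fun x => Bundle.TotalSpace.mk' F₂ x (φ x (v x))) x₀) :
    ContMDiffAt 𝓘(ℝ, E) (𝓘(ℝ, E).prod 𝓘(ℝ, F₁ →L[ℝ] F₂)) n
      (fun x => Bundle.TotalSpace.mk' (F₁ →L[ℝ] F₂) (E := fun x => V₁ x →L[ℝ] V₂ x) x (φ x)) x₀ := by
  rw [contMDiffAt_hom_bundle]
  refine ⟨contMDiffAt_id, contMDiffAt_clm_of_apply fun w => ?_⟩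
  let t₁ := trivializationAt F₁ V₁ x₀
  let t₂ := trivializationAt F₂ V₂ x₀
  have hx₁ : x₀ ∈ t₁.baseSet := FiberBundle.mem_baseSet_trivializationAt' x₀
  have hx₂ : x₀ ∈ t₂.baseSet := FiberBundle.mem_baseSet_trivializationAt' x₀
  -- The frame of the trivialization at `x₀` provides all the test sections needed, and they are
  -- smooth on a whole neighbourhood.
  have hv : ∀ᶠ y in 𝓝 x₀, ContMDiffAt 𝓘(ℝ, E) (𝓘(ℝ, E).prod 𝓘(ℝ, F₁)) n
      (fun x => Bundle.TotalSpace.mk' F₁ x (t₁.symm x w)) y := by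
    filter_upwards [t₁.open_baseSet.mem_nhds hx₁] with y hy
    rw [t₁.contMDiffAt_section_iff hy]
    refine (contMDiffAt_const (c := w)).congr_of_eventuallyEq ?_
    filter_upwards [t₁.open_baseSet.mem_nhds hy] with x hx
    have := t₁.apply_mk_symm hx w
    exact congrArg Prod.snd this
  have h2 := (t₂.contMDiffAt_section_iff hx₂).1 (h _ hv)
  refine h2.congr_of_eventuallyEq ?_
  filter_upwards [t₁.open_baseSet.mem_nhds hx₁, t₂.open_baseSet.mem_nhds hx₂] with x h₁ h₂
  rw [ContinuousLinearMap.inCoordinates_eq h₁ h₂]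
  simp [t₁, t₂]

end HomSections

/-! ### Operations preserving smoothness of vector fields -/

section Fields

variable {E : Type*} [NormedAddCommGroup E] [NormedSpace ℝ E]
  {M : Type*} [TopologicalSpace M] [ChartedSpace E M] [IsManifold 𝓘(ℝ, E) ∞ M]
  {F : Type*} [NormedAddCommGroup F] [NormedSpace ℝ F] {x : M}
  {X Y Z : (x : M) → TangentSpace 𝓘(ℝ, E) x}

theorem SmoothAt.add (hX : SmoothAt X x) (hY : SmoothAt Y x) : SmoothAt (X + Y) x :=
  ContMDiffAt.add_section hX hY

theorem SmoothAt.neg (hX : SmoothAt X x) : SmoothAt (-X) x :=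
  ContMDiffAt.neg_section hX

theorem exists_smoothAt_eq (v : TangentSpace 𝓘(ℝ, E) x) :
    ∃ X : (x : M) → TangentSpace 𝓘(ℝ, E) x, SmoothAt X x ∧ X x = v :=
  ⟨FiberBundle.extend E v, FiberBundle.contMDiffAt_extend 𝓘(ℝ, E) E v,
    FiberBundle.extend_apply_self E v⟩

theorem SmoothAt.congr (hX : SmoothAt X x) (h : ∀ᶠ y in 𝓝 x, Y y = X y) : SmoothAt Y x :=
  ContMDiffAt.congr_of_eventuallyEq hX (h.mono fun y hy => by simp [hy])

theorem SmoothAt.contMDiffAt_der {f : M → F} (hf : ContMDiffAt 𝓘(ℝ, E) 𝓘(ℝ, F) ∞ f x)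
    (hX : SmoothAt X x) : ContMDiffAt 𝓘(ℝ, E) 𝓘(ℝ, F) ∞ (der f X) x := by
  refine ContMDiffAt.congr_of_eventuallyEq ?_ (der_eq_chart (hf.of_le (by simp)) X)
  have h1 : ContDiffAt ℝ ∞ (chartField x X) (extChartAt 𝓘(ℝ, E) x x) := by
    have h1 := (smoothAt_iff (mem_extChartAt_source x)).1 hX
    rw [← contMDiffAt_iff_contDiffAt]
    have h3 := ContMDiffAt.comp_of_eq (x := extChartAt 𝓘(ℝ, E) x x) h1
      (contMDiffAt_extChartAt_symm_self x (mem_extChartAt_target x))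
      (extChartAt_to_inv (I := 𝓘(ℝ, E)) x)
    refine h3.congr_of_eventuallyEq ?_
    filter_upwards [(isOpen_extChartAt_target (I := 𝓘(ℝ, E)) x).mem_nhds
      (mem_extChartAt_target (I := 𝓘(ℝ, E)) x)] with z hz
    exact congrArg _ ((extChartAt 𝓘(ℝ, E) x).right_inv hz).symm
  have h2 := contDiffAt_comp_extChartAt_symm (n := ⊤) hf
  have h3 : ContDiffAt ℝ ∞ (fun z => fderiv ℝ (f ∘ (extChartAt 𝓘(ℝ, E) x).symm) z
      (chartField x X z)) (extChartAt 𝓘(ℝ, E) x x) :=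
    (h2.fderiv_right (m := ∞) (by simp)).clm_apply h1
  exact h3.contMDiffAt.comp x (contMDiffAt_extChartAt)

theorem SmoothAt.mlieBracket [CompleteSpace E] (hX : SmoothAt X x) (hY : SmoothAt Y x) :
    SmoothAt (mlieBracket 𝓘(ℝ, E) X Y) x := by
  have : IsManifold 𝓘(ℝ, E) (((⊤ : ℕ∞) : WithTop ℕ∞) + 1) M := by
    simpa using (inferInstance : IsManifold 𝓘(ℝ, E) ∞ M)
  have : IsManifold 𝓘(ℝ, E) (minSmoothness ℝ 2) M := by
    rw [minSmoothness_of_isRCLikeNormedField]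
    exact IsManifold.of_le (n := ∞) (by norm_cast)
  exact ContMDiffAt.mlieBracket_vectorField (n := ⊤) (m := ⊤) hX hY (by simp)

section Hyper

variable (H : HypercomplexStructure E M) (g : Metric E M)

theorem SmoothAt.applyField (a : Fin 3) (hX : SmoothAt X x) : SmoothAt (applyField (H.J a) X) x :=
  ContMDiffAt.clm_bundle_apply (H.smooth a x) hX

theorem contMDiffAt_inner (hX : SmoothAt X x) (hY : SmoothAt Y x) :
    ContMDiffAt 𝓘(ℝ, E) 𝓘(ℝ, ℝ) ∞ (fun y => g.inner y (X y) (Y y)) x := by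
  have := ContMDiffAt.clm_bundle_apply₂ (E₃ := Bundle.Trivial M ℝ) (F₃ := ℝ) (g.contMDiff x) hX hY
  rw [Bundle.contMDiffAt_section] at this
  exact this

theorem mdifferentiableAt_inner (hX : DiffAt X x) (hY : DiffAt Y x) :
    MDifferentiableAt 𝓘(ℝ, E) 𝓘(ℝ, ℝ) (fun y => g.inner y (X y) (Y y)) x := by
  have := MDifferentiableAt.clm_bundle_apply₂ (E₃ := Bundle.Trivial M ℝ) (F₃ := ℝ)
    ((g.contMDiff x).mdifferentiableAt (by simp)) hX hY
  rw [mdifferentiableAt_section] at this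
  exact this

end Hyper

end Fields

/-! ### Vector-valued 1-forms, their inverses and exterior derivatives -/

section Forms

variable {E : Type*} [NormedAddCommGroup E] [NormedSpace ℝ E] [FiniteDimensional ℝ E]
  {M : Type*} [TopologicalSpace M] [ChartedSpace E M] [IsManifold 𝓘(ℝ, E) ∞ M]
  {F : Type*} [NormedAddCommGroup F] [NormedSpace ℝ F] {x : M}
  {X Y Z : (x : M) → TangentSpace 𝓘(ℝ, E) x}

/-- The vector-valued 1-form `θ` is smooth at the point `x`. -/
def SmoothFormAt (θ : (x : M) → TangentSpace 𝓘(ℝ, E) x →L[ℝ] F) (x : M) : Prop :=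
  ∀ X : (x : M) → TangentSpace 𝓘(ℝ, E) x, SmoothAt X x →
    ContMDiffAt 𝓘(ℝ, E) 𝓘(ℝ, F) ∞ (fun y => θ y (X y)) x

/-- A 1-form read in the trivialization of the tangent bundle at `x₀`. -/
def formInChart (θ : (x : M) → TangentSpace 𝓘(ℝ, E) x →L[ℝ] F) (x₀ y : M) : E →L[ℝ] F :=
  (θ y).comp ((trivializationAt E (TangentSpace 𝓘(ℝ, E) : M → Type _) x₀).symmL ℝ y)

theorem SmoothFormAt.contMDiffAt_formInChart
    {θ : (x : M) → TangentSpace 𝓘(ℝ, E) x →L[ℝ] F} (h : SmoothFormAt θ x) :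
    ContMDiffAt 𝓘(ℝ, E) 𝓘(ℝ, E →L[ℝ] F) ∞ (formInChart θ x) x := by
  refine contMDiffAt_clm_of_apply (n := ⊤) fun w => ?_
  let t := trivializationAt E (TangentSpace 𝓘(ℝ, E) : M → Type _) x
  have hx : x ∈ t.baseSet := FiberBundle.mem_baseSet_trivializationAt' x
  apply h (fun y => t.symmL ℝ y w)
  refine (t.contMDiffAt_section_iff hx).2 ?_
  refine (contMDiffAt_const (c := w)).congr_of_eventuallyEq ?_
  filter_upwards [t.open_baseSet.mem_nhds hx] with y hy
  rw [t.symmL_apply (R := ℝ) hy]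
  exact congrArg Prod.snd (t.apply_mk_symm hy w)

theorem formInChart_apply (θ : (x : M) → TangentSpace 𝓘(ℝ, E) x →L[ℝ] F) {x₀ y : M}
    (hy : y ∈ (trivializationAt E (TangentSpace 𝓘(ℝ, E) : M → Type _) x₀).baseSet)
    (v : TangentSpace 𝓘(ℝ, E) y) :
    formInChart θ x₀ y
      ((trivializationAt E (TangentSpace 𝓘(ℝ, E) : M → Type _) x₀) ⟨y, v⟩).2 = θ y v := by
  let t := trivializationAt E (TangentSpace 𝓘(ℝ, E) : M → Type _) x₀
  have h1 : t.symmL ℝ y (t ⟨y, v⟩).2 = v := by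
    rw [t.symmL_apply (R := ℝ) hy]; exact t.symm_apply_apply_mk hy v
  exact congrArg (θ y) h1

/-- Smoothness of `θ` is tested on smooth fields only. Read in a trivialization, `θ` becomes a
smooth family of linear maps, which can be paired with a merely differentiable field, as
tensoriality arguments demand. -/
theorem SmoothFormAt.mdifferentiableAt {θ : (x : M) → TangentSpace 𝓘(ℝ, E) x →L[ℝ] F}
    (h : SmoothFormAt θ x) (hX : DiffAt X x) :
    MDifferentiableAt 𝓘(ℝ, E) 𝓘(ℝ, F) (fun y => θ y (X y)) x := by
  let t := trivializationAt E (TangentSpace 𝓘(ℝ, E) : M → Type _) x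
  have hx : x ∈ t.baseSet := FiberBundle.mem_baseSet_trivializationAt' x
  have h1 := (t.mdifferentiableAt_section_iff 𝓘(ℝ, E) X hx).1 hX
  have h2 := (h.contMDiffAt_formInChart.mdifferentiableAt (by simp)).clm_apply h1
  refine h2.congr_of_eventuallyEq ?_
  filter_upwards [t.open_baseSet.mem_nhds hx] with y hy
  exact (formInChart_apply θ hy (X y)).symm

theorem isInvertible_formInChart_iff (θ : (x : M) → TangentSpace 𝓘(ℝ, E) x →L[ℝ] F) {x₀ y : M}
    (hy : y ∈ (trivializationAt E (TangentSpace 𝓘(ℝ, E) : M → Type _) x₀).baseSet) :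
    (formInChart θ x₀ y).IsInvertible ↔ (θ y).IsInvertible := by
  let t := trivializationAt E (TangentSpace 𝓘(ℝ, E) : M → Type _) x₀
  have : formInChart θ x₀ y = (θ y).comp
      ((t.continuousLinearEquivAt ℝ y hy).symm : E →L[ℝ] TangentSpace 𝓘(ℝ, E) y) := by
    rw [t.symm_continuousLinearEquivAt_eq' hy]; rfl
  rw [this, ContinuousLinearMap.isInvertible_comp_equiv]

theorem SmoothFormAt.eventually_isInvertible {θ : (x : M) → TangentSpace 𝓘(ℝ, E) x →L[ℝ] F}
    (h : SmoothFormAt θ x) (hx : (θ x).IsInvertible) : ∀ᶠ y in 𝓝 x, (θ y).IsInvertible := by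
  let t := trivializationAt E (TangentSpace 𝓘(ℝ, E) : M → Type _) x
  have hb : x ∈ t.baseSet := FiberBundle.mem_baseSet_trivializationAt' x
  obtain ⟨e, he⟩ := (isInvertible_formInChart_iff θ hb).2 hx
  have : ∀ᶠ y in 𝓝 x, formInChart θ x y ∈ Set.range ((↑) : (E ≃L[ℝ] F) → E →L[ℝ] F) := by
    apply h.contMDiffAt_formInChart.continuousAt
    rw [← he]
    exact ContinuousLinearEquiv.nhds e
  filter_upwards [this, t.open_baseSet.mem_nhds hb] with y hy hyb
  exact (isInvertible_formInChart_iff θ hyb).1 hy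

theorem trivializationAt_inverse {θ : (x : M) → TangentSpace 𝓘(ℝ, E) x →L[ℝ] F} {x₀ y : M}
    (hy : y ∈ (trivializationAt E (TangentSpace 𝓘(ℝ, E) : M → Type _) x₀).baseSet)
    (hθ : (θ y).IsInvertible) (w : F) :
    ((trivializationAt E (TangentSpace 𝓘(ℝ, E) : M → Type _) x₀) ⟨y, (θ y).inverse w⟩).2 =
      (formInChart θ x₀ y).inverse w := by
  rw [eq_comm, ((isInvertible_formInChart_iff θ hy).2 hθ).inverse_apply_eq,
    formInChart_apply θ hy, hθ.self_apply_inverse]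

theorem contMDiffAt_inverse_formInChart {θ : (x : M) → TangentSpace 𝓘(ℝ, E) x →L[ℝ] F}
    (h : SmoothFormAt θ x) (hx : (θ x).IsInvertible) :
    ContMDiffAt 𝓘(ℝ, E) 𝓘(ℝ, F →L[ℝ] E) ∞ (fun y => (formInChart θ x y).inverse) x := by
  have hb : x ∈ (trivializationAt E (TangentSpace 𝓘(ℝ, E) : M → Type _) x).baseSet :=
    FiberBundle.mem_baseSet_trivializationAt' x
  obtain ⟨e, he⟩ := (isInvertible_formInChart_iff θ hb).2 hx
  have h1 : ContDiffAt ℝ ∞ (ContinuousLinearMap.inverse : (E →L[ℝ] F) → F →L[ℝ] E)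
      (formInChart θ x x) := by
    rw [← he]; exact contDiffAt_map_inverse e
  exact h1.contMDiffAt.comp x h.contMDiffAt_formInChart

/-- Inversion of operators is smooth. Fields known only through the values of an invertible form,
such as horizontal lifts, get their smoothness from here. -/
theorem SmoothFormAt.smoothAt_inverse {θ : (x : M) → TangentSpace 𝓘(ℝ, E) x →L[ℝ] F}
    (h : SmoothFormAt θ x) (hx : (θ x).IsInvertible) {w : M → F}
    (hw : ContMDiffAt 𝓘(ℝ, E) 𝓘(ℝ, F) ∞ w x) : SmoothAt (fun y => (θ y).inverse (w y)) x := by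
  let t := trivializationAt E (TangentSpace 𝓘(ℝ, E) : M → Type _) x
  have hb : x ∈ t.baseSet := FiberBundle.mem_baseSet_trivializationAt' x
  refine (t.contMDiffAt_section_iff hb).2 ?_
  refine ((contMDiffAt_inverse_formInChart h hx).clm_apply hw).congr_of_eventuallyEq ?_
  filter_upwards [h.eventually_isInvertible hx, t.open_baseSet.mem_nhds hb] with y hy hyb
  exact trivializationAt_inverse hyb hy _

theorem SmoothFormAt.diffAt_inverse {θ : (x : M) → TangentSpace 𝓘(ℝ, E) x →L[ℝ] F}
    (h : SmoothFormAt θ x) (hx : (θ x).IsInvertible) {w : M → F}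
    (hw : MDifferentiableAt 𝓘(ℝ, E) 𝓘(ℝ, F) w x) : DiffAt (fun y => (θ y).inverse (w y)) x := by
  let t := trivializationAt E (TangentSpace 𝓘(ℝ, E) : M → Type _) x
  have hb : x ∈ t.baseSet := FiberBundle.mem_baseSet_trivializationAt' x
  refine (t.mdifferentiableAt_section_iff 𝓘(ℝ, E) _ hb).2 ?_
  refine (((contMDiffAt_inverse_formInChart h hx).mdifferentiableAt
    (by simp)).clm_apply hw).congr_of_eventuallyEq ?_
  filter_upwards [h.eventually_isInvertible hx, t.open_baseSet.mem_nhds hb] with y hy hyb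
  exact trivializationAt_inverse hyb hy _

theorem der_eq_mvfderiv (f : M → F) (X : (x : M) → TangentSpace 𝓘(ℝ, E) x) (x : M) :
    der f X x = mvfderiv 𝓘(ℝ, E) f x (X x) := rfl

theorem der_add {f₁ f₂ : M → F} (h₁ : MDifferentiableAt 𝓘(ℝ, E) 𝓘(ℝ, F) f₁ x)
    (h₂ : MDifferentiableAt 𝓘(ℝ, E) 𝓘(ℝ, F) f₂ x) (X : (x : M) → TangentSpace 𝓘(ℝ, E) x) :
    der (fun y => f₁ y + f₂ y) X x = der f₁ X x + der f₂ X x :=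
  DFunLike.congr_fun (mvfderiv_add h₁ h₂) (X x)

theorem der_smul {f : M → ℝ} {h : M → F} (hf : MDifferentiableAt 𝓘(ℝ, E) 𝓘(ℝ, ℝ) f x)
    (hh : MDifferentiableAt 𝓘(ℝ, E) 𝓘(ℝ, F) h x) (X : (x : M) → TangentSpace 𝓘(ℝ, E) x) :
    der (fun y => f y • h y) X x = f x • der h X x + der f X x • h x :=
  DFunLike.congr_fun (mvfderiv_smul hf hh) (X x)

/-- The exterior derivative of a vector-valued 1-form, evaluated on two vector fields. -/
def extDerivOne (α : (x : M) → TangentSpace 𝓘(ℝ, E) x →L[ℝ] F)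
    (X Y : (x : M) → TangentSpace 𝓘(ℝ, E) x) (x : M) : F :=
  der (fun y => α y (Y y)) X x - der (fun y => α y (X y)) Y x
    - α x (mlieBracket 𝓘(ℝ, E) X Y x)

/-- The exterior derivative of a smooth 1-form is a tensor. -/
theorem exists_extDerivOne_eq {α : (x : M) → TangentSpace 𝓘(ℝ, E) x →L[ℝ] F}
    (hα : SmoothFormAt α x) :
    ∃ Ω : TangentSpace 𝓘(ℝ, E) x →L[ℝ] TangentSpace 𝓘(ℝ, E) x →L[ℝ] F,
      ∀ X Y : (x : M) → TangentSpace 𝓘(ℝ, E) x, DiffAt X x → DiffAt Y x →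
        Ω (X x) (Y x) = extDerivOne α X Y x := by
  have : IsManifold 𝓘(ℝ, E) (minSmoothness ℝ 2) M := by
    rw [minSmoothness_of_isRCLikeNormedField]
    exact IsManifold.of_le (n := ∞) (by norm_cast)
  have h1 : ∀ Y, DiffAt Y x → TensorialAt 𝓘(ℝ, E) E (fun X => extDerivOne α X Y x) x := by
    intro Y hY
    constructor
    · intro f X hf hX
      have h2 : der (fun y => α y ((f • X) y)) Y x =
          f x • der (fun y => α y (X y)) Y x + der f Y x • α x (X x) := by
        rw [← der_smul hf (hα.mdifferentiableAt hX) Y]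
        simp
      have h3 : der (fun y => α y (Y y)) (f • X) x = f x • der (fun y => α y (Y y)) X x :=
        map_smul (mvfderiv 𝓘(ℝ, E) (fun y => α y (Y y)) x) (f x) (X x)
      rw [extDerivOne, h2, h3, mlieBracket_smul_left hf hX, map_add, map_smul, map_smul,
        extDerivOne, der_eq_mvfderiv f Y]
      module
    · intro X X' hX hX'
      have h2 : der (fun y => α y ((X + X') y)) Y x =
          der (fun y => α y (X y)) Y x + der (fun y => α y (X' y)) Y x := by
        rw [← der_add (hα.mdifferentiableAt hX) (hα.mdifferentiableAt hX') Y]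
        simp
      have h3 : der (fun y => α y (Y y)) (X + X') x =
          der (fun y => α y (Y y)) X x + der (fun y => α y (Y y)) X' x :=
        map_add (mvfderiv 𝓘(ℝ, E) (fun y => α y (Y y)) x) (X x) (X' x)
      rw [extDerivOne, h2, h3, mlieBracket_add_left hX hX', map_add, extDerivOne, extDerivOne]
      module
  -- Skew-symmetry carries tensoriality over from the first slot to the second.
  have hsymm : ∀ X Y, extDerivOne α X Y x = - extDerivOne α Y X x := by
    intro X Y
    rw [extDerivOne, extDerivOne, mlieBracket_swap_apply, map_neg]
    module
  have h2 : ∀ X, DiffAt X x → TensorialAt 𝓘(ℝ, E) E (fun Y => extDerivOne α X Y x) x := by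
    intro X hX
    constructor
    · intro f Y hf hY
      simp only [hsymm X]
      rw [(h1 X hX).smul hf hY, smul_neg]
    · intro Y Y' hY hY'
      simp only [hsymm X]
      rw [(h1 X hX).add hY hY', neg_add]
  exact ⟨TensorialAt.mkHom₂ (extDerivOne α · · x) x h1 h2, fun X Y hX hY =>
    TensorialAt.mkHom₂_apply _ _ hX hY⟩

end Forms

/-! ### Linear algebra of a skew torsion and a complex structure -/

section TorsionAlgebra

variable {V : Type*} [AddCommGroup V] [Module ℝ V] [TopologicalSpace V] [IsTopologicalAddGroup V]
  [ContinuousSMul ℝ V]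

/-- The algebraic properties of the torsion of a connection that is Hermitian for an integrable
complex structure `J` and whose torsion is a 3-form. -/
structure IsHermitianTorsion (B : V →L[ℝ] V →L[ℝ] ℝ) (J : V →L[ℝ] V) (T : V →L[ℝ] V →L[ℝ] V) :
    Prop where
  symm : ∀ u v, B u v = B v u
  sq : ∀ v, J (J v) = -v
  herm : ∀ u v, B (J u) (J v) = B u v
  swap : ∀ u v, T v u = -T u v
  skew : ∀ u v w, B (T u v) w = -B (T u w) v
  integrable : ∀ u v, T (J u) (J v) - J (T (J u) v) - J (T u (J v)) - T u v = 0

/-- The cyclic sum of `g(J T(u, v), w)`. -/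
def torsionCyclic (B : V →L[ℝ] V →L[ℝ] ℝ) (J : V →L[ℝ] V) (T : V →L[ℝ] V →L[ℝ] V) (u v w : V) : ℝ :=
  B (J (T u v)) w + B (J (T v w)) u + B (J (T w u)) v

variable {B : V →L[ℝ] V →L[ℝ] ℝ} {J : V →L[ℝ] V} {T : V →L[ℝ] V →L[ℝ] V}

theorem IsHermitianTorsion.cyclic (h : IsHermitianTorsion B J T) (u v w : V) :
    B (T u v) w = B (T v w) u := by
  rw [h.skew v w u, h.swap u v, map_neg, neg_apply, neg_neg]

theorem IsHermitianTorsion.inner_J (h : IsHermitianTorsion B J T) (u v : V) :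
    B (J u) v = -B u (J v) := by
  rw [← h.herm u, h.sq, map_neg, neg_neg]

/-- The integrability identity paired with `w`, with `J` moved across the metric: the 3-form given
by `T` has no (3,0)- and (0,3)-parts. -/
theorem IsHermitianTorsion.type (h : IsHermitianTorsion B J T) (u v w : V) :
    B (T (J u) (J v)) w + B (T (J u) v) (J w) + B (T u (J v)) (J w) = B (T u v) w := by
  have h1 := congrArg (fun z => B z w) (h.integrable u v)
  simp only [map_sub, sub_apply, h.inner_J, map_zero, zero_apply] at h1
  linarith

/-- The cyclic sum is minus the sum of the values of the 3-form with `J` in one slot at a time. By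
`type` at `J w`, that sum is its value with `J` in all three slots. -/
theorem IsHermitianTorsion.torsionCyclic_eq (h : IsHermitianTorsion B J T) (u v w : V) :
    torsionCyclic B J T u v w = -B (T (J u) (J v)) (J w) := by
  have h1 := h.type u v (J w)
  simp only [h.sq, map_neg] at h1
  have h2 := h.cyclic (J u) v w
  have h3 := h.cyclic w u (J v)
  have h4 := h.cyclic v w (J u)
  have h5 := h.cyclic u (J v) w
  rw [torsionCyclic, h.inner_J, h.inner_J, h.inner_J]
  linarith

/-- The `(0, 3)`-part of `d(F₂ - i F₃)` vanishes, pointwise form. -/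
theorem torsionCyclic_zeroThree {I J K : V →L[ℝ] V} (hJ : IsHermitianTorsion B J T)
    (hK : IsHermitianTorsion B K T) (hJI : ∀ v, J (I v) = -K v) (hKI : ∀ v, K (I v) = J v)
    {Q : V → V → V → ℂ} (hQ : ∀ u v w, Q u v w =
      (torsionCyclic B J T u v w : ℂ) - Complex.I * (torsionCyclic B K T u v w : ℂ)) (u v w : V) :
    Q u v w + Complex.I * (Q (I u) v w + Q u (I v) w + Q u v (I w))
      - (Q (I u) (I v) w + Q (I u) v (I w) + Q u (I v) (I w)) - Complex.I * Q (I u) (I v) (I w)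
      = 0 := by
  -- Each term becomes a torsion value with all slots rotated by `J`, or all by `K`; inserting `I`
  -- in a slot exchanges `J` and `K` there up to sign, and everything cancels once i² = −1 is used.
  simp only [hQ, hJ.torsionCyclic_eq, hK.torsionCyclic_eq, hJI, hKI, map_neg, neg_apply, neg_neg,
    Complex.ofReal_neg]
  linear_combination (-((B (T (J u) (J v)) (J w) : ℂ) - (B (T (K u) (K v)) (J w) : ℂ)
    - (B (T (J u) (K v)) (K w) : ℂ) - (B (T (K u) (J v)) (K w) : ℂ))) * Complex.I_sq

end TorsionAlgebra

/-! ### HKT connections at a single point -/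

section Connections

variable {E : Type*} [NormedAddCommGroup E] [NormedSpace ℝ E] [FiniteDimensional ℝ E]
  {M : Type*} [TopologicalSpace M] [ChartedSpace E M] [IsManifold 𝓘(ℝ, E) ∞ M]

/-- The torsion, on vector fields, of an operator `K` on vector fields with values at `x`. -/
def torsionAt {x : M} (K : ((y : M) → TangentSpace 𝓘(ℝ, E) y) →
      (TangentSpace 𝓘(ℝ, E) x →L[ℝ] TangentSpace 𝓘(ℝ, E) x))
    (X Y : (y : M) → TangentSpace 𝓘(ℝ, E) y) : TangentSpace 𝓘(ℝ, E) x :=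
  K Y (X x) - K X (Y x) - mlieBracket 𝓘(ℝ, E) X Y x

/-- `K` has, at the point `x`, the properties of the value at `x` of an HKT connection. -/
structure HKTConnAt (H : HypercomplexStructure E M) (g : Metric E M) (x : M)
    (K : ((y : M) → TangentSpace 𝓘(ℝ, E) y) →
      (TangentSpace 𝓘(ℝ, E) x →L[ℝ] TangentSpace 𝓘(ℝ, E) x)) : Prop where
  add : ∀ X Y, DiffAt X x → DiffAt Y x → K (X + Y) = K X + K Y
  leibniz : ∀ (f : M → ℝ) X, MDifferentiableAt 𝓘(ℝ, E) 𝓘(ℝ, ℝ) f x → DiffAt X x →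
    ∀ v, K (f • X) v = f x • K X v + mvfderiv 𝓘(ℝ, E) f x v • X x
  metric : ∀ X Y, SmoothAt X x → SmoothAt Y x → ∀ v,
    mvfderiv 𝓘(ℝ, E) (fun y => g.inner y (X y) (Y y)) x v =
      g.inner x (K X v) (Y x) + g.inner x (X x) (K Y v)
  complex : ∀ a X, SmoothAt X x → ∀ v, K (applyField (H.J a) X) v = H.J a x (K X v)
  torsion : ∀ X Y Z, SmoothAt X x → SmoothAt Y x → SmoothAt Z x →
    g.inner x (torsionAt K X Y) (Z x) = -g.inner x (torsionAt K X Z) (Y x)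

theorem IsHKTConnection.hktConnAt {H : HypercomplexStructure E M} {g : Metric E M}
    {D : CovariantDerivative 𝓘(ℝ, E) E (fun x : M => TangentSpace 𝓘(ℝ, E) x)}
    (hD : IsHKTConnection H g D) (x : M) : HKTConnAt H g x (fun Y => D Y x) where
  add X Y hX hY := D.isCovariantDerivativeOnUniv.add hX hY
  leibniz f X hf hX v := DFunLike.congr_fun (D.isCovariantDerivativeOnUniv.leibniz hX hf) v
  metric X Y hX hY v := hD.metric x v X Y hX hY
  complex a X hX v := hD.complex a x v X hX
  torsion X Y Z hX hY hZ := by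
    have h := hD.torsion x (X x) (Y x) (Z x)
    rw [D.torsion_apply hX.diffAt hY.diffAt, D.torsion_apply hX.diffAt hZ.diffAt] at h
    exact h

variable {H : HypercomplexStructure E M} {g : Metric E M} {x : M}
  {K : ((y : M) → TangentSpace 𝓘(ℝ, E) y) →
      (TangentSpace 𝓘(ℝ, E) x →L[ℝ] TangentSpace 𝓘(ℝ, E) x)}

theorem torsionAt_swap (X Y : (y : M) → TangentSpace 𝓘(ℝ, E) y) :
    torsionAt K Y X = -torsionAt K X Y := by
  rw [torsionAt, torsionAt, mlieBracket_swap_apply]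
  module

/-- The derivative terms of the Leibniz rule cancel those of the bracket, as for a connection; only
the operator at the one point `x` takes part. -/
theorem HKTConnAt.exists_torsion (hK : HKTConnAt H g x K) :
    ∃ T : TangentSpace 𝓘(ℝ, E) x →L[ℝ] TangentSpace 𝓘(ℝ, E) x →L[ℝ] TangentSpace 𝓘(ℝ, E) x,
      ∀ X Y : (x : M) → TangentSpace 𝓘(ℝ, E) x, DiffAt X x → DiffAt Y x →
        T (X x) (Y x) = torsionAt K X Y := by
  have : IsManifold 𝓘(ℝ, E) (minSmoothness ℝ 2) M := by
    rw [minSmoothness_of_isRCLikeNormedField]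
    exact IsManifold.of_le (n := ∞) (by norm_cast)
  have h1 : ∀ Y, DiffAt Y x → TensorialAt 𝓘(ℝ, E) E (fun X => torsionAt K X Y) x := by
    intro Y hY
    constructor
    · intro f X hf hX
      have h3 : K Y ((f • X) x) = f x • K Y (X x) := map_smul (K Y) (f x) (X x)
      rw [torsionAt, mlieBracket_smul_left hf hX, hK.leibniz f X hf hX, h3, torsionAt]
      module
    · intro X X' hX hX'
      have h3 : K Y ((X + X') x) = K Y (X x) + K Y (X' x) := map_add (K Y) (X x) (X' x)
      rw [torsionAt, mlieBracket_add_left hX hX', hK.add X X' hX hX', h3, torsionAt, torsionAt,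
        add_apply]
      module
  have h2 : ∀ X, DiffAt X x → TensorialAt 𝓘(ℝ, E) E (fun Y => torsionAt K X Y) x := by
    intro X hX
    constructor
    · intro f Y hf hY
      simp only [fun Y => torsionAt_swap (K := K) Y X]
      rw [(h1 X hX).smul hf hY, smul_neg]
    · intro Y Y' hY hY'
      simp only [fun Y => torsionAt_swap (K := K) Y X]
      rw [(h1 X hX).add hY hY', neg_add]
  exact ⟨TensorialAt.mkHom₂ (torsionAt K · ·) x h1 h2, fun X Y hX hY =>
    TensorialAt.mkHom₂_apply _ _ hX hY⟩

/-- Only integrability carries an idea. Since `J` is parallel, the covariant derivatives cancel in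
the Nijenhuis expression built from the torsion, and minus the Nijenhuis tensor of `J` remains. -/
theorem HKTConnAt.isHermitianTorsion (hH : IsHyperHermitian H g) (hK : HKTConnAt H g x K)
    {T : TangentSpace 𝓘(ℝ, E) x →L[ℝ] TangentSpace 𝓘(ℝ, E) x →L[ℝ] TangentSpace 𝓘(ℝ, E) x}
    (hT : ∀ X Y : (x : M) → TangentSpace 𝓘(ℝ, E) x, DiffAt X x → DiffAt Y x →
        T (X x) (Y x) = torsionAt K X Y) (a : Fin 3) :
    IsHermitianTorsion (g.inner x) (H.J a x) T where
  symm u v := g.symm x u v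
  sq v := H.sq a x v
  herm u v := hH a x u v
  swap u v := by
    obtain ⟨X, hX, rfl⟩ := exists_smoothAt_eq u
    obtain ⟨Y, hY, rfl⟩ := exists_smoothAt_eq v
    rw [hT _ _ hX.diffAt hY.diffAt, hT _ _ hY.diffAt hX.diffAt, torsionAt_swap]
  skew u v w := by
    obtain ⟨X, hX, rfl⟩ := exists_smoothAt_eq u
    obtain ⟨Y, hY, rfl⟩ := exists_smoothAt_eq v
    obtain ⟨Z, hZ, rfl⟩ := exists_smoothAt_eq w
    rw [hT _ _ hX.diffAt hY.diffAt, hT _ _ hX.diffAt hZ.diffAt]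
    exact hK.torsion X Y Z hX hY hZ
  integrable u v := by
    obtain ⟨X, hX, rfl⟩ := exists_smoothAt_eq u
    obtain ⟨Y, hY, rfl⟩ := exists_smoothAt_eq v
    have hJX := hX.applyField H a
    have hJY := hY.applyField H a
    have e1 := hT _ _ hJX.diffAt hJY.diffAt
    have e2 := hT _ _ hJX.diffAt hY.diffAt
    have e3 := hT _ _ hX.diffAt hJY.diffAt
    have e4 := hT _ _ hX.diffAt hY.diffAt
    have hN := H.integrable a x X Y hX hY
    simp only [torsionAt, hK.complex a X hX, hK.complex a Y hY] at e1 e2 e3 e4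
    simp only [applyField] at e1 e2 e3 e4
    rw [e1, e2, e3, e4]
    simp only [map_sub, H.sq]
    rw [nijenhuis] at hN
    rw [← neg_eq_zero, ← hN]
    module

end Connections

/-! ### Koszul formula, uniqueness and smoothness of HKT connections -/

section Koszul

variable {E : Type*} [NormedAddCommGroup E] [NormedSpace ℝ E] [FiniteDimensional ℝ E]
  {M : Type*} [TopologicalSpace M] [ChartedSpace E M] [IsManifold 𝓘(ℝ, E) ∞ M]

/-- The exterior derivative of a real-valued 2-form, evaluated on three vector fields. -/
def extDerivTwoReal (θ : (x : M) → TangentSpace 𝓘(ℝ, E) x → TangentSpace 𝓘(ℝ, E) x → ℝ)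
    (X Y Z : (x : M) → TangentSpace 𝓘(ℝ, E) x) (x : M) : ℝ :=
  der (fun y => θ y (Y y) (Z y)) X x
    + der (fun y => θ y (Z y) (X y)) Y x
    + der (fun y => θ y (X y) (Y y)) Z x
    - θ x (mlieBracket 𝓘(ℝ, E) X Y x) (Z x)
    - θ x (mlieBracket 𝓘(ℝ, E) Y Z x) (X x)
    - θ x (mlieBracket 𝓘(ℝ, E) Z X x) (Y x)

/-- The first-order part of the Koszul formula. -/
def koszul (g : Metric E M) (X Y Z : (x : M) → TangentSpace 𝓘(ℝ, E) x) (x : M) : ℝ :=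
  der (fun y => g.inner y (Y y) (Z y)) X x
    + der (fun y => g.inner y (X y) (Z y)) Y x
    - der (fun y => g.inner y (X y) (Y y)) Z x
    + g.inner x (mlieBracket 𝓘(ℝ, E) X Y x) (Z x)
    - g.inner x (mlieBracket 𝓘(ℝ, E) X Z x) (Y x)
    - g.inner x (mlieBracket 𝓘(ℝ, E) Y Z x) (X x)

variable {H : HypercomplexStructure E M} {g : Metric E M} {x : M}
  {K : ((y : M) → TangentSpace 𝓘(ℝ, E) y) →
      (TangentSpace 𝓘(ℝ, E) x →L[ℝ] TangentSpace 𝓘(ℝ, E) x)}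
  {X Y Z : (x : M) → TangentSpace 𝓘(ℝ, E) x}

theorem MDifferentiableAt.clm_comp {F F' : Type*} [NormedAddCommGroup F] [NormedSpace ℝ F]
    [NormedAddCommGroup F'] [NormedSpace ℝ F'] (L : F →L[ℝ] F') {f : M → F}
    (hf : MDifferentiableAt 𝓘(ℝ, E) 𝓘(ℝ, F) f x) :
    MDifferentiableAt 𝓘(ℝ, E) 𝓘(ℝ, F') (fun y => L (f y)) x :=
  (L.mdifferentiableAt (x := f x)).comp x hf

theorem der_clm {F F' : Type*} [NormedAddCommGroup F] [NormedSpace ℝ F]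
    [NormedAddCommGroup F'] [NormedSpace ℝ F'] (L : F →L[ℝ] F') {f : M → F}
    (hf : MDifferentiableAt 𝓘(ℝ, E) 𝓘(ℝ, F) f x) (X : (x : M) → TangentSpace 𝓘(ℝ, E) x) :
    der (fun y => L (f y)) X x = L (der f X x) :=
  DFunLike.congr_fun (HasMFDerivAt.comp x (L.hasMFDerivAt (x := f x)) hf.hasMFDerivAt).mfderiv (X x)

theorem inner_torsionAt (K : ((y : M) → TangentSpace 𝓘(ℝ, E) y) →
      (TangentSpace 𝓘(ℝ, E) x →L[ℝ] TangentSpace 𝓘(ℝ, E) x)) (g : Metric E M)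
    (X Y : (x : M) → TangentSpace 𝓘(ℝ, E) x) (w : TangentSpace 𝓘(ℝ, E) x) :
    g.inner x (mlieBracket 𝓘(ℝ, E) X Y x) w =
      g.inner x (K Y (X x)) w - g.inner x (K X (Y x)) w - g.inner x (torsionAt K X Y) w := by
  rw [torsionAt, map_sub, map_sub, sub_apply, sub_apply]
  ring

/-- The usual Koszul computation produces three torsion terms; total skew-symmetry collapses them
into one. -/
theorem HKTConnAt.koszul_eq (hK : HKTConnAt H g x K) (hX : SmoothAt X x) (hY : SmoothAt Y x)
    (hZ : SmoothAt Z x) :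
    2 * g.inner x (K Y (X x)) (Z x) = koszul g X Y Z x + g.inner x (torsionAt K X Y) (Z x) := by
  have t1 := hK.torsion X Y Z hX hY hZ
  have t2 := hK.torsion Y X Z hY hX hZ
  rw [torsionAt_swap X Y, map_neg, neg_apply] at t2
  rw [koszul, inner_torsionAt K, inner_torsionAt K, inner_torsionAt K]
  have m1 := hK.metric Y Z hY hZ (X x)
  have m2 := hK.metric X Z hX hZ (Y x)
  have m3 := hK.metric X Y hX hY (Z x)
  rw [g.symm x (Y x) (K Z (X x))] at m1
  rw [g.symm x (X x) (K Z (Y x))] at m2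
  rw [g.symm x (X x) (K Y (Z x))] at m3
  rw [der_eq_mvfderiv, der_eq_mvfderiv, der_eq_mvfderiv, m1, m2, m3]
  linarith

theorem HKTConnAt.kahlerForm_apply (hH : IsHyperHermitian H g) (hK : HKTConnAt H g x K)
    (hX : SmoothAt X x) (hY : SmoothAt Y x) (a : Fin 3) (v : TangentSpace 𝓘(ℝ, E) x) :
    mvfderiv 𝓘(ℝ, E) (fun y => kahlerForm H g a y (X y) (Y y)) x v =
      kahlerForm H g a x (K X v) (Y x) - kahlerForm H g a x (K Y v) (X x) := by
  refine (hK.metric _ _ (hX.applyField H a) hY v).trans ?_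
  rw [hK.complex a X hX]
  have h1 : g.inner x (applyField (H.J a) X x) (K Y v) =
      -g.inner x (H.J a x (K Y v)) (X x) := by
    rw [applyField, ← hH a x (H.J a x (K Y v)), H.sq, map_neg, neg_apply, neg_neg, g.symm]
  rw [h1, kahlerForm, kahlerForm]
  ring

/-- `F_a` is parallel, so only the torsion contributes to its exterior derivative. -/
theorem HKTConnAt.extDerivTwoReal_kahlerForm (hH : IsHyperHermitian H g) (hK : HKTConnAt H g x K)
    {T : TangentSpace 𝓘(ℝ, E) x →L[ℝ] TangentSpace 𝓘(ℝ, E) x →L[ℝ] TangentSpace 𝓘(ℝ, E) x}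
    (hT : ∀ X Y : (x : M) → TangentSpace 𝓘(ℝ, E) x, DiffAt X x → DiffAt Y x →
        T (X x) (Y x) = torsionAt K X Y)
    (hX : SmoothAt X x) (hY : SmoothAt Y x) (hZ : SmoothAt Z x) (a : Fin 3) :
    extDerivTwoReal (kahlerForm H g a) X Y Z x =
      torsionCyclic (g.inner x) (H.J a x) T (X x) (Y x) (Z x) := by
  have key : ∀ U V : (x : M) → TangentSpace 𝓘(ℝ, E) x, ∀ w,
      g.inner x (H.J a x (torsionAt K U V)) w = kahlerForm H g a x (K V (U x)) w
        - kahlerForm H g a x (K U (V x)) w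
        - kahlerForm H g a x (mlieBracket 𝓘(ℝ, E) U V x) w := by
    intro U V w
    rw [torsionAt, map_sub, map_sub, map_sub, map_sub, sub_apply, sub_apply]
    rfl
  rw [torsionCyclic, hT _ _ hX.diffAt hY.diffAt, hT _ _ hY.diffAt hZ.diffAt,
    hT _ _ hZ.diffAt hX.diffAt, key, key, key, extDerivTwoReal, der_eq_mvfderiv, der_eq_mvfderiv,
    der_eq_mvfderiv, hK.kahlerForm_apply hH hY hZ, hK.kahlerForm_apply hH hZ hX,
    hK.kahlerForm_apply hH hX hY]
  ring

/-- By `torsionCyclic_eq` the torsion term is dF_a on rotated fields. The connection is thus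
expressed through the metric and one complex structure alone: this is the uniqueness of the Bismut
connection. -/
theorem HKTConnAt.koszul_kahler (hH : IsHyperHermitian H g) (hK : HKTConnAt H g x K)
    (hX : SmoothAt X x) (hY : SmoothAt Y x) (hZ : SmoothAt Z x) (a : Fin 3) :
    2 * g.inner x (K Y (X x)) (Z x) = koszul g X Y Z x + extDerivTwoReal (kahlerForm H g a)
      (applyField (H.J a) X) (applyField (H.J a) Y) (applyField (H.J a) Z) x := by
  obtain ⟨T, hT⟩ := hK.exists_torsion
  have h1 := hK.isHermitianTorsion hH hT a
  rw [hK.koszul_eq hX hY hZ, hK.extDerivTwoReal_kahlerForm hH hT (hX.applyField H a)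
    (hY.applyField H a) (hZ.applyField H a) a, ← hT _ _ hX.diffAt hY.diffAt, h1.torsionCyclic_eq]
  simp only [applyField]
  rw [H.sq, H.sq, H.sq]
  simp

theorem extDerivTwo_omegaOne (hX : SmoothAt X x) (hY : SmoothAt Y x) (hZ : SmoothAt Z x) :
    extDerivTwo (omegaOne H g) X Y Z x =
      (extDerivTwoReal (kahlerForm H g 1) X Y Z x : ℂ)
        - Complex.I * (extDerivTwoReal (kahlerForm H g 2) X Y Z x : ℂ) := by
  have key : ∀ U V W : (x : M) → TangentSpace 𝓘(ℝ, E) x, SmoothAt U x → SmoothAt V x →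
      dirDeriv (fun y => omegaOne H g y (U y) (V y)) x (W x) =
      ((der (fun y => kahlerForm H g 1 y (U y) (V y)) W x : ℝ) : ℂ) -
        Complex.I * ((der (fun y => kahlerForm H g 2 y (U y) (V y)) W x : ℝ) : ℂ) := by
    intro U V W hU hV
    have d1 : MDifferentiableAt 𝓘(ℝ, E) 𝓘(ℝ, ℝ) (fun y => kahlerForm H g 1 y (U y) (V y)) x :=
      mdifferentiableAt_inner g (hU.applyField H 1).diffAt hV.diffAt
    have d2 : MDifferentiableAt 𝓘(ℝ, E) 𝓘(ℝ, ℝ) (fun y => kahlerForm H g 2 y (U y) (V y)) x :=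
      mdifferentiableAt_inner g (hU.applyField H 2).diffAt hV.diffAt
    have h1 := der_add (x := x) (MDifferentiableAt.clm_comp Complex.ofRealCLM d1)
      (MDifferentiableAt.clm_comp (-Complex.I • Complex.ofRealCLM) d2) W
    rw [der_clm _ d1, der_clm _ d2] at h1
    have h2 : (fun y => omegaOne H g y (U y) (V y)) = fun y =>
        Complex.ofRealCLM (kahlerForm H g 1 y (U y) (V y)) +
          (-Complex.I • Complex.ofRealCLM) (kahlerForm H g 2 y (U y) (V y)) := by
      funext y
      simp [omegaOne, sub_eq_add_neg]
    rw [h2]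
    refine h1.trans ?_
    simp [sub_eq_add_neg]
  rw [extDerivTwo, key Y Z X hY hZ, key Z X Y hZ hX, key X Y Z hX hY, extDerivTwoReal,
    extDerivTwoReal, omegaOne, omegaOne, omegaOne]
  push_cast
  ring

/-- An operator at each point suffices: it turns dF₂ and dF₃ into cyclic torsion sums, and
`torsionCyclic_zeroThree` applies with I₁, I₂, I₃ in the roles of `I`, `J`, `K`. -/
theorem zeroThreePartVanishes_omegaOne (hH : IsHyperHermitian H g)
    (hK : ∀ x, ∃ K, HKTConnAt H g x K) : ZeroThreePartVanishes (H.J 0) (omegaOne H g) := by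
  intro x X Y Z hX hY hZ
  obtain ⟨K, hK⟩ := hK x
  obtain ⟨T, hT⟩ := hK.exists_torsion
  have hX' := hX.applyField H 0
  have hY' := hY.applyField H 0
  have hZ' := hZ.applyField H 0
  have h1 := hK.isHermitianTorsion hH hT 1
  have h2 := hK.isHermitianTorsion hH hT 2
  have h3 : ∀ v, H.J 2 x (H.J 0 x v) = H.J 1 x v := by
    intro v
    have e1 := H.mul_rev x (H.J 0 x v)
    rw [H.sq, map_neg] at e1
    exact (neg_injective e1).symm
  have h4 := torsionCyclic_zeroThree (I := H.J 0 x) h1 h2 (H.mul_rev x) h3 (fun _ _ _ => rfl)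
    (X x) (Y x) (Z x)
  rw [extDerivTwoComplex, ← h4]
  simp only [extDerivTwo_omegaOne, hX, hY, hZ, hX', hY', hZ', hK.extDerivTwoReal_kahlerForm hH hT]
  rfl

theorem exists_eventually_smoothAt_eq (v : TangentSpace 𝓘(ℝ, E) x) :
    ∃ X : (x : M) → TangentSpace 𝓘(ℝ, E) x, (∀ᶠ y in 𝓝 x, SmoothAt X y) ∧ X x = v := by
  let t := trivializationAt E (TangentSpace 𝓘(ℝ, E) : M → Type _) x
  have hx : x ∈ t.baseSet := FiberBundle.mem_baseSet_trivializationAt' x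
  refine ⟨fun y => t.symm y (t ⟨x, v⟩).2, ?_, t.symm_apply_apply_mk hx v⟩
  filter_upwards [t.open_baseSet.mem_nhds hx] with y hy
  refine (t.contMDiffAt_section_iff hy).2 ?_
  refine (contMDiffAt_const (c := (t ⟨x, v⟩).2)).congr_of_eventuallyEq ?_
  filter_upwards [t.open_baseSet.mem_nhds hy] with z hz
  have := t.apply_mk_symm hz (t ⟨x, v⟩).2
  have h2 := congrArg Prod.snd this
  exact h2

theorem isInvertible_of_injective {F F' : Type*} [NormedAddCommGroup F] [NormedSpace ℝ F]
    [NormedAddCommGroup F'] [NormedSpace ℝ F'] [FiniteDimensional ℝ F] [FiniteDimensional ℝ F']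
    (L : F →L[ℝ] F') (hL : Function.Injective L) (h : Module.finrank ℝ F = Module.finrank ℝ F') :
    L.IsInvertible := by
  exact ⟨(LinearEquiv.ofInjectiveOfFinrankEq L.toLinearMap hL h).toContinuousLinearEquiv,
    by ext v; rfl⟩

/-- Pairing with fields that extend a basis at `x` is a smooth form, invertible at `x` by positivity
of the metric; its inverse recovers `W` from smooth functions. -/
theorem smoothAt_of_inner {W : (x : M) → TangentSpace 𝓘(ℝ, E) x}
    (h : ∀ Z : (x : M) → TangentSpace 𝓘(ℝ, E) x, (∀ᶠ y in 𝓝 x, SmoothAt Z y) →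
      ContMDiffAt 𝓘(ℝ, E) 𝓘(ℝ, ℝ) ∞ (fun y => g.inner y (W y) (Z y)) x) : SmoothAt W x := by
  let n := Module.finrank ℝ E
  let b : Module.Basis (Fin n) ℝ (TangentSpace 𝓘(ℝ, E) x) := Module.finBasis ℝ E
  choose Z hZ hb using fun i => exists_eventually_smoothAt_eq (b i)
  let θ : (y : M) → TangentSpace 𝓘(ℝ, E) y →L[ℝ] (Fin n → ℝ) := fun y =>
    ContinuousLinearMap.pi fun i => g.inner y (Z i y)
  have hθ : SmoothFormAt θ x := by
    intro X hX
    refine contMDiffAt_pi_space.2 fun i => ?_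
    exact contMDiffAt_inner g (hZ i).self_of_nhds hX
  have hi : Function.Injective (θ x) := by
    rw [injective_iff_map_eq_zero]
    intro v hv
    by_contra hne
    have hpos := g.pos x v hne
    have : g.inner x v = 0 := by
      ext w
      rw [← b.sum_repr w, map_sum]
      refine Finset.sum_eq_zero fun i _ => ?_
      have : g.inner x (Z i x) v = 0 := congrFun hv i
      rw [map_smul, ← hb, g.symm, this, smul_zero]
    rw [this] at hpos
    simp at hpos
  have hinv : (θ x).IsInvertible := by
    have hd : Module.finrank ℝ E = Module.finrank ℝ (Fin n → ℝ) := by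
      simp [n]
    exact isInvertible_of_injective (F := E) (θ x) hi hd
  refine (hθ.smoothAt_inverse hinv (w := fun y => θ y (W y)) ?_).congr ?_
  · refine contMDiffAt_pi_space.2 fun i => ?_
    exact (h (Z i) (hZ i)).congr_of_eventuallyEq (Filter.Eventually.of_forall fun y =>
      g.symm y (Z i y) (W y))
  · filter_upwards [hθ.eventually_isInvertible hinv] with y hy
    exact (hy.inverse_apply_self _).symm

theorem contMDiffAt_koszul (hX : SmoothAt X x) (hY : SmoothAt Y x) (hZ : SmoothAt Z x) :
    ContMDiffAt 𝓘(ℝ, E) 𝓘(ℝ, ℝ) ∞ (koszul g X Y Z) x :=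
  (((((hX.contMDiffAt_der (contMDiffAt_inner g hY hZ)).add
    (hY.contMDiffAt_der (contMDiffAt_inner g hX hZ))).sub
    (hZ.contMDiffAt_der (contMDiffAt_inner g hX hY))).add
    (contMDiffAt_inner g (hX.mlieBracket hY) hZ)).sub
    (contMDiffAt_inner g (hX.mlieBracket hZ) hY)).sub
    (contMDiffAt_inner g (hY.mlieBracket hZ) hX)

theorem contMDiffAt_kahlerForm (a : Fin 3) (hX : SmoothAt X x) (hY : SmoothAt Y x) :
    ContMDiffAt 𝓘(ℝ, E) 𝓘(ℝ, ℝ) ∞ (fun y => kahlerForm H g a y (X y) (Y y)) x :=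
  contMDiffAt_inner g (hX.applyField H a) hY

theorem contMDiffAt_extDerivTwoReal_kahlerForm (a : Fin 3) (hX : SmoothAt X x) (hY : SmoothAt Y x)
    (hZ : SmoothAt Z x) :
    ContMDiffAt 𝓘(ℝ, E) 𝓘(ℝ, ℝ) ∞ (extDerivTwoReal (kahlerForm H g a) X Y Z) x :=
  (((((hX.contMDiffAt_der (contMDiffAt_kahlerForm a hY hZ)).add
    (hY.contMDiffAt_der (contMDiffAt_kahlerForm a hZ hX))).add
    (hZ.contMDiffAt_der (contMDiffAt_kahlerForm a hX hY))).sub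
    (contMDiffAt_kahlerForm a (hX.mlieBracket hY) hZ)).sub
    (contMDiffAt_kahlerForm a (hY.mlieBracket hZ) hX)).sub
    (contMDiffAt_kahlerForm a (hZ.mlieBracket hX) hY)

/-- A connection given pointwise by operators with the properties of an HKT connection is smooth. -/
theorem smoothAt_hktConnAt (hH : IsHyperHermitian H g)
    {K : (y : M) → ((y : M) → TangentSpace 𝓘(ℝ, E) y) →
      (TangentSpace 𝓘(ℝ, E) y →L[ℝ] TangentSpace 𝓘(ℝ, E) y)}
    (hK : ∀ y, HKTConnAt H g y (K y)) (hX : ∀ᶠ y in 𝓝 x, SmoothAt X y)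
    (hY : ∀ᶠ y in 𝓝 x, SmoothAt Y y) : SmoothAt (fun y => K y Y (X y)) x := by
  refine smoothAt_of_inner (g := g) fun Z hZ => ?_
  -- The right-hand side of `koszul_kahler` is smooth in the base point, although nothing is assumed
  -- on how `K` varies; any of the three structures would serve.
  have h1 := ((contMDiffAt_koszul (g := g) hX.self_of_nhds hY.self_of_nhds hZ.self_of_nhds).add
    (contMDiffAt_extDerivTwoReal_kahlerForm (H := H) (g := g) 0 (hX.self_of_nhds.applyField H 0)
      (hY.self_of_nhds.applyField H 0) (hZ.self_of_nhds.applyField H 0)))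
  refine ((contMDiffAt_const (c := (2⁻¹ : ℝ))).mul h1).congr_of_eventuallyEq ?_
  filter_upwards [hX, hY, hZ] with y h1 h2 h3
  have := (hK y).koszul_kahler hH h1 h2 h3 0
  simp only [Pi.mul_apply, Pi.add_apply, ← this]
  ring

/-- The operators at different points are chosen independently; since the Koszul formula determines
them on smooth fields, they fit together smoothly. -/
theorem isHKT_of_hktConnAt (hH : IsHyperHermitian H g)
    (h : ∀ x, ∃ K, HKTConnAt H g x K) : IsHKT H g := by
  choose K hK using h
  refine ⟨hH, ⟨fun Y x => K x Y, ?_⟩, ?_⟩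
  · exact ⟨fun hσ hσ' _ => (hK _).add _ _ hσ hσ', fun hσ hf _ => by
      ext v
      exact (hK _).leibniz _ _ hf hσ v⟩
  · refine ⟨⟨⟨fun {σ} hσ x _ => ?_⟩⟩, fun x v Y Z hY hZ => (hK x).metric Y Z hY hZ v,
      fun a x v Y hY => (hK x).complex a Y hY v, fun x u v w => ?_⟩
    · refine ContMDiffAt.contMDiffWithinAt ?_
      have hσ' : ∀ y, SmoothAt σ y := fun y => (hσ y trivial).contMDiffAt Filter.univ_mem
      refine contMDiffAt_hom_of_apply (n := ⊤) fun X hX => ?_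
      exact smoothAt_hktConnAt hH hK hX (Filter.Eventually.of_forall hσ')
    · obtain ⟨X, hX, rfl⟩ := exists_smoothAt_eq u
      obtain ⟨Y, hY, rfl⟩ := exists_smoothAt_eq v
      obtain ⟨Z, hZ, rfl⟩ := exists_smoothAt_eq w
      rw [CovariantDerivative.torsion_apply _ hX.diffAt hY.diffAt,
        CovariantDerivative.torsion_apply _ hX.diffAt hZ.diffAt]
      exact (hK x).torsion X Y Z hX hY hZ

end Koszul

/-! ### Local diffeomorphisms and charts from invertible derivatives -/

section InverseFunction

variable {F₁ F₂ : Type*} [NormedAddCommGroup F₁] [NormedSpace ℝ F₁] [FiniteDimensional ℝ F₁]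
  [NormedAddCommGroup F₂] [NormedSpace ℝ F₂]

/-- The inverse function theorem, with the source shrunk to where the derivative stays invertible,
so that the inverse is smooth on the entire target and not only at the image of `a`. -/
theorem exists_localHomeo {f : F₁ → F₂} {a : F₁} {O : Set F₁} (hO : IsOpen O) (ha : a ∈ O)
    (hf : ContDiffOn ℝ ∞ f O) (h : (fderiv ℝ f a).IsInvertible) :
    ∃ c : OpenPartialHomeomorph F₁ F₂, a ∈ c.source ∧ c.source ⊆ O ∧ (⇑c = f) ∧
      ContDiffOn ℝ ∞ c.symm c.target := by
  have : CompleteSpace F₁ := FiniteDimensional.complete ℝ F₁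
  obtain ⟨e, he⟩ := h
  have hfa : ContDiffAt ℝ ∞ f a := hf.contDiffAt (hO.mem_nhds ha)
  have hd : HasFDerivAt f (e : F₁ →L[ℝ] F₂) a := by
    rw [he]; exact (hfa.differentiableAt (by simp)).hasFDerivAt
  let c := hfa.toOpenPartialHomeomorph f hd (by simp)
  have hinv : ∀ᶠ z in 𝓝 a, (fderiv ℝ f z).IsInvertible := by
    have h1 : ContinuousAt (fderiv ℝ f) a :=
      (hfa.fderiv_right (m := 0) (by simp)).continuousAt
    have h2 := h1 (by rw [← he]; exact ContinuousLinearEquiv.nhds e)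
    exact h2
  obtain ⟨U, hU, hUo, haU⟩ := eventually_nhds_iff.1 (hinv.and (hO.mem_nhds ha))
  refine ⟨c.restrOpen U hUo, ⟨hfa.mem_toOpenPartialHomeomorph_source hd (by simp), haU⟩,
    fun x hx => (hU x hx.2).2, rfl, fun y hy => ContDiffAt.contDiffWithinAt ?_⟩
  have hy' := (c.restrOpen U hUo).map_target hy
  obtain ⟨e', he'⟩ := (hU _ hy'.2).1
  have h3 := hf.contDiffAt (hO.mem_nhds (hU _ hy'.2).2)
  refine (c.restrOpen U hUo).contDiffAt_symm hy (f₀' := e') ?_ h3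
  rw [he']
  exact (h3.differentiableAt (by simp)).hasFDerivAt

end InverseFunction

section LocalCharts

variable {E : Type*} [NormedAddCommGroup E] [NormedSpace ℝ E] [FiniteDimensional ℝ E]
  {M : Type*} [TopologicalSpace M] [ChartedSpace E M] [IsManifold 𝓘(ℝ, E) ∞ M]
  {F : Type*} [NormedAddCommGroup F] [NormedSpace ℝ F]

/-- A chart with values in a vector space which is smooth together with its inverse. -/
structure IsSmoothChart (c : OpenPartialHomeomorph M F) : Prop where
  smooth : ContMDiffOn 𝓘(ℝ, E) 𝓘(ℝ, F) ∞ c c.source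
  smooth_symm : ContMDiffOn 𝓘(ℝ, F) 𝓘(ℝ, E) ∞ c.symm c.target

theorem isSmoothChart_chartAt (p : M) : IsSmoothChart (E := E) (chartAt E p) :=
  ⟨contMDiffOn_chart, contMDiffOn_chart_symm⟩

theorem IsSmoothChart.trans_symm {F' : Type*} [NormedAddCommGroup F'] [NormedSpace ℝ F']
    {c : OpenPartialHomeomorph M F} (hc : IsSmoothChart (E := E) c)
    {d : OpenPartialHomeomorph F' F} (hd : ContDiffOn ℝ ∞ d d.source)
    (hd' : ContDiffOn ℝ ∞ d.symm d.target) : IsSmoothChart (E := E) (c.trans d.symm) where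
  smooth := by
    refine (hd'.contMDiffOn).comp (hc.smooth.mono ?_) ?_
    · intro x hx; exact hx.1
    · intro x hx; exact hx.2
  smooth_symm := by
    refine (hc.smooth_symm).comp ((hd.contMDiffOn).mono ?_) ?_
    · intro x hx; exact hx.1
    · intro x hx; exact hx.2

/-- The tangent space at `p` is the model space by means of the preferred chart at `p`, so this is
the coordinate change from that chart to itself. -/
theorem mfderiv_chartAt_self (p : M) : mfderiv 𝓘(ℝ, E) 𝓘(ℝ, E) (chartAt E p) p =
    ContinuousLinearMap.id ℝ E := by
  have h := mfderiv_chartAt_eq_tangentCoordChange (I := 𝓘(ℝ, E)) (x := p) (y := p)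
    (mem_chart_source E p)
  ext v
  refine (DFunLike.congr_fun h v).trans ?_
  exact tangentCoordChange_self (I := 𝓘(ℝ, E)) (mem_extChartAt_source p)

theorem exists_isSmoothChart {f : M → F} {p : M} {O : Set M} (hO : IsOpen O) (hp : p ∈ O)
    (hf : ContMDiffOn 𝓘(ℝ, E) 𝓘(ℝ, F) ∞ f O)
    (h : (mfderiv 𝓘(ℝ, E) 𝓘(ℝ, F) f p : E →L[ℝ] F).IsInvertible) :
    ∃ c : OpenPartialHomeomorph M F, p ∈ c.source ∧ (∀ x ∈ c.source, c x = f x) ∧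
      c.source ⊆ O ∧ IsSmoothChart (E := E) c := by
  let φ := chartAt E p
  have hpφ : p ∈ φ.source := mem_chart_source E p
  let O' := φ.target ∩ φ.symm ⁻¹' O
  have hO' : IsOpen O' := φ.isOpen_inter_preimage_symm hO
  have hpO' : φ p ∈ O' := ⟨φ.map_source hpφ, by simpa [φ.left_inv hpφ] using hp⟩
  have hf' : ContDiffOn ℝ ∞ (f ∘ φ.symm) O' := by
    rw [← contMDiffOn_iff_contDiffOn]
    exact hf.comp (contMDiffOn_chart_symm.mono fun x hx => hx.1) fun x hx => hx.2
  have hfp : MDifferentiableAt 𝓘(ℝ, E) 𝓘(ℝ, F) f p :=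
    (hf.contMDiffAt (hO.mem_nhds hp)).mdifferentiableAt (by simp)
  have hd : fderiv ℝ (f ∘ φ.symm) (φ p) = mfderiv 𝓘(ℝ, E) 𝓘(ℝ, F) f p := by
    ext v
    have h1 := mfderiv_eq_fderiv_chart (mem_extChartAt_source p) hfp v
    have h2 := DFunLike.congr_fun (mfderiv_chartAt_self (E := E) p) v
    refine Eq.trans ?_ h1.symm
    exact (congrArg (fderiv ℝ (f ∘ φ.symm) (φ p)) h2).symm
  obtain ⟨c, hc1, hc2, hc3, hc4⟩ := exists_localHomeo hO' hpO' hf' (hd ▸ h)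
  refine ⟨φ.trans c, ⟨hpφ, hc1⟩, fun x hx => ?_, fun x hx => ?_, ?_⟩
  · simp only [OpenPartialHomeomorph.coe_trans, Function.comp_apply, hc3]
    rw [φ.left_inv hx.1]
  · have := (hc2 hx.2).2
    simpa [φ.left_inv hx.1] using this
  · exact (isSmoothChart_chartAt p).trans_symm (d := c.symm) hc4
      (hc3 ▸ hf'.mono hc2)

end LocalCharts

/-- A projection onto the kernel of `b`, identified with `R` by counting dimensions, completes `b`
to an injective map. -/
theorem exists_complement_map {E B R : Type*} [NormedAddCommGroup E] [NormedSpace ℝ E]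
    [FiniteDimensional ℝ E] [NormedAddCommGroup B] [NormedSpace ℝ B] [FiniteDimensional ℝ B]
    [NormedAddCommGroup R] [NormedSpace ℝ R] [FiniteDimensional ℝ R]
    (b : E →L[ℝ] B) (hb : Function.Surjective b)
    (hd : Module.finrank ℝ E = Module.finrank ℝ B + Module.finrank ℝ R) :
    ∃ κ : E →L[ℝ] R, ∀ v, b v = 0 → κ v = 0 → v = 0 := by
  let K := LinearMap.ker b.toLinearMap
  have h1 : Module.finrank ℝ K = Module.finrank ℝ R := by
    have h2 : Module.finrank ℝ (LinearMap.range b.toLinearMap) + Module.finrank ℝ K =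
        Module.finrank ℝ E := b.toLinearMap.finrank_range_add_finrank_ker
    rw [LinearMap.range_eq_top.2 hb, finrank_top] at h2
    omega
  let e : K ≃ₗ[ℝ] R := LinearEquiv.ofFinrankEq K R h1
  obtain ⟨q, hq⟩ := K.exists_isCompl
  obtain ⟨π, hπ⟩ := K.subtype.exists_leftInverse_of_injective (by simp)
  refine ⟨LinearMap.toContinuousLinearMap (e.toLinearMap ∘ₗ π), fun v hv hκ => ?_⟩
  have h3 : π v = ⟨v, hv⟩ := DFunLike.congr_fun hπ ⟨v, hv⟩
  have h4 : π v = 0 := e.map_eq_zero_iff.1 hκ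
  rw [h3] at h4
  exact congrArg Subtype.val h4

/-! ### Slice charts for a free action of a compact group on a level set -/

section Slice

variable {E : Type*} [NormedAddCommGroup E] [NormedSpace ℝ E] [FiniteDimensional ℝ E]
  {M : Type*} [TopologicalSpace M] [ChartedSpace E M] [IsManifold 𝓘(ℝ, E) ∞ M]
  {EG : Type*} [NormedAddCommGroup EG] [NormedSpace ℝ EG] [FiniteDimensional ℝ EG]
  {G : Type*} [TopologicalSpace G] [ChartedSpace EG G] [Group G] [LieGroup 𝓘(ℝ, EG) ∞ G]
  [MulAction G M] [ContMDiffSMul 𝓘(ℝ, EG) 𝓘(ℝ, E) ∞ G M]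
  {S : Type*} [NormedAddCommGroup S] [NormedSpace ℝ S] [FiniteDimensional ℝ S]
  {R : Type*} [NormedAddCommGroup R] [NormedSpace ℝ R] [FiniteDimensional ℝ R]

variable (G) in
/-- A chart adapted to the level set `f = 0` and to the orbits of `G` in it. -/
structure IsSliceChart (f : M → S) (p : M) (c : OpenPartialHomeomorph M (S × (EG × R))) :
    Prop where
  mem_source : p ∈ c.source
  map_self : c p = 0
  smooth : IsSmoothChart (E := E) c
  target : ∃ (A : Set S) (B : Set EG) (W : Set R), IsOpen W ∧ c.target = A ×ˢ (B ×ˢ W)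
  fst_eq : ∀ x ∈ c.source, (c x).1 = 0 ↔ f x = 0
  orbit : ∀ x ∈ c.source, ∀ y ∈ c.source, f x = 0 → f y = 0 →
    ((∃ γ : G, γ • x = y) ↔ (c x).2.2 = (c y).2.2)

theorem contMDiff_smul_point (p : M) : ContMDiff 𝓘(ℝ, EG) 𝓘(ℝ, E) ∞ (fun γ : G => γ • p) :=
  ContMDiff.smul contMDiff_id contMDiff_const

theorem mfderiv_fundamentalVector {F : Type*} [NormedAddCommGroup F] [NormedSpace ℝ F] {f : M → F}
    {p : M} (hf : MDifferentiableAt 𝓘(ℝ, E) 𝓘(ℝ, F) f p) (X : EG) :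
    mfderiv 𝓘(ℝ, E) 𝓘(ℝ, F) f p (fundamentalVector (G := G) X p) =
      mfderiv 𝓘(ℝ, EG) 𝓘(ℝ, F) (fun γ : G => f (γ • p)) 1 X := by
  have h1 : ∀ q, q = p → HasMFDerivAt 𝓘(ℝ, E) 𝓘(ℝ, F) f q
      (mfderiv 𝓘(ℝ, E) 𝓘(ℝ, F) f p : E →L[ℝ] F) := by
    rintro q rfl
    exact hf.hasMFDerivAt
  have h2 := HasMFDerivAt.comp (1 : G) (h1 _ (one_smul G p))
    ((contMDiff_smul_point (E := E) (EG := EG) (G := G) p).mdifferentiableAt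
      (by simp)).hasMFDerivAt
  exact (DFunLike.congr_fun h2.mfderiv X).symm

/-- A chart adapted to the level set only, with prescribed derivative in the other directions. -/
theorem exists_levelChart {A : Type*} [NormedAddCommGroup A] [NormedSpace ℝ A]
    [FiniteDimensional ℝ A] {f : M → S} (hf : ContMDiff 𝓘(ℝ, E) 𝓘(ℝ, S) ∞ f) {p : M}
    (hp : f p = 0) (a : E →L[ℝ] A)
    (hsurj : Function.Surjective fun v : E =>
      ((mfderiv 𝓘(ℝ, E) 𝓘(ℝ, S) f p : E →L[ℝ] S) v, a v))
    (hd : Module.finrank ℝ E = Module.finrank ℝ S + Module.finrank ℝ A + Module.finrank ℝ R) :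
    ∃ c : OpenPartialHomeomorph M (S × (A × R)), p ∈ c.source ∧ c p = 0 ∧
      IsSmoothChart (E := E) c ∧ (∀ x ∈ c.source, (c x).1 = f x) ∧
      ∀ v : E, ((mfderiv 𝓘(ℝ, E) 𝓘(ℝ, S × (A × R)) c p : E →L[ℝ] S × (A × R)) v).2.1 = a v := by
  let df : E →L[ℝ] S := mfderiv 𝓘(ℝ, E) 𝓘(ℝ, S) f p
  obtain ⟨κ, hκ⟩ := exists_complement_map (R := R) (df.prod a) hsurj (by
    rw [Module.finrank_prod]; exact hd)
  let ℓ : E →L[ℝ] S × (A × R) := (0 : E →L[ℝ] S).prod (a.prod κ)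
  -- The first component is exactly `f`; the other two are affine in the preferred chart, with
  -- derivatives `a` and the complementary map `κ`.
  let F1 : M → S × (A × R) := fun x =>
    ContinuousLinearMap.inl ℝ S (A × R) (f x) + ℓ (chartAt E p x - chartAt E p p)
  have hF1 : ContMDiffOn 𝓘(ℝ, E) 𝓘(ℝ, S × (A × R)) ∞ F1 (chartAt E p).source := by
    refine ContMDiffOn.add ?_ ?_
    · exact ((ContinuousLinearMap.contMDiff _).comp hf).contMDiffOn
    · exact (ContinuousLinearMap.contMDiff ℓ).comp_contMDiffOn
        (contMDiffOn_chart.sub contMDiffOn_const)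
  have hd1 : HasMFDerivAt 𝓘(ℝ, E) 𝓘(ℝ, S × (A × R)) F1 p (df.prod (a.prod κ)) := by
    have hL : (ContinuousLinearMap.inl ℝ S (A × R)).comp df +
        ℓ.comp (ContinuousLinearMap.id ℝ E) = df.prod (a.prod κ) := by
      ext v <;> simp [ℓ]
    have h1 : HasMFDerivAt 𝓘(ℝ, E) 𝓘(ℝ, S) f p df :=
      (hf.mdifferentiableAt (by simp)).hasMFDerivAt
    have h2 : HasMFDerivAt 𝓘(ℝ, E) 𝓘(ℝ, E) (chartAt E p) p (ContinuousLinearMap.id ℝ E) := by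
      rw [← mfderiv_chartAt_self]
      exact (mdifferentiableAt_atlas (chart_mem_atlas E p) (mem_chart_source E p)).hasMFDerivAt
    have h3 : HasMFDerivAt 𝓘(ℝ, E) 𝓘(ℝ, E) (fun x => chartAt E p x - chartAt E p p) p
        (ContinuousLinearMap.id ℝ E) := by
      have := h2.sub (hasMFDerivAt_const (chartAt E p p) p)
      exact this.congr_mfderiv (sub_zero _)
    have h4 := HasMFDerivAt.comp p
      ((ContinuousLinearMap.inl ℝ S (A × R)).hasMFDerivAt (x := f p)) h1
    have h5 := HasMFDerivAt.comp p (ℓ.hasMFDerivAt (x := chartAt E p p - chartAt E p p)) h3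
    exact (h4.add h5).congr_mfderiv hL
  obtain ⟨c, hc1, hc2, hc3, hc4⟩ := exists_isSmoothChart (chartAt E p).open_source
    (mem_chart_source E p) hF1 (by
      rw [hd1.mfderiv]
      refine isInvertible_of_injective (F := E) (F' := S × (A × R)) _ ?_ (by simp only [Module.finrank_prod]; omega)
      rw [injective_iff_map_eq_zero]
      intro v hv
      have hv' : (df v, (a v, κ v)) = 0 := hv
      simp only [Prod.mk_eq_zero] at hv'
      exact hκ v (Prod.ext hv'.1 hv'.2.1) hv'.2.2)
  refine ⟨c, hc1, ?_, hc4, fun x hx => ?_, fun v => ?_⟩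
  · rw [hc2 p hc1]; simp [F1, hp]
  · rw [hc2 x hx]; simp [F1, ℓ]
  · have : (c : M → S × (A × R)) =ᶠ[𝓝 p] F1 := by
      filter_upwards [c.open_source.mem_nhds hc1] with x hx using hc2 x hx
    rw [this.mfderiv_eq, hd1.mfderiv]
    rfl

end Slice

section Slice

variable {E : Type*} [NormedAddCommGroup E] [NormedSpace ℝ E] [FiniteDimensional ℝ E]
  {M : Type*} [TopologicalSpace M] [ChartedSpace E M] [IsManifold 𝓘(ℝ, E) ∞ M]
  {EG : Type*} [NormedAddCommGroup EG] [NormedSpace ℝ EG] [FiniteDimensional ℝ EG]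
  {G : Type*} [TopologicalSpace G] [ChartedSpace EG G] [Group G] [LieGroup 𝓘(ℝ, EG) ∞ G]
  [MulAction G M] [ContMDiffSMul 𝓘(ℝ, EG) 𝓘(ℝ, E) ∞ G M]
  {S : Type*} [NormedAddCommGroup S] [NormedSpace ℝ S] [FiniteDimensional ℝ S]
  {R : Type*} [NormedAddCommGroup R] [NormedSpace ℝ R] [FiniteDimensional ℝ R]

variable (EG G) in
/-- A parametrization of a neighbourhood of `1` in a Lie group. -/
def paramOne (ξ : EG) : G := (chartAt EG (1 : G)).symm (ξ + chartAt EG (1 : G) 1)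

variable (EG G) in
theorem paramOne_zero : paramOne EG G 0 = 1 := by
  simp [paramOne, (chartAt EG (1 : G)).left_inv (mem_chart_source EG (1 : G))]

variable (EG G) in
/-- The domain of the parametrization of a neighbourhood of `1` in a Lie group. -/
def paramDomain : Set EG := {ξ | ξ + chartAt EG (1 : G) 1 ∈ (chartAt EG (1 : G)).target}

variable (EG G) in
theorem isOpen_paramDomain : IsOpen (paramDomain EG G) :=
  (chartAt EG (1 : G)).open_target.preimage (by fun_prop)

variable (EG G) in
theorem zero_mem_paramDomain : (0 : EG) ∈ paramDomain EG G := by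
  simp [paramDomain, mem_chart_target EG (1 : G)]

variable (EG G) in
theorem contMDiffOn_paramOne :
    ContMDiffOn 𝓘(ℝ, EG) 𝓘(ℝ, EG) ∞ (paramOne EG G) (paramDomain EG G) :=
  (contMDiffOn_chart_symm (I := 𝓘(ℝ, EG)) (x := (1 : G))).comp
    (ContDiff.contMDiff (by fun_prop)).contMDiffOn fun _ h => h

variable (EG G) in
theorem mfderiv_paramOne : HasMFDerivAt 𝓘(ℝ, EG) 𝓘(ℝ, EG) (paramOne EG G) 0
    (ContinuousLinearMap.id ℝ EG) := by
  have h1 : MDifferentiableAt 𝓘(ℝ, EG) 𝓘(ℝ, EG) (paramOne EG G) 0 :=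
    ((contMDiffOn_paramOne EG G).contMDiffAt
      ((isOpen_paramDomain EG G).mem_nhds (zero_mem_paramDomain EG G))).mdifferentiableAt (by simp)
  have h2 : ∀ q : G, q = 1 → HasMFDerivAt 𝓘(ℝ, EG) 𝓘(ℝ, EG) (chartAt EG (1 : G)) q
      (ContinuousLinearMap.id ℝ EG) := by
    rintro q rfl
    rw [← mfderiv_chartAt_self]
    exact (mdifferentiableAt_atlas (chart_mem_atlas EG (1 : G))
      (mem_chart_source EG (1 : G))).hasMFDerivAt
  have h3 := HasMFDerivAt.comp 0 (h2 _ (paramOne_zero EG G)) h1.hasMFDerivAt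
  have h4 : HasMFDerivAt 𝓘(ℝ, EG) 𝓘(ℝ, EG) (fun ξ : EG => ξ + chartAt EG (1 : G) 1) 0
      (ContinuousLinearMap.id ℝ EG) :=
    ((hasFDerivAt_id (0 : EG)).add_const _).hasMFDerivAt
  have h5 : (chartAt EG (1 : G) ∘ paramOne EG G) =ᶠ[𝓝 0] fun ξ => ξ + chartAt EG (1 : G) 1 := by
    filter_upwards [(isOpen_paramDomain EG G).mem_nhds (zero_mem_paramDomain EG G)] with ξ hξ
    exact (chartAt EG (1 : G)).right_inv hξ
  have h6 := hasMFDerivAt_unique h3 (h4.congr_of_eventuallyEq h5)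
  exact h1.hasMFDerivAt.congr_mfderiv h6

/-- Near a point with trivial stabilizer, the orbits meet a slice only once. -/
theorem exists_orbit_slice_injective {M G Y : Type*} [TopologicalSpace M] [TopologicalSpace G]
    [Group G] [MulAction G M] [ContinuousSMul G M] [T2Space M] [CompactSpace G]
    [TopologicalSpace Y] {y₀ : Y} {σ : Y → M} (hσ : ContinuousAt σ y₀)
    (hfree : ∀ γ : G, γ • σ y₀ = σ y₀ → γ = 1)
    (h1 : ∀ᶠ z : (Y × Y) × G in 𝓝 ((y₀, y₀), 1), z.2 • σ z.1.1 = σ z.1.2 → z.1.1 = z.1.2) :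
    ∃ W : Set Y, IsOpen W ∧ y₀ ∈ W ∧ ∀ y ∈ W, ∀ y' ∈ W, ∀ γ : G, γ • σ y = σ y' → y = y' := by
  have key : ∀ᶠ z : Y × Y in 𝓝 (y₀, y₀), ∀ γ ∈ (Set.univ : Set G),
      γ • σ z.1 = σ z.2 → z.1 = z.2 := by
    -- Compactness makes neighbourhoods found for each `γ` uniform: `γ = 1` is `h1`, and for `γ ≠ 1`
    -- freeness keeps the two points apart.
    refine isCompact_univ.eventually_forall_of_forall_eventually fun γ _ => ?_
    by_cases hγ : γ = 1
    · subst hγ; exact h1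
    · have hne : γ • σ y₀ ≠ σ y₀ := fun h => hγ (hfree γ h)
      have c1 : ContinuousAt (fun z : (Y × Y) × G => z.2 • σ z.1.1) ((y₀, y₀), γ) :=
        continuousAt_snd.smul (ContinuousAt.comp_of_eq hσ
          (continuousAt_fst.comp continuousAt_fst) rfl)
      have c2 : ContinuousAt (fun z : (Y × Y) × G => σ z.1.2) ((y₀, y₀), γ) :=
        ContinuousAt.comp_of_eq hσ (continuousAt_snd.comp continuousAt_fst) rfl
      filter_upwards [(c1.ne_iff_eventually_ne c2).1 hne] with z hz h
      exact absurd h hz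
  obtain ⟨U, hU, V, hV, hUV⟩ := mem_nhds_prod_iff.1 key
  obtain ⟨W, hW, hWo, hyW⟩ := mem_nhds_iff.1 (Filter.inter_mem hU hV)
  exact ⟨W, hWo, hyW, fun y hy y' hy' γ h =>
    hUV (Set.mk_mem_prod (hW hy).1 (hW hy').2) γ trivial h⟩

/-- The transversals of a level chart `c₁` are spread out by the group: (s, ξ, t) ↦ e(ξ) • c₁⁻¹(s,
0, t) is a local diffeomorphism at 0 because `a` is injective on fundamental vectors, and its
inverse is the chart. In the level set, orbits correspond to values of `t` once the transversal is
small enough to meet each of them at most once. -/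
theorem exists_isSliceChart [T2Space M] [CompactSpace G] {A : Type*} [NormedAddCommGroup A]
    [NormedSpace ℝ A] [FiniteDimensional ℝ A] {f : M → S} (hf : ContMDiff 𝓘(ℝ, E) 𝓘(ℝ, S) ∞ f)
    (hinv : ∀ (γ : G) x, f x = 0 → f (γ • x) = 0) {p : M} (hp : f p = 0)
    (hfree : ∀ γ : G, γ • p = p → γ = 1) (a : E →L[ℝ] A)
    (hsurj : Function.Surjective fun v : E =>
      ((mfderiv 𝓘(ℝ, E) 𝓘(ℝ, S) f p : E →L[ℝ] S) v, a v))
    (ha : ∀ ξ : EG, a (fundamentalVector (G := G) ξ p : E) = 0 → ξ = 0)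
    (hdA : Module.finrank ℝ A = Module.finrank ℝ EG)
    (hd : Module.finrank ℝ E = Module.finrank ℝ S + Module.finrank ℝ A + Module.finrank ℝ R) :
    ∃ c : OpenPartialHomeomorph M (S × (EG × R)), IsSliceChart (E := E) G f p c := by
  have hcs : ContinuousSMul G M := ContMDiffSMul.continuousSMul (I := 𝓘(ℝ, EG)) (I' := 𝓘(ℝ, E)) ∞
  have hinv' : ∀ (γ : G) x, f (γ • x) = 0 ↔ f x = 0 := fun γ x =>
    ⟨fun h => by simpa using hinv γ⁻¹ _ h, hinv γ x⟩
  obtain ⟨c₁, hpc, hc0, hcs1, hcf, hca⟩ := exists_levelChart (R := R) hf hp a hsurj hd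
  have hsymm0 : c₁.symm 0 = p := by rw [← hc0, c₁.left_inv hpc]
  have h0t : (0 : S × (A × R)) ∈ c₁.target := hc0 ▸ c₁.map_source hpc
  let i : S × (EG × R) → S × (A × R) := fun z => (z.1, (0, z.2.2))
  have hi : ContDiff ℝ ∞ i := by fun_prop
  let e := paramOne EG G
  let Ψ : S × (EG × R) → M := fun z => e z.2.1 • c₁.symm (i z)
  let O₂ : Set (S × (EG × R)) := {z | z.2.1 ∈ paramDomain EG G} ∩ i ⁻¹' c₁.target
  have hO₂ : IsOpen O₂ := ((isOpen_paramDomain EG G).preimage (by fun_prop)).inter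
    (c₁.open_target.preimage hi.continuous)
  have h0O₂ : (0 : S × (EG × R)) ∈ O₂ := ⟨zero_mem_paramDomain EG G, h0t⟩
  have hΨ : ContMDiffOn 𝓘(ℝ, S × (EG × R)) 𝓘(ℝ, E) ∞ Ψ O₂ := by
    refine ContMDiffOn.smul (I := 𝓘(ℝ, EG)) ?_ ?_
    · exact (contMDiffOn_paramOne EG G).comp (ContDiff.contMDiff (by fun_prop)).contMDiffOn
        fun _ h => h.1
    · exact hcs1.smooth_symm.comp hi.contMDiff.contMDiffOn fun _ h => h.2
  have hΨ0 : Ψ 0 = p := by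
    have h1 : i 0 = 0 := rfl
    simp only [Ψ, h1, hsymm0]
    rw [show e (0 : S × (EG × R)).2.1 = 1 from paramOne_zero EG G, one_smul]
  let O₃ : Set (S × (EG × R)) := O₂ ∩ Ψ ⁻¹' c₁.source
  have hO₃ : IsOpen O₃ := hΨ.continuousOn.isOpen_inter_preimage hO₂ c₁.open_source
  have h0O₃ : (0 : S × (EG × R)) ∈ O₃ := ⟨h0O₂, by simpa [hΨ0] using hpc⟩
  let Φ : S × (EG × R) → S × (A × R) := fun z => c₁ (Ψ z)
  have hΦ : ContDiffOn ℝ ∞ Φ O₃ := by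
    rw [← contMDiffOn_iff_contDiffOn]
    exact hcs1.smooth.comp (hΨ.mono fun _ h => h.1) fun _ h => h.2
  have hΦd : HasFDerivAt Φ (fderiv ℝ Φ 0) 0 :=
    ((hΦ.contDiffAt (hO₃.mem_nhds h0O₃)).differentiableAt (by simp)).hasFDerivAt
  have hΦd' : ∀ z, z = 0 → HasFDerivAt Φ (fderiv ℝ Φ 0) z := by
    rintro z rfl; exact hΦd
  -- In the coordinates of `c₁`, the derivative of the parametrization is the identity on `S × R`,
  -- and by `hd2` it sends `ξ` to the image of its fundamental vector. The `A`-component detects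
  -- `ξ`, whence injectivity.
  have hd1 : ∀ s t, fderiv ℝ Φ 0 (s, (0, t)) = (s, (0, t)) := by
    intro s t
    let j : S × R →L[ℝ] S × (EG × R) := (ContinuousLinearMap.fst ℝ S R).prod
      ((0 : S × R →L[ℝ] EG).prod (ContinuousLinearMap.snd ℝ S R))
    let j' : S × R →L[ℝ] S × (A × R) := (ContinuousLinearMap.fst ℝ S R).prod
      ((0 : S × R →L[ℝ] A).prod (ContinuousLinearMap.snd ℝ S R))
    have h1 : HasFDerivAt (Φ ∘ j) ((fderiv ℝ Φ 0).comp j) 0 :=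
      (hΦd' _ (map_zero j)).comp 0 j.hasFDerivAt
    have h2 : (Φ ∘ j) =ᶠ[𝓝 0] j' := by
      have : j' ⁻¹' c₁.target ∈ 𝓝 0 :=
        (c₁.open_target.preimage j'.continuous).mem_nhds (by simpa using h0t)
      filter_upwards [this] with z hz
      change c₁ (e 0 • c₁.symm (j' z)) = j' z
      rw [show e 0 = 1 from paramOne_zero EG G, one_smul, c₁.right_inv hz]
    have h3 := (h1.congr_of_eventuallyEq h2.symm).unique j'.hasFDerivAt
    exact DFunLike.congr_fun h3 (s, t)
  have hd2 : ∀ ξ, fderiv ℝ Φ 0 (0, (ξ, 0)) =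
      (mfderiv 𝓘(ℝ, E) 𝓘(ℝ, S × (A × R)) c₁ p : E →L[ℝ] S × (A × R))
        (fundamentalVector (G := G) ξ p) := by
    intro ξ
    let j : EG →L[ℝ] S × (EG × R) := (0 : EG →L[ℝ] S).prod
      ((ContinuousLinearMap.id ℝ EG).prod (0 : EG →L[ℝ] R))
    have h1 : HasFDerivAt (Φ ∘ j) ((fderiv ℝ Φ 0).comp j) 0 :=
      (hΦd' _ (map_zero j)).comp 0 j.hasFDerivAt
    have hcp : MDifferentiableAt 𝓘(ℝ, E) 𝓘(ℝ, S × (A × R)) c₁ p :=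
      (hcs1.smooth.contMDiffAt (c₁.open_source.mem_nhds hpc)).mdifferentiableAt (by simp)
    have h2 : ∀ q, q = p → HasMFDerivAt 𝓘(ℝ, E) 𝓘(ℝ, S × (A × R)) c₁ q
        (mfderiv 𝓘(ℝ, E) 𝓘(ℝ, S × (A × R)) c₁ p : E →L[ℝ] S × (A × R)) := by
      rintro q rfl; exact hcp.hasMFDerivAt
    have h3 : ∀ γ, γ = (1 : G) → HasMFDerivAt 𝓘(ℝ, EG) 𝓘(ℝ, E) (fun γ : G => γ • p) γ
        (mfderiv 𝓘(ℝ, EG) 𝓘(ℝ, E) (fun γ : G => γ • p) 1 : EG →L[ℝ] E) := by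
      rintro q rfl
      exact ((contMDiff_smul_point (E := E) (EG := EG) (G := G) p).mdifferentiableAt
        (by simp)).hasMFDerivAt
    have h4 := HasMFDerivAt.comp (0 : EG) (h3 _ (paramOne_zero EG G)) (mfderiv_paramOne EG G)
    have h5 := HasMFDerivAt.comp (0 : EG) (h2 _ (show paramOne EG G 0 • p = p by
      rw [paramOne_zero, one_smul])) h4
    have h6 : (Φ ∘ j) = (c₁ ∘ (fun γ : G => γ • p) ∘ paramOne EG G) := by
      funext ξ
      change c₁ (e ξ • c₁.symm 0) = _
      rw [hsymm0]
      rfl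
    have h7 := h1.unique (h6 ▸ h5.hasFDerivAt)
    exact DFunLike.congr_fun h7 ξ
  have hdinv : (fderiv ℝ Φ 0).IsInvertible := by
    refine isInvertible_of_injective _ ?_ (by simp only [Module.finrank_prod]; omega)
    rw [injective_iff_map_eq_zero]
    rintro ⟨s, ξ, t⟩ hz
    have h1 : ((s, (ξ, t)) : S × (EG × R)) = (s, (0, t)) + (0, (ξ, 0)) := by simp
    rw [h1, map_add, hd1, hd2] at hz
    have h2 : a (fundamentalVector (G := G) ξ p : E) = 0 := by
      have h3 : (0 : A) + ((mfderiv 𝓘(ℝ, E) 𝓘(ℝ, S × (A × R)) c₁ p : E →L[ℝ] S × (A × R))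
        (fundamentalVector (G := G) ξ p)).2.1 = 0 := congrArg (fun z => z.2.1) hz
      exact ((hca _).symm.trans (zero_add _).symm).trans h3
    have hξ := ha ξ h2
    subst hξ
    have h4 : (mfderiv 𝓘(ℝ, E) 𝓘(ℝ, S × (A × R)) c₁ p : E →L[ℝ] S × (A × R))
        (fundamentalVector (G := G) (0 : EG) p) = 0 :=
      (congrArg _ (map_zero (mfderiv 𝓘(ℝ, EG) 𝓘(ℝ, E) (fun γ : G => γ • p) 1))).trans (map_zero _)
    have h5 : ((s, (0, t)) : S × (A × R)) + 0 = 0 := (congrArg _ h4).symm.trans hz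
    simpa using h5
  obtain ⟨c₂, h0c₂, hc₂O, hc₂Φ, hc₂s⟩ := exists_localHomeo hO₃ h0O₃ hΦ hdinv
  let c₃ := c₁.trans c₂.symm
  have hc₃ : IsSmoothChart (E := E) c₃ := hcs1.trans_symm (hc₂Φ ▸ hΦ.mono hc₂O) hc₂s
  have ht₃ : ∀ z ∈ c₃.target, z ∈ O₃ ∧ c₃.symm z = Ψ z := by
    intro z hz
    have hz' : z ∈ c₂.source := hz.1
    refine ⟨hc₂O hz', ?_⟩
    change c₁.symm (c₂ z) = Ψ z
    rw [hc₂Φ]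
    exact c₁.left_inv (hc₂O hz').2
  have h0t₃ : (0 : S × (EG × R)) ∈ c₃.target := by
    refine ⟨h0c₂, ?_⟩
    change c₂ 0 ∈ c₁.target
    rw [hc₂Φ]
    exact c₁.map_source (hc₂O h0c₂).2
  have hp₃ : p ∈ c₃.source := by
    rw [← hΨ0, ← (ht₃ 0 h0t₃).2]
    exact c₃.map_target h0t₃
  have hc₃p : c₃ p = 0 := by
    conv_lhs => rw [← hΨ0, ← (ht₃ 0 h0t₃).2]
    exact c₃.right_inv h0t₃
  let σ : R → M := fun t => c₁.symm (0, (0, t))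
  have hσ0 : σ 0 = p := hsymm0
  have hσc : ContinuousAt σ 0 :=
    ContinuousAt.comp (f := fun t : R => ((0 : S), ((0 : A), t)))
      (c₁.continuousAt_symm h0t) (by fun_prop)
  obtain ⟨W₀, hW₀, h0W₀, hW₀inj⟩ := exists_orbit_slice_injective (G := G) hσc
    (by simpa [hσ0] using hfree) (by
      -- For `γ` near 1, both sides of `γ • σ t = σ t'` are values of `c₃.symm`, at (0, ξ(γ), t) and
      -- (0, 0, t'), so injectivity gives `t = t'`.
      let φ := chartAt EG (1 : G)
      let ξ : G → EG := fun γ => φ γ - φ 1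
      have hξ : ContinuousAt ξ 1 :=
        (φ.continuousAt (mem_chart_source EG (1 : G))).sub continuousAt_const
      have m1 : ∀ᶠ z : (R × R) × G in 𝓝 ((0, 0), 1), z.2 ∈ φ.source :=
        continuousAt_snd.eventually (φ.open_source.mem_nhds (mem_chart_source EG (1 : G)))
      have m2 : ContinuousAt (fun z : (R × R) × G => ((0 : S), (ξ z.2, z.1.1))) ((0, 0), 1) :=
        continuousAt_const.prodMk ((ContinuousAt.comp_of_eq hξ continuousAt_snd rfl).prodMk
          (continuousAt_fst.comp continuousAt_fst))
      have m3 : ContinuousAt (fun z : (R × R) × G => ((0 : S), ((0 : EG), z.1.2))) ((0, 0), 1) :=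
        continuousAt_const.prodMk (continuousAt_const.prodMk
          (continuousAt_snd.comp continuousAt_fst))
      have hn : c₃.target ∈ 𝓝 (0 : S × (EG × R)) := c₃.open_target.mem_nhds h0t₃
      have m2' := m2.eventually (p := fun z => z ∈ c₃.target)
        (show c₃.target ∈ 𝓝 ((0 : S), (ξ 1, (0 : R))) by
          rw [show ξ 1 = 0 from sub_self _]; exact hn)
      have m3' := m3.eventually (p := fun z => z ∈ c₃.target) hn
      filter_upwards [m1, m2', m3'] with z h1 h2 h3 h
      have e1 : e (ξ z.2) = z.2 := by simp [e, paramOne, ξ, φ, (chartAt EG (1 : G)).left_inv h1]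
      have e2 : c₃.symm (0, (ξ z.2, z.1.1)) = z.2 • σ z.1.1 := by
        rw [(ht₃ _ h2).2]
        change e (ξ z.2) • _ = _
        rw [e1]
      have e3 : c₃.symm (0, (0, z.1.2)) = σ z.1.2 := by
        rw [(ht₃ _ h3).2]
        change e 0 • _ = _
        rw [show e 0 = 1 from paramOne_zero EG G, one_smul]
      have h4 := c₃.symm.injOn h2 h3 (by rw [e2, e3, h])
      simpa using congrArg (fun z => z.2.2) h4)
  -- The target is cut down to a product, so that `s` and `ξ` can be set to zero without leaving it,
  -- with the `t`-factor inside `W₀`.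
  obtain ⟨A₁, hA₁, V, hV, hAV⟩ := mem_nhds_prod_iff.1 (c₃.open_target.mem_nhds h0t₃)
  obtain ⟨B₁, hB₁, W₁, hW₁, hBW⟩ := mem_nhds_prod_iff.1 hV
  let A₂ := interior A₁
  let B₂ := interior B₁
  let W₂ := interior W₁ ∩ W₀
  let box := A₂ ×ˢ (B₂ ×ˢ W₂)
  have hbox : IsOpen box := isOpen_interior.prod (isOpen_interior.prod (isOpen_interior.inter hW₀))
  have hboxt : box ⊆ c₃.target := fun z hz => hAV ⟨interior_subset hz.1,
    hBW ⟨interior_subset hz.2.1, interior_subset hz.2.2.1⟩⟩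
  have h0box : (0 : S × (EG × R)) ∈ box := ⟨mem_interior_iff_mem_nhds.2 hA₁,
    mem_interior_iff_mem_nhds.2 hB₁, mem_interior_iff_mem_nhds.2 hW₁, h0W₀⟩
  let c := (c₃.symm.restrOpen box hbox).symm
  have hct : c.target = box := Set.inter_eq_right.2 hboxt
  have hcsrc : ∀ x, x ∈ c.source ↔ x ∈ c₃.source ∧ c₃ x ∈ box := fun x => Iff.rfl
  have hrep : ∀ x ∈ c.source, c₃ x ∈ O₂ ∧ x = e (c₃ x).2.1 • c₁.symm (i (c₃ x)) := by
    intro x hx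
    have h1 := ht₃ _ (c₃.map_source hx.1)
    exact ⟨h1.1.1, (c₃.left_inv hx.1).symm.trans h1.2⟩
  -- The first coordinate agrees with `f` only before translation by the group, but invariance of
  -- the level set preserves its zero locus.
  have hfst : ∀ x ∈ c.source, (c₃ x).1 = 0 ↔ f x = 0 := by
    intro x hx
    obtain ⟨h1, h2⟩ := hrep x hx
    conv_rhs => rw [h2, hinv', ← hcf _ (c₁.map_target h1.2), c₁.right_inv h1.2]
  refine ⟨c, ⟨hp₃, by change c₃ p ∈ box; rw [hc₃p]; exact h0box⟩, hc₃p, ⟨hc₃.smooth.mono fun x hx => hx.1,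
    hc₃.smooth_symm.mono fun x hx => hx.1⟩, ⟨A₂, B₂, W₂, isOpen_interior.inter hW₀, hct⟩, hfst, ?_⟩
  intro x hx y hy hfx hfy
  have hx1 := (hrep x hx).2
  have hy1 := (hrep y hy).2
  have hix : c₁.symm (i (c₃ x)) = σ (c₃ x).2.2 := by
    change c₁.symm ((c₃ x).1, _) = _
    rw [(hfst x hx).2 hfx]
  have hiy : c₁.symm (i (c₃ y)) = σ (c₃ y).2.2 := by
    change c₁.symm ((c₃ y).1, _) = _
    rw [(hfst y hy).2 hfy]
  rw [hix] at hx1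
  rw [hiy] at hy1
  constructor
  · rintro ⟨γ, hγ⟩
    refine hW₀inj _ hx.2.2.2.2 _ hy.2.2.2.2 ((e (c₃ y).2.1)⁻¹ * γ * e (c₃ x).2.1) ?_
    change _ • σ (c₃ x).2.2 = σ (c₃ y).2.2
    rw [mul_smul, mul_smul, ← hx1, hγ, inv_smul_eq_iff, ← hy1]
  · intro h
    refine ⟨e (c₃ y).2.1 * (e (c₃ x).2.1)⁻¹, ?_⟩
    have h' : (c₃ x).2.2 = (c₃ y).2.2 := h
    rw [mul_smul, inv_smul_eq_iff.2 hx1, h', ← hy1]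

end Slice

/-! ### Properness of compact group actions -/

section Quotient

/-- The quotient by a continuous action of a compact group is Hausdorff. -/
theorem properSMul_of_compactSpace {G X : Type*} [TopologicalSpace G] [Group G]
    [TopologicalSpace X] [MulAction G X] [ContinuousSMul G X] [T2Space X] [CompactSpace G] :
    ProperSMul G X := by
  rw [properSMul_iff_continuousSMul_ultrafilter_tendsto_t2]
  refine ⟨inferInstance, fun 𝒰 x₁ x₂ _ => ?_⟩
  have h := (isCompact_univ (X := G)).ultrafilter_le_nhds (𝒰.map Prod.fst) (by simp)
  obtain ⟨g, -, hg⟩ := h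
  exact ⟨g, hg⟩

end Quotient

/-! ### Charts of the level set and of the quotient -/

section SliceData

variable {E : Type*} [NormedAddCommGroup E] [NormedSpace ℝ E] [FiniteDimensional ℝ E]
  {M : Type*} [TopologicalSpace M] [ChartedSpace E M] [IsManifold 𝓘(ℝ, E) ∞ M]
  {EG : Type*} [NormedAddCommGroup EG] [NormedSpace ℝ EG] [FiniteDimensional ℝ EG]
  {G : Type*} [TopologicalSpace G] [ChartedSpace EG G] [Group G] [LieGroup 𝓘(ℝ, EG) ∞ G]
  [MulAction G M] [ContMDiffSMul 𝓘(ℝ, EG) 𝓘(ℝ, E) ∞ G M]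
  {S : Type*} [NormedAddCommGroup S] [NormedSpace ℝ S] [FiniteDimensional ℝ S]
  {R : Type*} [NormedAddCommGroup R] [NormedSpace ℝ R] [FiniteDimensional ℝ R]
  {P : SubMulAction G M} {f : M → S} {p : P} {c : OpenPartialHomeomorph M (S × (EG × R))}

theorem quotientMap_eq_iff {q q' : P} :
    quotientMap P q = quotientMap P q' ↔ ∃ γ : G, γ • (q : M) = q' := by
  refine Quotient.eq''.trans ?_
  rw [MulAction.orbitRel_apply]
  constructor
  · rintro ⟨γ, hγ⟩
    refine ⟨γ⁻¹, ?_⟩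
    rw [← hγ]
    simp
  · rintro ⟨γ, hγ⟩
    exact ⟨γ⁻¹, Subtype.ext (by simp [← hγ])⟩

theorem IsSliceChart.zero_mem (hc : IsSliceChart (E := E) G f (p : M) c) :
    ((0 : S), ((0 : EG), (0 : R))) ∈ c.target := by
  have := c.map_source hc.mem_source
  rwa [hc.map_self] at this

theorem IsSliceChart.mem_target (hc : IsSliceChart (E := E) G f (p : M) c) {s : S} {ξ : EG} {t : R}
    (h : (s, (ξ, t)) ∈ c.target) : ((0 : S), ((0 : EG), t)) ∈ c.target := by
  have h0 := hc.zero_mem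
  obtain ⟨A, B, W, hW, ht⟩ := hc.target
  rw [ht] at h h0 ⊢
  exact ⟨h0.1, h0.2.1, h.2.2⟩

theorem IsSliceChart.symm_mem (hc : IsSliceChart (E := E) G f (p : M) c)
    (hP : ∀ x, x ∈ P ↔ f x = 0) {y : EG × R} (hy : ((0 : S), y) ∈ c.target) :
    c.symm (0, y) ∈ P := by
  rw [hP, ← hc.fst_eq _ (c.map_target hy), c.right_inv hy]

/-- On `P` the first coordinate of a slice chart is zero, so the other two are coordinates of `P`.
-/
theorem IsSliceChart.exists_levelSet_chart (hc : IsSliceChart (E := E) G f (p : M) c)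
    (hP : ∀ x, x ∈ P ↔ f x = 0) :
    ∃ e : OpenPartialHomeomorph P (EG × R), e.source = {q : P | (q : M) ∈ c.source} ∧
      (∀ q : P, e q = (c q).2) ∧ e.target = {y | ((0 : S), y) ∈ c.target} ∧
      ∀ y ∈ e.target, (e.symm y : M) = c.symm (0, y) := by
  classical
  have h0 : ∀ q : P, (q : M) ∈ c.source → c q = (0, (c q).2) := fun q hq =>
    Prod.ext ((hc.fst_eq _ hq).2 ((hP _).1 q.2)) rfl
  let inv : EG × R → P := fun y => if h : ((0 : S), y) ∈ c.target
    then ⟨c.symm (0, y), hc.symm_mem hP h⟩ else p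
  have hinv : ∀ y, ((0 : S), y) ∈ c.target → (inv y : M) = c.symm (0, y) := fun y hy => by
    simp [inv, hy]
  refine ⟨⟨⟨⟨fun q => (c q).2, inv, {q : P | (q : M) ∈ c.source}, {y | ((0 : S), y) ∈ c.target},
    fun q hq => ?_, fun y hy => ?_, fun q hq => ?_, fun y hy => ?_⟩, ?_, ?_⟩,
    c.open_source.preimage continuous_subtype_val, c.open_target.preimage (by fun_prop)⟩,
    rfl, fun _ => rfl, rfl, hinv⟩
  · have := c.map_source hq
    rwa [h0 q hq] at this
  · change (inv y : M) ∈ c.source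
    rw [hinv y hy]; exact c.map_target hy
  · refine Subtype.ext ?_
    have h1 := c.map_source hq
    rw [h0 q hq] at h1
    rw [hinv _ h1, ← h0 q hq, c.left_inv hq]
  · change (c (inv y)).2 = y
    rw [hinv y hy, c.right_inv hy]
  · exact continuous_snd.comp_continuousOn
      (c.continuousOn.comp continuous_subtype_val.continuousOn fun _ h => h)
  · rw [continuousOn_iff_continuous_domRestrict, continuous_induced_rng]
    refine (continuousOn_iff_continuous_domRestrict (f := fun y => (inv y : M))).1 ?_
    refine ContinuousOn.congr (f := fun y => c.symm (0, y)) ?_ hinv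
    exact c.continuousOn_symm.comp (by fun_prop) fun _ h => h

/-- Orbits in `P` are the fibres of the last coordinate, which therefore descends; its continuity
uses that the quotient map is open. -/
theorem IsSliceChart.exists_quotient_chart (hc : IsSliceChart (E := E) G f (p : M) c)
    (hP : ∀ x, x ∈ P ↔ f x = 0) :
    ∃ e : OpenPartialHomeomorph (ReducedSpace P) R,
      e.source = quotientMap P '' {q : P | (q : M) ∈ c.source} ∧
      (∀ q : P, (q : M) ∈ c.source → e (quotientMap P q) = (c q).2.2) ∧
      e.target = {t | ((0 : S), ((0 : EG), t)) ∈ c.target} ∧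
      ∀ t ∈ e.target, ∃ q : P, (q : M) = c.symm (0, (0, t)) ∧ e.symm t = quotientMap P q := by
  classical
  have hcs : ContinuousSMul G M := ContMDiffSMul.continuousSMul (I := 𝓘(ℝ, EG)) (I' := 𝓘(ℝ, E)) ∞
  have hπ : IsOpenQuotientMap (quotientMap P) := MulAction.isOpenQuotientMap_quotientMk
  obtain ⟨lev, hl1, hl2, hl3, hl4⟩ := hc.exists_levelSet_chart hP
  let U : Set P := {q : P | (q : M) ∈ c.source}
  have hU : IsOpen U := c.open_source.preimage continuous_subtype_val
  let rep : ReducedSpace P → P := fun n => if h : ∃ q ∈ U, quotientMap P q = n then h.choose else p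
  have hrep : ∀ q ∈ U, rep (quotientMap P q) ∈ U ∧
      quotientMap P (rep (quotientMap P q)) = quotientMap P q := by
    intro q hq
    have h : ∃ q' ∈ U, quotientMap P q' = quotientMap P q := ⟨q, hq, rfl⟩
    simp only [rep, dif_pos h]
    exact h.choose_spec
  let F : ReducedSpace P → R := fun n => (c (rep n)).2.2
  have hF : ∀ q ∈ U, F (quotientMap P q) = (c q).2.2 := by
    intro q hq
    obtain ⟨h1, h2⟩ := hrep q hq
    exact (hc.orbit _ h1 _ hq ((hP _).1 (rep _).2) ((hP _).1 q.2)).1 (quotientMap_eq_iff.1 h2)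
  let W : Set R := {t | ((0 : S), ((0 : EG), t)) ∈ c.target}
  have hlt : ∀ t ∈ W, ((0 : EG), t) ∈ lev.target := fun t ht => by rw [hl3]; exact ht
  have hls : ∀ t ∈ W, lev.symm (0, t) ∈ U := fun t ht => by
    have := lev.map_target (hlt t ht); rwa [hl1] at this
  have hFl : ∀ t ∈ W, F (quotientMap P (lev.symm (0, t))) = t := by
    intro t ht
    rw [hF _ (hls t ht), ← hl2, lev.right_inv (hlt t ht)]
  refine ⟨⟨⟨⟨F, fun t => quotientMap P (lev.symm (0, t)), quotientMap P '' U, W, ?_, ?_, ?_, hFl⟩, ?_, ?_⟩,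
    hπ.isOpenMap U hU, c.open_target.preimage (by fun_prop)⟩, rfl, hF, rfl,
    fun t ht => ⟨lev.symm (0, t), hl4 _ (hlt t ht), rfl⟩⟩
  · rintro _ ⟨q, hq, rfl⟩
    rw [hF q hq]
    exact hc.mem_target (s := (c q).1) (ξ := (c q).2.1) (c.map_source hq)
  · intro t ht
    exact ⟨_, hls t ht, rfl⟩
  · rintro _ ⟨q, hq, rfl⟩
    have ht : (c q).2.2 ∈ W := hc.mem_target (s := (c q).1) (ξ := (c q).2.1) (c.map_source hq)
    rw [hF q hq, quotientMap_eq_iff]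
    refine (hc.orbit _ (hls _ ht) _ hq ((hP _).1 (lev.symm _).2) ((hP _).1 q.2)).2 ?_
    rw [← hl2, lev.right_inv (hlt _ ht)]
  · rintro _ ⟨q, hq, rfl⟩
    refine ContinuousAt.continuousWithinAt (hπ.continuousAt_comp_iff.1 ?_)
    refine ContinuousAt.congr (f := fun q : P => (c q).2.2) ?_ ?_
    · exact (continuous_snd.comp continuous_snd).continuousAt.comp
        (ContinuousAt.comp_of_eq (c.continuousAt hq) continuous_subtype_val.continuousAt rfl)
    · filter_upwards [hU.mem_nhds hq] with q' hq' using (hF q' hq').symm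
  · exact hπ.continuous.comp_continuousOn
      (lev.continuousOn_symm.comp (by fun_prop) fun t ht => hlt t ht)

end SliceData

theorem isManifold_of_forall {F X : Type*} [NormedAddCommGroup F] [NormedSpace ℝ F]
    [TopologicalSpace X] [ChartedSpace F X]
    (h : ∀ e e' : OpenPartialHomeomorph X F, e ∈ atlas F X → e' ∈ atlas F X →
      ∀ y ∈ e.target, e.symm y ∈ e'.source → ContDiffAt ℝ ∞ (fun y => e' (e.symm y)) y) :
    IsManifold 𝓘(ℝ, F) ∞ X := by
  refine isManifold_of_contDiffOn 𝓘(ℝ, F) ∞ X fun e e' he he' y hy => ?_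
  exact (h e e' he he' y hy.1.1 hy.1.2).contDiffWithinAt

section SliceData

variable {E : Type*} [NormedAddCommGroup E] [NormedSpace ℝ E] [FiniteDimensional ℝ E]
  {M : Type*} [TopologicalSpace M] [ChartedSpace E M] [IsManifold 𝓘(ℝ, E) ∞ M]
  {EG : Type*} [NormedAddCommGroup EG] [NormedSpace ℝ EG] [FiniteDimensional ℝ EG]
  {G : Type*} [TopologicalSpace G] [ChartedSpace EG G] [Group G] [LieGroup 𝓘(ℝ, EG) ∞ G]
  [MulAction G M] [ContMDiffSMul 𝓘(ℝ, EG) 𝓘(ℝ, E) ∞ G M]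
  {S : Type*} [NormedAddCommGroup S] [NormedSpace ℝ S] [FiniteDimensional ℝ S]
  {R : Type*} [NormedAddCommGroup R] [NormedSpace ℝ R] [FiniteDimensional ℝ R]
  {EP : Type*} [NormedAddCommGroup EP] [NormedSpace ℝ EP] [FiniteDimensional ℝ EP]

variable (E EG R EP) in
/-- Charts near `p` of the ambient manifold, of the level set `P` and of the quotient `P / G`
that are adapted to each other. -/
structure SliceData (f : M → S) (P : SubMulAction G M) (p : P) where
  c : OpenPartialHomeomorph M (S × (EG × R))
  slice : IsSliceChart (E := E) G f (p : M) c
  equiv : (EG × R) ≃L[ℝ] EP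
  lev : OpenPartialHomeomorph P EP
  mem_lev_source : ∀ q : P, q ∈ lev.source ↔ (q : M) ∈ c.source
  lev_apply : ∀ q : P, lev q = equiv (c q).2
  mem_lev_target : ∀ y, y ∈ lev.target ↔ ((0 : S), equiv.symm y) ∈ c.target
  lev_symm : ∀ y ∈ lev.target, (lev.symm y : M) = c.symm (0, equiv.symm y)
  quo : OpenPartialHomeomorph (ReducedSpace P) R
  quo_source : quo.source = quotientMap P '' {q : P | (q : M) ∈ c.source}
  quo_apply : ∀ q : P, (q : M) ∈ c.source → quo (quotientMap P q) = (c q).2.2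
  mem_quo_target : ∀ t, t ∈ quo.target ↔ ((0 : S), ((0 : EG), t)) ∈ c.target
  quo_symm : ∀ t ∈ quo.target, ∃ q : P, (q : M) = c.symm (0, (0, t)) ∧
    quo.symm t = quotientMap P q

theorem IsSliceChart.nonempty_sliceData {f : M → S} {P : SubMulAction G M} {p : P}
    {c : OpenPartialHomeomorph M (S × (EG × R))} (hc : IsSliceChart (E := E) G f (p : M) c)
    (hP : ∀ x, x ∈ P ↔ f x = 0)
    (hd : Module.finrank ℝ EP = Module.finrank ℝ EG + Module.finrank ℝ R) :
    Nonempty (SliceData E EG R EP f P p) := by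
  obtain ⟨lev, h1, h2, h3, h4⟩ := hc.exists_levelSet_chart hP
  obtain ⟨quo, k1, k2, k3, k4⟩ := hc.exists_quotient_chart hP
  let ℓ : (EG × R) ≃L[ℝ] EP := ContinuousLinearEquiv.ofFinrankEq (by
    rw [Module.finrank_prod, hd])
  refine ⟨⟨c, hc, ℓ, lev.trans ℓ.toHomeomorph.toOpenPartialHomeomorph, fun q => ?_, fun q => ?_,
    fun y => ?_, fun y hy => ?_, quo, k1, k2, fun t => ?_, k4⟩⟩
  · simp [h1]
  · simp [h2]
  · simp only [OpenPartialHomeomorph.trans_target]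
    simp [h3]
  · refine h4 (ℓ.symm y) ?_
    exact hy.2
  · rw [k3]; rfl

variable {f : M → S} {P : SubMulAction G M} (D : ∀ p : P, SliceData E EG R EP f P p)

theorem SliceData.mem_lev_self {p : P} (D : SliceData E EG R EP f P p) : p ∈ D.lev.source :=
  (D.mem_lev_source p).2 D.slice.mem_source

theorem SliceData.mem_quo_self {p : P} (D : SliceData E EG R EP f P p) :
    quotientMap P p ∈ D.quo.source := by
  rw [D.quo_source]
  exact ⟨p, D.slice.mem_source, rfl⟩

/-- The atlas of the level set. -/
abbrev levelChartedSpace : ChartedSpace EP P where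
  atlas := Set.range fun p => (D p).lev
  chartAt p := (D p).lev
  mem_chart_source p := (D p).mem_lev_self
  chart_mem_atlas p := ⟨p, rfl⟩

/-- The atlas of the quotient. -/
abbrev quotientChartedSpace : ChartedSpace R (ReducedSpace P) where
  atlas := Set.range fun p => (D p).quo
  chartAt n := (D n.out).quo
  mem_chart_source n := by
    have h := (D n.out).mem_quo_self
    rwa [show quotientMap P n.out = n from Quotient.out_eq n] at h
  chart_mem_atlas n := ⟨n.out, rfl⟩

theorem isManifold_level :
    letI := levelChartedSpace D
    IsManifold 𝓘(ℝ, EP) ∞ P := by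
  letI := levelChartedSpace D
  refine isManifold_of_forall ?_
  rintro _ _ ⟨p, rfl⟩ ⟨p', rfl⟩ y hy hy'
  dsimp only at hy hy' ⊢
  have h1 := ((D p).mem_lev_target y).1 hy
  have h2 := ((D p').mem_lev_source _).1 hy'
  rw [(D p).lev_symm y hy] at h2
  have key : ContMDiffAt 𝓘(ℝ, EP) 𝓘(ℝ, EP) ∞ (fun y =>
      (D p').equiv ((D p').c ((D p).c.symm (0, (D p).equiv.symm y))).2) y := by
    have a1 : ContMDiffAt 𝓘(ℝ, EP) 𝓘(ℝ, S × (EG × R)) ∞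
        (fun y => ((0 : S), (D p).equiv.symm y)) y :=
      ContDiff.contMDiff (by fun_prop) |>.contMDiffAt
    have a2 := ((D p).slice.smooth.smooth_symm.contMDiffAt
      ((D p).c.open_target.mem_nhds h1)).comp y a1
    have a3 := ((D p').slice.smooth.smooth.contMDiffAt
      ((D p').c.open_source.mem_nhds h2)).comp y a2
    have a4 : ContMDiff 𝓘(ℝ, S × (EG × R)) 𝓘(ℝ, EP) ∞
        (fun z : S × (EG × R) => (D p').equiv z.2) := ContDiff.contMDiff (by fun_prop)
    exact a4.contMDiffAt.comp y a3
  refine key.contDiffAt.congr_of_eventuallyEq ?_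
  filter_upwards [(D p).lev.open_target.mem_nhds hy] with z hz
  rw [(D p').lev_apply, (D p).lev_symm z hz]

/-- A transition map is computed in `M`: go up by one inverse slice chart, translate by a group
element into the domain of the other, and take the last coordinate. The element found at one point
serves nearby as well. -/
theorem isManifold_quotient :
    letI := quotientChartedSpace D
    IsManifold 𝓘(ℝ, R) ∞ (ReducedSpace P) := by
  letI := quotientChartedSpace D
  refine isManifold_of_forall ?_
  rintro _ _ ⟨p, rfl⟩ ⟨p', rfl⟩ t ht ht'
  dsimp only at ht ht' ⊢
  have h1 := ((D p).mem_quo_target t).1 ht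
  obtain ⟨q, hq1, hq2⟩ := (D p).quo_symm t ht
  rw [hq2, (D p').quo_source] at ht'
  obtain ⟨q', hq', hqq'⟩ := ht'
  obtain ⟨γ, hγ⟩ := quotientMap_eq_iff.1 hqq'.symm
  have a1 : ContMDiffAt 𝓘(ℝ, R) 𝓘(ℝ, S × (EG × R)) ∞
      (fun t : R => ((0 : S), ((0 : EG), t))) t :=
    ContDiff.contMDiff (by fun_prop) |>.contMDiffAt
  have a2 := ((D p).slice.smooth.smooth_symm.contMDiffAt
    ((D p).c.open_target.mem_nhds h1)).comp t a1
  have a3 : ContMDiffAt 𝓘(ℝ, R) 𝓘(ℝ, E) ∞ (fun t : R => γ • (D p).c.symm (0, (0, t))) t :=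
    ContMDiffAt.smul (I := 𝓘(ℝ, EG)) contMDiffAt_const a2
  have h2 : γ • (D p).c.symm (0, (0, t)) ∈ (D p').c.source := by
    rw [← hq1, hγ]; exact hq'
  have hn := (D p').c.open_source.mem_nhds h2
  have a4 := ((D p').slice.smooth.smooth.contMDiffAt hn).comp t a3
  have a5 : ContMDiff 𝓘(ℝ, S × (EG × R)) 𝓘(ℝ, R) ∞ (fun z : S × (EG × R) => z.2.2) :=
    ContDiff.contMDiff (by fun_prop)
  refine (a5.contMDiffAt.comp t a4).contDiffAt.congr_of_eventuallyEq ?_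
  filter_upwards [(D p).quo.open_target.mem_nhds ht, a3.continuousAt hn] with s hs hs'
  obtain ⟨r, hr1, hr2⟩ := (D p).quo_symm s hs
  have hr3 : quotientMap P r = quotientMap P (γ • r) := quotientMap_eq_iff.2 ⟨γ, rfl⟩
  have hr4 : ((γ • r : P) : M) ∈ (D p').c.source := by
    change γ • (r : M) ∈ _
    rw [hr1]; exact hs'
  rw [hr2, hr3, (D p').quo_apply _ hr4]
  change ((D p').c (γ • (r : M))).2.2 = _
  rw [hr1]
  rfl

end SliceData

/-! ### Embedding, submersion and local sections -/

section Reduction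

variable {E : Type u} [NormedAddCommGroup E] [NormedSpace ℝ E]
  {M : Type*} [TopologicalSpace M] [ChartedSpace E M]
  {G : Type*} [Group G] [MulAction G M]
  {EP : Type} [NormedAddCommGroup EP] [NormedSpace ℝ EP]
  {EN : Type*} [NormedAddCommGroup EN] [NormedSpace ℝ EN]

variable (E EP EN) in
/-- The level set `P` and the quotient `P / G` carry smooth structures for which the inclusion is
an embedding and the quotient map a submersion; the quotient map extends locally to `M` and has
smooth local sections. -/
structure IsReduction (P : SubMulAction G M) [ChartedSpace EP P]
    [ChartedSpace EN (ReducedSpace P)] : Prop where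
  incl : ContMDiff 𝓘(ℝ, EP) 𝓘(ℝ, E) ∞ (fun q : P => (q : M))
  dIncl_injective : ∀ p : P, Function.Injective
    (mfderiv 𝓘(ℝ, EP) 𝓘(ℝ, E) (fun q : P => (q : M)) p)
  embedding : Manifold.IsSmoothEmbedding 𝓘(ℝ, EP) 𝓘(ℝ, E) ∞ (fun q : P => (q : M))
  submersion : Manifold.IsSubmersion 𝓘(ℝ, EP) 𝓘(ℝ, EN) ∞ (quotientMap P)
  extend : ∀ p : P, ∃ (ρ : M → ReducedSpace P) (O : Set M), IsOpen O ∧ (p : M) ∈ O ∧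
    ContMDiffOn 𝓘(ℝ, E) 𝓘(ℝ, EN) ∞ ρ O ∧ ∀ q : P, (q : M) ∈ O → ρ q = quotientMap P q
  sect : ∀ p : P, ∃ (s : ReducedSpace P → M) (V : Set (ReducedSpace P)), IsOpen V ∧
    quotientMap P p ∈ V ∧ ContMDiffOn 𝓘(ℝ, EN) 𝓘(ℝ, E) ∞ s V ∧ s (quotientMap P p) = p ∧
    ∀ n ∈ V, ∃ q : P, (q : M) = s n ∧ quotientMap P q = n

end Reduction

/-- The complement witnessing the immersion into `M` is taken in the universe of `E`, whereas the
normal directions `S` may live in another one. -/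
theorem exists_normedSpace_finrank (n : ℕ) :
    ∃ (F : Type u) (_ : NormedAddCommGroup F) (_ : NormedSpace ℝ F) (_ : FiniteDimensional ℝ F),
      Module.finrank ℝ F = n := by
  let e : ULift.{u} (EuclideanSpace ℝ (Fin n)) ≃ₗ[ℝ] EuclideanSpace ℝ (Fin n) :=
    ULift.moduleEquiv
  refine ⟨ULift.{u} (EuclideanSpace ℝ (Fin n)), inferInstance, inferInstance,
    Module.Finite.equiv e.symm, ?_⟩
  rw [e.finrank_eq]
  simp

section SliceData

variable {E : Type u} [NormedAddCommGroup E] [NormedSpace ℝ E] [FiniteDimensional ℝ E]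
  {M : Type*} [TopologicalSpace M] [ChartedSpace E M] [IsManifold 𝓘(ℝ, E) ∞ M]
  {EG : Type*} [NormedAddCommGroup EG] [NormedSpace ℝ EG] [FiniteDimensional ℝ EG]
  {G : Type*} [TopologicalSpace G] [ChartedSpace EG G] [Group G] [LieGroup 𝓘(ℝ, EG) ∞ G]
  [MulAction G M] [ContMDiffSMul 𝓘(ℝ, EG) 𝓘(ℝ, E) ∞ G M]
  {S : Type*} [NormedAddCommGroup S] [NormedSpace ℝ S] [FiniteDimensional ℝ S]
  {R : Type*} [NormedAddCommGroup R] [NormedSpace ℝ R] [FiniteDimensional ℝ R]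
  {EP : Type} [NormedAddCommGroup EP] [NormedSpace ℝ EP] [FiniteDimensional ℝ EP]
  {f : M → S} {P : SubMulAction G M} (D : ∀ p : P, SliceData E EG R EP f P p)

/-- In slice charts the inclusion is y ↦ (0, y) and the quotient map is (ξ, t) ↦ t, up to linear
isomorphisms; local extensions and sections are again coordinate maps. -/
theorem isReduction_of_sliceData
    (hdim : P → Module.finrank ℝ E = Module.finrank ℝ S + Module.finrank ℝ EP) :
    letI := levelChartedSpace D
    letI := quotientChartedSpace D
    IsReduction E EP R P := by
  let _ := levelChartedSpace D
  let _ := quotientChartedSpace D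
  have _ := isManifold_level D
  have _ := isManifold_quotient D
  have hlev : ∀ p, (D p).lev ∈ IsManifold.maximalAtlas 𝓘(ℝ, EP) ∞ P := fun p =>
    IsManifold.subset_maximalAtlas ⟨p, rfl⟩
  have hquo : ∀ p, (D p).quo ∈ IsManifold.maximalAtlas 𝓘(ℝ, R) ∞ (ReducedSpace P) := fun p =>
    IsManifold.subset_maximalAtlas ⟨p, rfl⟩
  have hincl : ContMDiff 𝓘(ℝ, EP) 𝓘(ℝ, E) ∞ (fun q : P => (q : M)) := by
    intro p
    have a1 := contMDiffAt_of_mem_maximalAtlas (hlev p) (D p).mem_lev_self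
    have a2 : ContMDiff 𝓘(ℝ, EP) 𝓘(ℝ, S × (EG × R)) ∞
        (fun y => ((0 : S), (D p).equiv.symm y)) := ContDiff.contMDiff (by fun_prop)
    have h1 := ((D p).mem_lev_target _).1 ((D p).lev.map_source (D p).mem_lev_self)
    have a3 := ((D p).slice.smooth.smooth_symm.contMDiffAt
      ((D p).c.open_target.mem_nhds h1)).comp p (a2.contMDiffAt.comp p a1)
    refine a3.congr_of_eventuallyEq ?_
    filter_upwards [(D p).lev.open_source.mem_nhds (D p).mem_lev_self] with q hq
    have h2 := (D p).lev_symm _ ((D p).lev.map_source hq)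
    rw [(D p).lev.left_inv hq] at h2
    exact h2
  refine ⟨hincl, fun p => ?_, ⟨?_, Topology.IsEmbedding.subtypeVal⟩, ?_, fun p => ?_, fun p => ?_⟩
  · let r : M → P := fun x => (D p).lev.symm ((D p).equiv ((D p).c x).2)
    have b1 : (D p).equiv ((D p).c p).2 ∈ (D p).lev.target := by
      rw [← (D p).lev_apply]; exact (D p).lev.map_source (D p).mem_lev_self
    have b2 : ContMDiffAt 𝓘(ℝ, E) 𝓘(ℝ, EP) ∞ (fun x => (D p).equiv ((D p).c x).2) (p : M) := by
      have a4 : ContMDiff 𝓘(ℝ, S × (EG × R)) 𝓘(ℝ, EP) ∞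
        (fun z : S × (EG × R) => (D p).equiv z.2) := ContDiff.contMDiff (by fun_prop)
      exact a4.contMDiffAt.comp (p : M) ((D p).slice.smooth.smooth.contMDiffAt
        ((D p).c.open_source.mem_nhds (D p).slice.mem_source))
    have b3 : ContMDiffAt 𝓘(ℝ, E) 𝓘(ℝ, EP) ∞ r (p : M) :=
      (contMDiffAt_symm_of_mem_maximalAtlas (hlev p) b1).comp (p : M) b2
    have b4 := mfderiv_comp (I'' := 𝓘(ℝ, EP)) p (b3.mdifferentiableAt (by simp))
      (hincl.mdifferentiableAt (by simp) (x := p))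
    have b5 : (r ∘ fun q : P => (q : M)) =ᶠ[𝓝 p] id := by
      filter_upwards [(D p).lev.open_source.mem_nhds (D p).mem_lev_self] with q hq
      change (D p).lev.symm ((D p).equiv ((D p).c q).2) = q
      rw [← (D p).lev_apply, (D p).lev.left_inv hq]
    rw [b5.mfderiv_eq, mfderiv_id] at b4
    intro v w hvw
    have e1 := DFunLike.congr_fun b4 v
    have e2 := DFunLike.congr_fun b4 w
    refine e1.trans (Eq.trans ?_ e2.symm)
    exact congrArg (mfderiv 𝓘(ℝ, E) 𝓘(ℝ, EP) r (p : M)) hvw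
  · obtain ⟨F, _, _, _, hF⟩ := exists_normedSpace_finrank.{u} (Module.finrank ℝ S)
    refine ⟨F, inferInstance, inferInstance, fun p => ?_⟩
    let k : S ≃L[ℝ] F := ContinuousLinearEquiv.ofFinrankEq hF.symm
    let l : (EP × F) ≃L[ℝ] E := ContinuousLinearEquiv.ofFinrankEq (by
      rw [Module.finrank_prod, hF, hdim p, add_comm])
    let m : (S × (EG × R)) ≃L[ℝ] E :=
      ((k.prodCongr (D p).equiv).trans (ContinuousLinearEquiv.prodComm ℝ F EP)).trans l
    let φ : OpenPartialHomeomorph M E := (D p).c.trans m.toHomeomorph.toOpenPartialHomeomorph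
    have hφ : φ ∈ IsManifold.maximalAtlas 𝓘(ℝ, E) ∞ M := by
      refine φ.mem_maximalAtlas_of_contMDiffOn ?_ ?_
      · exact (m.contDiff.contMDiff).comp_contMDiffOn
          ((D p).slice.smooth.smooth.mono fun x hx => hx.1)
      · exact (D p).slice.smooth.smooth_symm.comp m.symm.contDiff.contMDiff.contMDiffOn
          fun x hx => hx.2
    refine Manifold.IsImmersionAtOfComplement.mk_of_charts l (D p).lev φ (D p).mem_lev_self ?_
      (hlev p) hφ ?_ ?_
    · exact ⟨(D p).slice.mem_source, trivial⟩
    · intro q hq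
      exact ⟨((D p).mem_lev_source q).1 hq, trivial⟩
    · intro y hy
      have hy' : y ∈ (D p).lev.target := by simpa using hy
      change m ((D p).c ((D p).lev.symm y : M)) = l (y, 0)
      rw [(D p).lev_symm y hy', (D p).c.right_inv (((D p).mem_lev_target y).1 hy')]
      simp [m]
  · let F := EuclideanSpace ℝ (Fin (Module.finrank ℝ EG))
    refine ⟨F, inferInstance, inferInstance, fun p => ?_⟩
    let k : EG ≃L[ℝ] F := ContinuousLinearEquiv.ofFinrankEq (by simp [F])
    let l : EP ≃L[ℝ] (R × F) := (D p).equiv.symm.trans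
      ((ContinuousLinearEquiv.prodComm ℝ EG R).trans
        ((ContinuousLinearEquiv.refl ℝ R).prodCongr k))
    refine Manifold.IsSubmersionAtOfComplement.mk_of_charts l (D p).lev (D p).quo
      (D p).mem_lev_self (D p).mem_quo_self (hlev p) (hquo p) ?_ ?_
    · intro q hq
      change quotientMap P q ∈ (D p).quo.source
      rw [(D p).quo_source]
      exact ⟨q, ((D p).mem_lev_source q).1 hq, rfl⟩
    · intro y hy
      have hy' : y ∈ (D p).lev.target := by simpa using hy
      change (D p).quo (quotientMap P ((D p).lev.symm y)) = (l y).1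
      rw [(D p).quo_apply _ (((D p).mem_lev_source _).1 ((D p).lev.map_target hy')),
        (D p).lev_symm y hy', (D p).c.right_inv (((D p).mem_lev_target y).1 hy')]
      rfl
  · have h1 : ∀ q : P, (q : M) ∈ (D p).c.source →
        quotientMap P q ∈ (D p).quo.source := fun q hq => by
      rw [(D p).quo_source]; exact ⟨q, hq, rfl⟩
    have a5 : ContMDiff 𝓘(ℝ, S × (EG × R)) 𝓘(ℝ, R) ∞ (fun z : S × (EG × R) => z.2.2) :=
      ContDiff.contMDiff (by fun_prop)
    refine ⟨fun x => (D p).quo.symm ((D p).c x).2.2, (D p).c.source, (D p).c.open_source,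
      (D p).slice.mem_source, ?_, fun q hq => ?_⟩
    · refine (contMDiffOn_symm_of_mem_maximalAtlas (hquo p)).comp
        (a5.comp_contMDiffOn (D p).slice.smooth.smooth) fun x hx => ?_
      change _ ∈ (D p).quo.target
      rw [(D p).mem_quo_target]
      exact (D p).slice.mem_target (s := ((D p).c x).1) (ξ := ((D p).c x).2.1)
        ((D p).c.map_source hx)
    · change (D p).quo.symm ((D p).c q).2.2 = quotientMap P q
      rw [← (D p).quo_apply q hq, (D p).quo.left_inv (h1 q hq)]
  · have a5 : ContMDiff 𝓘(ℝ, R) 𝓘(ℝ, S × (EG × R)) ∞ (fun t : R => ((0 : S), ((0 : EG), t))) :=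
      ContDiff.contMDiff (by fun_prop)
    refine ⟨fun n => (D p).c.symm (0, (0, (D p).quo n)), (D p).quo.source, (D p).quo.open_source,
      (D p).mem_quo_self, ?_, ?_, fun n hn => ?_⟩
    · refine (D p).slice.smooth.smooth_symm.comp
        (a5.comp_contMDiffOn (contMDiffOn_of_mem_maximalAtlas (hquo p))) fun n hn => ?_
      exact ((D p).mem_quo_target _).1 ((D p).quo.map_source hn)
    · change (D p).c.symm (0, (0, (D p).quo (quotientMap P p))) = p
      rw [(D p).quo_apply p (D p).slice.mem_source, (D p).slice.map_self]
      have := (D p).c.left_inv (D p).slice.mem_source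
      rwa [(D p).slice.map_self] at this
    · obtain ⟨q, hq1, hq2⟩ := (D p).quo_symm _ ((D p).quo.map_source hn)
      exact ⟨q, hq1, by rw [← hq2, (D p).quo.left_inv hn]⟩

end SliceData

/-! ### The form (α, dν) and its quaternionic symmetry -/

section MomentForm

variable {E : Type*} [NormedAddCommGroup E] [NormedSpace ℝ E]
  {M : Type*} [TopologicalSpace M] [ChartedSpace E M] [IsManifold 𝓘(ℝ, E) ∞ M]
  {EG : Type*} [NormedAddCommGroup EG] [NormedSpace ℝ EG]
  {G : Type*} [TopologicalSpace G] [ChartedSpace EG G] [Group G] [MulAction G M]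
  {H : HypercomplexStructure E M} {ν : Fin 3 → M → (EG →L[ℝ] ℝ)}

/-- The composition of two different complex structures is, up to sign, the third one. -/
theorem HypercomplexStructure.exists_mul (H : HypercomplexStructure E M) {a b : Fin 3}
    (hab : a ≠ b) : ∃ (c : Fin 3) (ε : ℝ), ∀ x v, H.J a x (H.J b x v) = ε • H.J c x v := by
  have h02 : ∀ x v, H.J 0 x (H.J 2 x v) = -H.J 1 x v := fun x v => by
    rw [← H.mul, H.sq]
  have h20 : ∀ x v, H.J 2 x (H.J 0 x v) = H.J 1 x v := fun x v => by
    rw [← H.mul, H.mul_rev, map_neg, h02, neg_neg]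
  have h21 : ∀ x v, H.J 2 x (H.J 1 x v) = -H.J 0 x v := fun x v => by
    rw [← H.mul, H.sq, map_neg]
  have h12 : ∀ x v, H.J 1 x (H.J 2 x v) = H.J 0 x v := fun x v => by
    rw [← neg_neg (H.J 2 x v), ← H.mul_rev, map_neg, H.sq, neg_neg]
  fin_cases a <;> fin_cases b
  · exact absurd rfl hab
  · exact ⟨2, 1, fun x v => (H.mul x v).trans (one_smul ℝ _).symm⟩
  · exact ⟨1, -1, fun x v => (h02 x v).trans (neg_one_smul ℝ _).symm⟩
  · exact ⟨2, -1, fun x v => (H.mul_rev x v).trans (neg_one_smul ℝ _).symm⟩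
  · exact absurd rfl hab
  · exact ⟨0, 1, fun x v => (h12 x v).trans (one_smul ℝ _).symm⟩
  · exact ⟨1, 1, fun x v => (h20 x v).trans (one_smul ℝ _).symm⟩
  · exact ⟨0, -1, fun x v => (h21 x v).trans (neg_one_smul ℝ _).symm⟩
  · exact absurd rfl hab

variable (H ν) in
/-- The 1-form `(I₁dν₁, (dν₁, dν₂, dν₃))`. On the level set its kernel is the horizontal space. -/
def momentForm (x : M) :
    TangentSpace 𝓘(ℝ, E) x →L[ℝ] (EG →L[ℝ] ℝ) × (Fin 3 → (EG →L[ℝ] ℝ)) :=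
  (twistedDifferential H ν 0 x).prod
    (ContinuousLinearMap.pi fun a => mfderiv 𝓘(ℝ, E) 𝓘(ℝ, EG →L[ℝ] ℝ) (ν a) x)

theorem twistedDifferential_apply (a : Fin 3) (x : M) (v : TangentSpace 𝓘(ℝ, E) x) :
    twistedDifferential H ν a x v =
      -(mfderiv 𝓘(ℝ, E) 𝓘(ℝ, EG →L[ℝ] ℝ) (ν a) x (H.J a x v) : EG →L[ℝ] ℝ) := rfl

theorem twistedDifferential_J (a : Fin 3) (x : M) (v : TangentSpace 𝓘(ℝ, E) x) :
    twistedDifferential H ν a x (H.J a x v) =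
      mfderiv 𝓘(ℝ, E) 𝓘(ℝ, EG →L[ℝ] ℝ) (ν a) x v := by
  rw [twistedDifferential_apply, H.sq, map_neg, neg_neg]

theorem momentForm_fst (hν : IsGMomentMap G H ν) (a : Fin 3) (x : M)
    (v : TangentSpace 𝓘(ℝ, E) x) :
    (momentForm H ν x v).1 = twistedDifferential H ν a x v := by
  rw [hν.cauchyRiemann a 0]; rfl

theorem momentForm_snd (x : M) (v : TangentSpace 𝓘(ℝ, E) x) (a : Fin 3) :
    (momentForm H ν x v).2 a = mfderiv 𝓘(ℝ, E) 𝓘(ℝ, EG →L[ℝ] ℝ) (ν a) x v := rfl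

theorem momentForm_J_fst (hν : IsGMomentMap G H ν) (a : Fin 3) (x : M)
    (v : TangentSpace 𝓘(ℝ, E) x) :
    (momentForm H ν x (H.J a x v)).1 = (momentForm H ν x v).2 a := by
  rw [momentForm_fst hν a, twistedDifferential_J, momentForm_snd]

theorem momentForm_J_snd_self (hν : IsGMomentMap G H ν) (a : Fin 3) (x : M)
    (v : TangentSpace 𝓘(ℝ, E) x) :
    (momentForm H ν x (H.J a x v)).2 a = -(momentForm H ν x v).1 := by
  rw [← momentForm_J_fst hν, H.sq, map_neg, Prod.fst_neg]

/-- dν_b ∘ I_a = α ∘ (I_b I_a), and I_b I_a is the third structure up to sign. -/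
theorem momentForm_J_snd_of_ne (hν : IsGMomentMap G H ν) {a b : Fin 3} (hab : b ≠ a) :
    ∃ (c : Fin 3) (ε : ℝ), ∀ x (v : TangentSpace 𝓘(ℝ, E) x),
      (momentForm H ν x (H.J a x v)).2 b = ε • (momentForm H ν x v).2 c := by
  obtain ⟨c, ε, hc⟩ := H.exists_mul hab
  refine ⟨c, ε, fun x v => ?_⟩
  rw [← momentForm_J_fst hν, hc, map_smul, Prod.smul_fst, momentForm_J_fst hν]

/-- The Cauchy–Riemann condition lets I_a permute the four components up to sign, so their common
kernel is quaternionic. -/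
theorem momentForm_J_eq_zero (hν : IsGMomentMap G H ν) (a : Fin 3) {x : M}
    {v : TangentSpace 𝓘(ℝ, E) x} (hv : momentForm H ν x v = 0) :
    momentForm H ν x (H.J a x v) = 0 := by
  refine Prod.ext ?_ (funext fun b => ?_)
  · rw [momentForm_J_fst hν, hv]; rfl
  · by_cases hab : b = a
    · subst hab
      rw [momentForm_J_snd_self hν, hv]
      simp
    · obtain ⟨c, ε, hc⟩ := momentForm_J_snd_of_ne hν hab
      rw [hc, hv]
      simp

theorem smoothFormAt_momentForm (hν : IsGMomentMap G H ν) (x : M) :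
    SmoothFormAt (momentForm H ν) x := by
  intro X hX
  refine ContMDiffAt.prodMk_space ?_ (contMDiffAt_pi_space.2 fun a => ?_)
  · exact ((hX.applyField H 0).contMDiffAt_der (hν.smooth 0 x)).neg
  · exact hX.contMDiffAt_der (hν.smooth a x)

theorem finrank_dual [FiniteDimensional ℝ EG] :
    Module.finrank ℝ (EG →L[ℝ] ℝ) = Module.finrank ℝ EG :=
  (LinearMap.toContinuousLinearMap (𝕜 := ℝ) (E := EG) (F' := ℝ)).finrank_eq.symm.trans
    Subspace.dual_finrank_eq

theorem finrank_momentForm_target [FiniteDimensional ℝ EG] :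
    Module.finrank ℝ ((EG →L[ℝ] ℝ) × (Fin 3 → (EG →L[ℝ] ℝ))) = 4 * Module.finrank ℝ EG := by
  rw [Module.finrank_prod, Module.finrank_pi_fintype, finrank_dual]
  simp
  ring

variable [FiniteDimensional ℝ E] [FiniteDimensional ℝ EG] [LieGroup 𝓘(ℝ, EG) ∞ G]
  [ContMDiffSMul 𝓘(ℝ, EG) 𝓘(ℝ, E) ∞ G M]

theorem momentForm_fundamentalVector_snd (hν : IsGMomentMap G H ν) {ζ : Fin 3 → (EG →L[ℝ] ℝ)}
    {p : M} (hp : ∀ (γ : G) a, ν a (γ • p) = ζ a) (ξ : EG) :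
    (momentForm H ν p (fundamentalVector (G := G) ξ p)).2 = 0 := by
  funext a
  refine (momentForm_snd (H := H) p _ a).trans ?_
  refine (mfderiv_fundamentalVector ((hν.smooth a).mdifferentiableAt (by simp)) ξ).trans ?_
  have : (fun γ : G => ν a (γ • p)) = fun _ => ζ a := funext fun γ => hp γ a
  rw [this, mfderiv_const]
  rfl

/-- Transversality makes ξ ↦ α(ξ) injective from 𝔤 to 𝔤*, hence bijective; the dν_a vanish because
`ν` is constant on the orbit. -/
theorem exists_momentForm_fundamentalVector (hν : IsGMomentMap G H ν)
    {ζ : Fin 3 → (EG →L[ℝ] ℝ)} {p : M} (hp : ∀ (γ : G) a, ν a (γ • p) = ζ a) (μ : EG →L[ℝ] ℝ) :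
    ∃ ξ : EG, momentForm H ν p (fundamentalVector (G := G) ξ p) = (μ, 0) := by
  let X : EG →L[ℝ] E := mfderiv 𝓘(ℝ, EG) 𝓘(ℝ, E) (fun γ : G => γ • p) 1
  let α : E →L[ℝ] (EG →L[ℝ] ℝ) := twistedDifferential H ν 0 p
  have hinj : Function.Injective (α.comp X).toLinearMap := by
    rw [← LinearMap.ker_eq_bot, LinearMap.ker_eq_bot']
    intro ξ hξ
    by_contra h
    exact hν.transversal 0 p ξ h hξ
  obtain ⟨ξ, hξ⟩ := (LinearMap.injective_iff_surjective_of_finrank_eq_finrank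
    (finrank_dual (EG := EG)).symm).1 hinj μ
  exact ⟨ξ, Prod.ext hξ (momentForm_fundamentalVector_snd hν hp ξ)⟩

/-- Orbit directions reach the first component. Rotated by I_a, they reach dν_a and nothing else,
since all dν_b vanish on the unrotated vectors. -/
theorem momentForm_surjective (hν : IsGMomentMap G H ν)
    {ζ : Fin 3 → (EG →L[ℝ] ℝ)} {p : M} (hp : ∀ (γ : G) a, ν a (γ • p) = ζ a) :
    Function.Surjective (momentForm H ν p) := by
  rintro ⟨μ, b⟩
  obtain ⟨ξ, hξ⟩ := exists_momentForm_fundamentalVector hν hp μ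
  -- The sign anticipates dν_a ∘ I_a = −α.
  choose η hη using fun a => exists_momentForm_fundamentalVector hν hp (-b a)
  have hJ : ∀ a, momentForm H ν p (H.J a p (fundamentalVector (G := G) (η a) p)) =
      (0, Pi.single a (b a)) := by
    intro a
    refine Prod.ext ?_ (funext fun c => ?_)
    · rw [momentForm_J_fst hν, hη]; rfl
    · by_cases hac : c = a
      · subst hac
        rw [momentForm_J_snd_self hν, hη]
        simp
      · obtain ⟨d, ε, hd⟩ := momentForm_J_snd_of_ne hν hac
        rw [hd, hη]
        simp [hac]
  refine ⟨fundamentalVector (G := G) ξ p +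
    ∑ a, H.J a p (fundamentalVector (G := G) (η a) p), ?_⟩
  rw [map_add, map_sum, hξ, Finset.sum_congr rfl fun a _ => hJ a]
  refine Prod.ext ?_ (funext fun c => ?_)
  · simp [Prod.fst_sum]
  · simp [Prod.snd_sum, Finset.sum_apply]

end MomentForm

/-! ### Slice charts for the level set of the moment map -/

section LevelSet

variable {E : Type u} [NormedAddCommGroup E] [NormedSpace ℝ E] [FiniteDimensional ℝ E]
  {M : Type*} [TopologicalSpace M] [ChartedSpace E M] [IsManifold 𝓘(ℝ, E) ∞ M]
  [T2Space M]
  {EG : Type*} [NormedAddCommGroup EG] [NormedSpace ℝ EG] [FiniteDimensional ℝ EG]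
  {G : Type*} [TopologicalSpace G] [ChartedSpace EG G] [Group G]
  [LieGroup 𝓘(ℝ, EG) ∞ G] [CompactSpace G]
  [MulAction G M] [ContMDiffSMul 𝓘(ℝ, EG) 𝓘(ℝ, E) ∞ G M]
  {H : HypercomplexStructure E M} {ν : Fin 3 → M → (EG →L[ℝ] ℝ)} {ζ : Fin 3 → (EG →L[ℝ] ℝ)}
  {P : SubMulAction G M}

theorem finrank_pi_dual :
    Module.finrank ℝ (Fin 3 → (EG →L[ℝ] ℝ)) = 3 * Module.finrank ℝ EG := by
  rw [Module.finrank_pi_fintype, finrank_dual]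
  simp

/-- The truncated subtractions in `LevelModel` and `ReducedModel` are genuine as soon as `P` has a
point; for empty `P` the model dimensions play no role. -/
theorem four_mul_finrank_le (hν : IsGMomentMap G H ν) (hP : ∀ x, x ∈ P ↔ ∀ a, ν a x = ζ a)
    (p : P) : 4 * Module.finrank ℝ EG ≤ Module.finrank ℝ E := by
  let β : E →L[ℝ] (EG →L[ℝ] ℝ) × (Fin 3 → (EG →L[ℝ] ℝ)) := momentForm H ν (p : M)
  have hβ : Function.Surjective β :=
    momentForm_surjective hν (fun γ => (hP _).1 (P.smul_mem γ p.2))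
  rw [← finrank_momentForm_target]
  exact LinearMap.finrank_le_finrank_of_surjective (f := β.toLinearMap) hβ

/-- The slice theorem is applied to `ν − ζ` and `a = α`, which is injective on fundamental vectors
by transversality. -/
theorem nonempty_sliceData (hν : IsGMomentMap G H ν) (hP : ∀ x, x ∈ P ↔ ∀ a, ν a x = ζ a)
    (hfree : ∀ (γ : G), ∀ x ∈ P, γ • x = x → γ = 1) (p : P) :
    Nonempty (SliceData E EG (ReducedModel E EG) (LevelModel E EG)
      (fun x a => ν a x - ζ a) P p) := by
  have hd := four_mul_finrank_le hν hP p
  have hp : ∀ (γ : G) a, ν a (γ • (p : M)) = ζ a := fun γ => (hP _).1 (P.smul_mem γ p.2)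
  have hP' : ∀ x, x ∈ P ↔ (fun a => ν a x - ζ a) = 0 := fun x => by
    rw [hP, funext_iff]
    simp [sub_eq_zero]
  have hf : ContMDiff 𝓘(ℝ, E) 𝓘(ℝ, Fin 3 → (EG →L[ℝ] ℝ)) ∞ (fun x a => ν a x - ζ a) :=
    contMDiff_pi_space.2 fun a => (hν.smooth a).sub contMDiff_const
  let α : E →L[ℝ] (EG →L[ℝ] ℝ) := twistedDifferential H ν 0 (p : M)
  have hdf : ∀ v : E, (mfderiv 𝓘(ℝ, E) 𝓘(ℝ, Fin 3 → (EG →L[ℝ] ℝ)) (fun x a => ν a x - ζ a) (p : M) :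
      E →L[ℝ] (Fin 3 → (EG →L[ℝ] ℝ))) v = (momentForm H ν (p : M) v).2 := by
    intro v
    funext a
    have h1 := HasMFDerivAt.comp (p : M)
      ((ContinuousLinearMap.proj (R := ℝ) (φ := fun _ : Fin 3 => EG →L[ℝ] ℝ) a).hasMFDerivAt)
      (hf.mdifferentiableAt (by simp) (x := (p : M))).hasMFDerivAt
    have h2 := (((hν.smooth a).mdifferentiableAt (by simp) (x := (p : M))).hasMFDerivAt).sub
      (hasMFDerivAt_const (ζ a) (p : M))
    have h3 := hasMFDerivAt_unique h1 h2
    refine (DFunLike.congr_fun h3 v).trans ?_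
    exact sub_zero (momentForm H ν (p : M) v |>.2 a)
  obtain ⟨c, hc⟩ := exists_isSliceChart (E := E) (EG := EG) (R := ReducedModel E EG) (G := G)
    hf (fun γ x hx => (hP' _).1 (P.smul_mem γ ((hP' x).2 hx))) ((hP' _).1 p.2)
    (fun γ h => hfree γ p p.2 h) α (by
      rintro ⟨b, μ⟩
      obtain ⟨v, hv⟩ := momentForm_surjective hν hp (μ, b)
      refine ⟨v, Prod.ext ((hdf v).trans (congrArg Prod.snd hv)) (congrArg Prod.fst hv)⟩)
    (fun ξ h => by
      by_contra hξ
      exact hν.transversal 0 p ξ hξ h)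
    finrank_dual (by
      refine Eq.trans ?_ (congrArg₂ (· + · + _) (finrank_pi_dual (EG := EG)).symm
        (finrank_dual (EG := EG)).symm)
      rw [finrank_euclideanSpace]
      simp
      omega)
  exact hc.nonempty_sliceData hP' (by
    rw [finrank_euclideanSpace, finrank_euclideanSpace]
    simp
    omega)

theorem exists_isReduction (hν : IsGMomentMap G H ν) (hP : ∀ x, x ∈ P ↔ ∀ a, ν a x = ζ a)
    (hfree : ∀ (γ : G), ∀ x ∈ P, γ • x = x → γ = 1) :
    ∃ (_ : ChartedSpace (LevelModel E EG) P) (_ : IsManifold 𝓘(ℝ, LevelModel E EG) ∞ P)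
      (_ : ChartedSpace (ReducedModel E EG) (ReducedSpace P))
      (_ : IsManifold 𝓘(ℝ, ReducedModel E EG) ∞ (ReducedSpace P)),
      IsReduction E (LevelModel E EG) (ReducedModel E EG) P := by
  let D := fun p => (nonempty_sliceData hν hP hfree p).some
  refine ⟨levelChartedSpace D, isManifold_level D, quotientChartedSpace D,
    isManifold_quotient D, isReduction_of_sliceData D fun p => ?_⟩
  have hd := four_mul_finrank_le hν hP p
  refine Eq.trans ?_ (congrArg (· + _) (finrank_pi_dual (EG := EG)).symm)
  rw [finrank_euclideanSpace]
  simp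
  omega

end LevelSet

theorem exists_eq_of_finrank {A B C : Type*} [NormedAddCommGroup A] [NormedSpace ℝ A]
    [NormedAddCommGroup B] [NormedSpace ℝ B] [FiniteDimensional ℝ B]
    [NormedAddCommGroup C] [NormedSpace ℝ C] [FiniteDimensional ℝ C]
    (i : A →L[ℝ] B) (b : B →L[ℝ] C) (hi : Function.Injective i) (hb : Function.Surjective b)
    (hbi : ∀ u, b (i u) = 0)
    (hd : Module.finrank ℝ A + Module.finrank ℝ C = Module.finrank ℝ B) {v : B} (hv : b v = 0) :
    ∃ u, i u = v := by
  have h1 : LinearMap.range i.toLinearMap ≤ LinearMap.ker b.toLinearMap := by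
    rintro _ ⟨u, rfl⟩
    exact hbi u
  have h2 : LinearMap.range i.toLinearMap = LinearMap.ker b.toLinearMap := by
    refine Submodule.eq_of_le_of_finrank_eq h1 ?_
    rw [LinearMap.finrank_range_of_inj hi]
    have h3 := b.toLinearMap.finrank_range_add_finrank_ker
    rw [LinearMap.range_eq_top.2 hb, finrank_top] at h3
    omega
  have h3 : v ∈ LinearMap.range i.toLinearMap := by rw [h2]; exact hv
  exact h3

theorem isInvertible_of_surjective {F F' : Type*} [NormedAddCommGroup F] [NormedSpace ℝ F]
    [NormedAddCommGroup F'] [NormedSpace ℝ F'] [FiniteDimensional ℝ F] [FiniteDimensional ℝ F']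
    (L : F →L[ℝ] F') (hL : Function.Surjective L) (h : Module.finrank ℝ F = Module.finrank ℝ F') :
    L.IsInvertible :=
  isInvertible_of_injective L
    ((LinearMap.injective_iff_surjective_of_finrank_eq_finrank (f := L.toLinearMap) h).2 hL) h

theorem mfderiv_comp_eq {E E' F : Type*} [NormedAddCommGroup E] [NormedSpace ℝ E]
    [NormedAddCommGroup E'] [NormedSpace ℝ E'] [NormedAddCommGroup F] [NormedSpace ℝ F]
    {M N : Type*} [TopologicalSpace M] [ChartedSpace E M] [TopologicalSpace N] [ChartedSpace E' N]
    {s : N → M} {n : N} {x : M} {ds : E' →L[ℝ] E} (hds : HasMFDerivAt 𝓘(ℝ, E') 𝓘(ℝ, E) s n ds)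
    (hx : s n = x) {f : M → F} (hf : MDifferentiableAt 𝓘(ℝ, E) 𝓘(ℝ, F) f x) {f' : N → F}
    {L : E' →L[ℝ] F} (hff : f ∘ s =ᶠ[𝓝 n] f') (hf' : HasMFDerivAt 𝓘(ℝ, E') 𝓘(ℝ, F) f' n L) :
    (mfderiv 𝓘(ℝ, E) 𝓘(ℝ, F) f x : E →L[ℝ] F).comp ds = L := by
  subst hx
  have h1 : HasMFDerivAt 𝓘(ℝ, E') 𝓘(ℝ, F) (f ∘ s) n
      ((mfderiv 𝓘(ℝ, E) 𝓘(ℝ, F) f (s n) : E →L[ℝ] F).comp ds) :=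
    HasMFDerivAt.comp n hf.hasMFDerivAt hds
  exact h1.mfderiv.symm.trans (hf'.congr_of_eventuallyEq hff).mfderiv

/-! ### Horizontal lifts of tangent vectors -/

section Lift

variable {E : Type*} [NormedAddCommGroup E] [NormedSpace ℝ E] [FiniteDimensional ℝ E]
  {M : Type*} [TopologicalSpace M] [ChartedSpace E M] [IsManifold 𝓘(ℝ, E) ∞ M]
  {EG : Type*} [NormedAddCommGroup EG] [NormedSpace ℝ EG] [FiniteDimensional ℝ EG]
  {G : Type*} [TopologicalSpace G] [ChartedSpace EG G] [Group G]
  [LieGroup 𝓘(ℝ, EG) ∞ G]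
  [MulAction G M] [ContMDiffSMul 𝓘(ℝ, EG) 𝓘(ℝ, E) ∞ G M]
  {H : HypercomplexStructure E M} {ν : Fin 3 → M → (EG →L[ℝ] ℝ)} {ζ : Fin 3 → (EG →L[ℝ] ℝ)}
  {P : SubMulAction G M}
  {EP : Type} [NormedAddCommGroup EP] [NormedSpace ℝ EP] [FiniteDimensional ℝ EP]
  {EN : Type*} [NormedAddCommGroup EN] [NormedSpace ℝ EN] [FiniteDimensional ℝ EN]
  [ChartedSpace EP P] [IsManifold 𝓘(ℝ, EP) ∞ P]
  [ChartedSpace EN (ReducedSpace P)] [IsManifold 𝓘(ℝ, EN) ∞ (ReducedSpace P)]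

variable (H ν ζ P EP EN) in
/-- `P` is a level set of the moment map `ν`, and `P` and `P / G` carry smooth structures of the
expected dimensions. -/
structure IsMomentReduction : Prop extends IsReduction E EP EN P where
  moment : IsGMomentMap G H ν
  mem_iff : ∀ x, x ∈ P ↔ ∀ a, ν a x = ζ a
  finrank_level : P → Module.finrank ℝ EP + 3 * Module.finrank ℝ EG = Module.finrank ℝ E
  finrank_reduced : P → Module.finrank ℝ EN + 4 * Module.finrank ℝ EG = Module.finrank ℝ E

theorem IsMomentReduction.orbit (h : IsMomentReduction H ν ζ P EP EN) (p : P) (γ : G) (a : Fin 3) : ν a (γ • (p : M)) = ζ a :=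
  (h.mem_iff _).1 (P.smul_mem γ p.2) a

theorem IsMomentReduction.hasMFDerivAt_incl (h : IsMomentReduction H ν ζ P EP EN) (p : P) :
    HasMFDerivAt 𝓘(ℝ, EP) 𝓘(ℝ, E) (fun q : P => (q : M)) p (dIncl P p) :=
  (h.incl.mdifferentiableAt (by simp)).hasMFDerivAt

theorem IsMomentReduction.contMDiff_quotientMap (h : IsMomentReduction H ν ζ P EP EN) :
    ContMDiff 𝓘(ℝ, EP) 𝓘(ℝ, EN) ∞ (quotientMap P) := by
  intro p
  obtain ⟨ρ, O, hO, hpO, hρ, hρP⟩ := h.extend p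
  refine ((hρ.contMDiffAt (hO.mem_nhds hpO)).comp p (h.incl p)).congr_of_eventuallyEq ?_
  filter_upwards [continuous_subtype_val.continuousAt.preimage_mem_nhds (hO.mem_nhds hpO)] with q hq
  exact (hρP q hq).symm

theorem IsMomentReduction.hasMFDerivAt_quotientMap (h : IsMomentReduction H ν ζ P EP EN) (p : P) :
    HasMFDerivAt 𝓘(ℝ, EP) 𝓘(ℝ, EN) (quotientMap P) p (dQuot P p) :=
  (h.contMDiff_quotientMap.mdifferentiableAt (by simp)).hasMFDerivAt

theorem IsMomentReduction.momentForm_dIncl_snd (h : IsMomentReduction H ν ζ P EP EN) (p : P) (u : EP) :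
    (momentForm H ν (p : M) (dIncl P p u)).2 = 0 := by
  funext a
  have h1 := HasMFDerivAt.comp p
    ((h.moment.smooth a).mdifferentiableAt (by simp) (x := (p : M))).hasMFDerivAt
    (h.hasMFDerivAt_incl p)
  have h2 : ((ν a) ∘ fun q : P => (q : M)) = fun _ => ζ a :=
    funext fun q => (h.mem_iff _).1 q.2 a
  rw [h2] at h1
  exact DFunLike.congr_fun (hasMFDerivAt_unique h1 (hasMFDerivAt_const (ζ a) p)) u

/-- The tangent space of `P` lies in the kernel of dν and has the same dimension. -/
theorem IsMomentReduction.exists_dIncl_eq (h : IsMomentReduction H ν ζ P EP EN) (p : P) {v : E}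
    (hv : (momentForm H ν (p : M) v).2 = 0) : ∃ u : EP, dIncl P p u = v := by
  let b : E →L[ℝ] (Fin 3 → (EG →L[ℝ] ℝ)) :=
    (ContinuousLinearMap.snd ℝ _ _).comp (momentForm H ν (p : M))
  let i : EP →L[ℝ] E := dIncl P p
  refine exists_eq_of_finrank i b (h.dIncl_injective p) (fun c => ?_)
    (h.momentForm_dIncl_snd p) ?_ hv
  · obtain ⟨w, hw⟩ := momentForm_surjective h.moment (h.orbit p) (0, c)
    exact ⟨w, congrArg Prod.snd hw⟩
  · rw [finrank_pi_dual, h.finrank_level p]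

/-- The derivative along the level set of a function that vanishes on it. -/
theorem IsMomentReduction.mfderiv_eq_zero (h : IsMomentReduction H ν ζ P EP EN) {F : Type*} [NormedAddCommGroup F] [NormedSpace ℝ F]
    (p : P) {f : M → F} (hf : MDifferentiableAt 𝓘(ℝ, E) 𝓘(ℝ, F) f (p : M))
    (hfP : ∀ᶠ x in 𝓝 (p : M), x ∈ P → f x = 0) {v : E}
    (hv : (momentForm H ν (p : M) v).2 = 0) : mfderiv 𝓘(ℝ, E) 𝓘(ℝ, F) f (p : M) v = 0 := by
  obtain ⟨u, rfl⟩ := h.exists_dIncl_eq p hv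
  have h1 := HasMFDerivAt.comp p hf.hasMFDerivAt (h.hasMFDerivAt_incl p)
  have h2 : (f ∘ fun q : P => (q : M)) =ᶠ[𝓝 p] fun _ => 0 := by
    filter_upwards [continuous_subtype_val.continuousAt.eventually hfP] with q hq
    exact hq q.2
  exact DFunLike.congr_fun (hasMFDerivAt_unique (h1.congr_of_eventuallyEq h2.symm)
    (hasMFDerivAt_const 0 p)) u

variable (H ν P EN) in
/-- The differential of `π`, extended to `M` by `ρ` and read in the chart at `n`, together with
the moment form. -/
def liftForm (n : ReducedSpace P) (ρ : M → ReducedSpace P) (x : M) :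
    TangentSpace 𝓘(ℝ, E) x →L[ℝ] EN × ((EG →L[ℝ] ℝ) × (Fin 3 → (EG →L[ℝ] ℝ))) :=
  (mfderiv 𝓘(ℝ, E) 𝓘(ℝ, EN) (extChartAt 𝓘(ℝ, EN) n ∘ ρ) x).prod (momentForm H ν x)

variable (E EN P) in
/-- `ρ` is a smooth extension near `p` of the quotient map. -/
structure IsExtensionAt (p : P) (ρ : M → ReducedSpace P) : Prop where
  smooth : ContMDiffAt 𝓘(ℝ, E) 𝓘(ℝ, EN) ∞ ρ (p : M)
  eq : ∀ᶠ x in 𝓝 (p : M), ∀ hx : x ∈ P, ρ x = quotientMap P ⟨x, hx⟩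

theorem IsMomentReduction.exists_isExtensionAt (h : IsMomentReduction H ν ζ P EP EN) (p : P) : ∃ ρ, IsExtensionAt E P EN p ρ := by
  obtain ⟨ρ, O, hO, hpO, hρ, hρP⟩ := h.extend p
  refine ⟨ρ, hρ.contMDiffAt (hO.mem_nhds hpO), ?_⟩
  filter_upwards [hO.mem_nhds hpO] with x hx hxP
  exact hρP ⟨x, hxP⟩ hx

variable {p : P} {ρ : M → ReducedSpace P}

theorem IsExtensionAt.apply_self (hρ : IsExtensionAt E P EN p ρ) : ρ p = quotientMap P p :=
  hρ.eq.self_of_nhds p.2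

theorem IsExtensionAt.contMDiffAt_chart (hρ : IsExtensionAt E P EN p ρ) :
    ContMDiffAt 𝓘(ℝ, E) 𝓘(ℝ, EN) ∞ (extChartAt 𝓘(ℝ, EN) (quotientMap P p) ∘ ρ) (p : M) := by
  refine ContMDiffAt.comp_of_eq ?_ hρ.smooth hρ.apply_self
  exact contMDiffAt_extChartAt

theorem IsMomentReduction.smoothFormAt_liftForm (h : IsMomentReduction H ν ζ P EP EN) (hρ : IsExtensionAt E P EN p ρ) :
    SmoothFormAt (liftForm H ν P EN (quotientMap P p) ρ) (p : M) := by
  intro X hX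
  exact (hX.contMDiffAt_der hρ.contMDiffAt_chart).prodMk_space (smoothFormAt_momentForm h.moment _ X hX)

theorem IsMomentReduction.eventually_mfderiv_dIncl (h : IsMomentReduction H ν ζ P EP EN) (hρ : IsExtensionAt E P EN p ρ) :
    ∀ᶠ x in 𝓝 (p : M), ∀ hx : x ∈ P, quotientMap P ⟨x, hx⟩ ∈
        (extChartAt 𝓘(ℝ, EN) (quotientMap P p)).source ∧ ∀ u : EP,
      mfderiv 𝓘(ℝ, E) 𝓘(ℝ, EN) (extChartAt 𝓘(ℝ, EN) (quotientMap P p) ∘ ρ) x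
        (dIncl P ⟨x, hx⟩ u) =
      mfderiv 𝓘(ℝ, EN) 𝓘(ℝ, EN) (extChartAt 𝓘(ℝ, EN) (quotientMap P p)) (quotientMap P ⟨x, hx⟩)
        (dQuot P ⟨x, hx⟩ u) := by
  have h1 : ∀ᶠ x in 𝓝 (p : M), ContMDiffAt 𝓘(ℝ, E) 𝓘(ℝ, EN) 1
      (extChartAt 𝓘(ℝ, EN) (quotientMap P p) ∘ ρ) x :=
    (contMDiffAt_iff_contMDiffAt_nhds (by simp)).1 (hρ.contMDiffAt_chart.of_le (by simp))
  have h2 : ∀ᶠ x in 𝓝 (p : M), ρ x ∈ (extChartAt 𝓘(ℝ, EN) (quotientMap P p)).source := by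
    apply hρ.smooth.continuousAt.preimage_mem_nhds
    rw [hρ.apply_self]
    exact extChartAt_source_mem_nhds _
  filter_upwards [h1, h2, eventually_eventually_nhds.2 hρ.eq] with x h1 h2 h3 hx
  rw [h3.self_of_nhds hx] at h2
  refine ⟨h2, fun u => ?_⟩
  have k1 := HasMFDerivAt.comp (⟨x, hx⟩ : P) (h1.mdifferentiableAt (by simp)).hasMFDerivAt
    (h.hasMFDerivAt_incl ⟨x, hx⟩)
  have k2 := HasMFDerivAt.comp (⟨x, hx⟩ : P)
    (mdifferentiableAt_extChartAt (I := 𝓘(ℝ, EN)) (by simpa using h2)).hasMFDerivAt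
    (h.hasMFDerivAt_quotientMap ⟨x, hx⟩)
  have k3 : ((extChartAt 𝓘(ℝ, EN) (quotientMap P p) ∘ ρ) ∘ fun q : P => (q : M)) =ᶠ[𝓝 ⟨x, hx⟩]
      extChartAt 𝓘(ℝ, EN) (quotientMap P p) ∘ quotientMap P := by
    filter_upwards [continuous_subtype_val.continuousAt.eventually h3] with q hq
    exact congrArg (extChartAt 𝓘(ℝ, EN) (quotientMap P p)) (hq q.2)
  exact DFunLike.congr_fun (hasMFDerivAt_unique k1 (k2.congr_of_eventuallyEq k3)) u

/-- The dimensions agree, so surjectivity suffices. Orbit directions reach all α-values and nothing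
else. The derivative of a local section reaches every tangent vector of the quotient, with its
α-value then removed by an orbit direction. The remaining components are covered by
`momentForm_surjective`. -/
theorem IsMomentReduction.isInvertible_liftForm (h : IsMomentReduction H ν ζ P EP EN) (hρ : IsExtensionAt E P EN p ρ) :
    (liftForm H ν P EN (quotientMap P p) ρ (p : M)).IsInvertible := by
  let θ : E →L[ℝ] EN × ((EG →L[ℝ] ℝ) × (Fin 3 → (EG →L[ℝ] ℝ))) :=
    liftForm H ν P EN (quotientMap P p) ρ (p : M)
  let r : M → EN := extChartAt 𝓘(ℝ, EN) (quotientMap P p) ∘ ρ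
  have hr : MDifferentiableAt 𝓘(ℝ, E) 𝓘(ℝ, EN) r (p : M) :=
    hρ.contMDiffAt_chart.mdifferentiableAt (by simp)
  have hsm : Continuous fun γ : G => γ • (p : M) :=
    (contMDiff_smul_point (E := E) (EG := EG) (G := G) (p : M)).continuous
  have hvert : ∀ μ, ∃ v : E, θ v = (0, (μ, 0)) := by
    intro μ
    obtain ⟨ξ, hξ⟩ := exists_momentForm_fundamentalVector h.moment (h.orbit p) μ
    refine ⟨fundamentalVector (G := G) ξ (p : M), Prod.ext ?_ hξ⟩
    refine (mfderiv_fundamentalVector hr ξ).trans ?_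
    have h1 : (fun γ : G => r (γ • (p : M))) =ᶠ[𝓝 1] fun _ => r p := by
      have h2 : Filter.Tendsto (fun γ : G => γ • (p : M)) (𝓝 1) (𝓝 (p : M)) := by
        have := hsm.tendsto 1
        rwa [one_smul] at this
      filter_upwards [h2.eventually hρ.eq] with γ hγ
      refine congrArg (extChartAt 𝓘(ℝ, EN) (quotientMap P p)) ?_
      rw [hρ.apply_self, hγ (P.smul_mem γ p.2), quotientMap_eq_iff]
      exact ⟨γ⁻¹, inv_smul_smul _ _⟩
    rw [h1.mfderiv_eq, mfderiv_const]
    rfl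
  have hsurj : ∀ a : EN, ∃ v : E, θ v = (a, 0) := by
    intro a
    obtain ⟨s, V, hV, hpV, hs, hsp, hsP⟩ := h.sect p
    obtain ⟨A, hA⟩ : ∃ A : EN, (mfderiv 𝓘(ℝ, EN) 𝓘(ℝ, EN)
        (extChartAt 𝓘(ℝ, EN) (quotientMap P p)) (quotientMap P p) : EN →L[ℝ] EN) A = a := by
      obtain ⟨e, he⟩ := isInvertible_mfderiv_extChartAt (I := 𝓘(ℝ, EN))
        (mem_extChartAt_source (I := 𝓘(ℝ, EN)) (quotientMap P p))
      exact ⟨e.symm a, by rw [← he]; exact e.apply_symm_apply a⟩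
    let ds : EN →L[ℝ] E := mfderiv 𝓘(ℝ, EN) 𝓘(ℝ, E) s (quotientMap P p)
    have hds : HasMFDerivAt 𝓘(ℝ, EN) 𝓘(ℝ, E) s (quotientMap P p) ds :=
      ((hs.contMDiffAt (hV.mem_nhds hpV)).mdifferentiableAt (by simp)).hasMFDerivAt
    have hs0 : Filter.Tendsto s (𝓝 (quotientMap P p)) (𝓝 (p : M)) := by
      have := (hs.continuousOn.continuousAt (hV.mem_nhds hpV)).tendsto
      rwa [hsp] at this
    have d1 : (mfderiv 𝓘(ℝ, E) 𝓘(ℝ, EN) r (p : M) : E →L[ℝ] EN) (ds A) = a := by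
      refine (DFunLike.congr_fun (mfderiv_comp_eq hds hsp hr (f' := extChartAt 𝓘(ℝ, EN) (quotientMap P p)) ?_
        (mdifferentiableAt_extChartAt (I := 𝓘(ℝ, EN)) (mem_chart_source _ _)).hasMFDerivAt)
        A).trans hA
      filter_upwards [hs0.eventually hρ.eq, hV.mem_nhds hpV] with n h1 h2
      obtain ⟨q, hq1, hq2⟩ := hsP n h2
      refine congrArg (extChartAt 𝓘(ℝ, EN) (quotientMap P p)) ?_
      have hmem : s n ∈ P := hq1 ▸ q.2
      exact (h1 hmem).trans ((congrArg (quotientMap P) (show (⟨s n, hmem⟩ : P) = q from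
        Subtype.ext hq1.symm)).trans hq2)
    have d2 : (momentForm H ν (p : M) (ds A)).2 = 0 := by
      funext b
      refine DFunLike.congr_fun (mfderiv_comp_eq hds hsp ((h.moment.smooth b).mdifferentiableAt (by simp))
        (f' := fun _ => ζ b) ?_ (hasMFDerivAt_const _ _)) A
      filter_upwards [hV.mem_nhds hpV] with n h2
      obtain ⟨q, hq1, hq2⟩ := hsP n h2
      exact (congrArg (ν b) hq1.symm).trans ((h.mem_iff _).1 q.2 b)
    obtain ⟨w, hw⟩ := hvert (momentForm H ν (p : M) (ds A)).1
    refine ⟨ds A - w, ?_⟩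
    rw [map_sub, hw]
    have h3 : θ (ds A) = (a, ((momentForm H ν (p : M) (ds A)).1, 0)) :=
      Prod.ext d1 (Prod.ext rfl d2)
    rw [h3]
    simp
  refine isInvertible_of_surjective θ ?_ ?_
  · rintro ⟨a, w⟩
    obtain ⟨v, hv⟩ : ∃ v : E, (θ v).2 = w := momentForm_surjective h.moment (h.orbit p) w
    obtain ⟨u, hu⟩ := hsurj (a - (θ v).1)
    refine ⟨u + v, ?_⟩
    rw [map_add, hu, ← hv]
    ext <;> simp
  · rw [Module.finrank_prod, finrank_momentForm_target, h.finrank_reduced p]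

end Lift

section Lift

variable {E : Type*} [NormedAddCommGroup E] [NormedSpace ℝ E] [FiniteDimensional ℝ E]
  {M : Type*} [TopologicalSpace M] [ChartedSpace E M] [IsManifold 𝓘(ℝ, E) ∞ M]
  {EG : Type*} [NormedAddCommGroup EG] [NormedSpace ℝ EG] [FiniteDimensional ℝ EG]
  {G : Type*} [TopologicalSpace G] [ChartedSpace EG G] [Group G]
  [LieGroup 𝓘(ℝ, EG) ∞ G]
  [MulAction G M] [ContMDiffSMul 𝓘(ℝ, EG) 𝓘(ℝ, E) ∞ G M]
  {H : HypercomplexStructure E M} {ν : Fin 3 → M → (EG →L[ℝ] ℝ)} {ζ : Fin 3 → (EG →L[ℝ] ℝ)}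
  {P : SubMulAction G M}
  {EP : Type} [NormedAddCommGroup EP] [NormedSpace ℝ EP] [FiniteDimensional ℝ EP]
  {EN : Type*} [NormedAddCommGroup EN] [NormedSpace ℝ EN] [FiniteDimensional ℝ EN]
  [ChartedSpace EP P] [IsManifold 𝓘(ℝ, EP) ∞ P]
  [ChartedSpace EN (ReducedSpace P)] [IsManifold 𝓘(ℝ, EN) ∞ (ReducedSpace P)]

variable (H ν EP) in
/-- `v` is the horizontal lift at `p` of the tangent vector `A` of the quotient. -/
def IsLift (p : P) (A : TangentSpace 𝓘(ℝ, EN) (quotientMap P p))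
    (v : TangentSpace 𝓘(ℝ, E) (p : M)) : Prop :=
  momentForm H ν (p : M) v = 0 ∧
    ∃ u : TangentSpace 𝓘(ℝ, EP) p, dIncl P p u = v ∧ dQuot P p u = A

variable {p : P} {A B : TangentSpace 𝓘(ℝ, EN) (quotientMap P p)}
  {v w : TangentSpace 𝓘(ℝ, E) (p : M)}

theorem IsLift.congr (h₁ : IsLift H ν EP p A v) (hvw : v = w) : IsLift H ν EP p A w :=
  hvw ▸ h₁

theorem IsLift.add (h₁ : IsLift H ν EP p A v) (h₂ : IsLift H ν EP p B w) :
    IsLift H ν EP p (A + B) (v + w) := by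
  obtain ⟨hv, u, rfl, rfl⟩ := h₁
  obtain ⟨hw, u', rfl, rfl⟩ := h₂
  exact ⟨by rw [map_add, hv, hw, add_zero], u + u', map_add _ _ _, map_add _ _ _⟩

theorem IsLift.smul (c : ℝ) (h₁ : IsLift H ν EP p A v) : IsLift H ν EP p (c • A) (c • v) := by
  obtain ⟨hv, u, rfl, rfl⟩ := h₁
  exact ⟨by rw [map_smul, hv, smul_zero], c • u, map_smul _ _ _, map_smul _ _ _⟩

theorem IsLift.neg (h₁ : IsLift H ν EP p A v) : IsLift H ν EP p (-A) (-v) := by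
  obtain ⟨hv, u, rfl, rfl⟩ := h₁
  exact ⟨by rw [map_neg, hv, neg_zero], -u, map_neg _ _, map_neg _ _⟩

/-- Being a lift becomes a linear equation that also makes sense off `P`. Existence and uniqueness
of lifts, and their smooth extension to `M`, then follow from invertibility of `liftForm`. -/
theorem IsMomentReduction.eventually_isLift_iff (h : IsMomentReduction H ν ζ P EP EN)
    {ρ : M → ReducedSpace P} (hρ : IsExtensionAt E P EN p ρ) :
    ∀ᶠ x in 𝓝 (p : M), ∀ (hx : x ∈ P) (A : EN) (v : E), IsLift H ν EP ⟨x, hx⟩ A v ↔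
      liftForm H ν P EN (quotientMap P p) ρ x v =
        ((mfderiv 𝓘(ℝ, EN) 𝓘(ℝ, EN) (extChartAt 𝓘(ℝ, EN) (quotientMap P p))
          (quotientMap P ⟨x, hx⟩) : EN →L[ℝ] EN) A, 0) := by
  filter_upwards [h.eventually_mfderiv_dIncl hρ] with x h1 hx A v
  obtain ⟨hs, h2⟩ := h1 hx
  have hinj : Function.Injective (mfderiv 𝓘(ℝ, EN) 𝓘(ℝ, EN)
      (extChartAt 𝓘(ℝ, EN) (quotientMap P p)) (quotientMap P ⟨x, hx⟩) : EN →L[ℝ] EN) := by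
    obtain ⟨e, he⟩ := isInvertible_mfderiv_extChartAt (I := 𝓘(ℝ, EN)) hs
    rw [← he]
    exact e.injective
  constructor
  · rintro ⟨hv, u, rfl, rfl⟩
    exact Prod.ext (h2 u) hv
  · intro hv
    have hv2 : momentForm H ν x v = 0 := congrArg Prod.snd hv
    obtain ⟨u, rfl⟩ := h.exists_dIncl_eq ⟨x, hx⟩ (congrArg Prod.snd hv2)
    exact ⟨hv2, u, rfl, hinj ((h2 u).symm.trans (congrArg Prod.fst hv))⟩

theorem IsMomentReduction.exists_isLift (h : IsMomentReduction H ν ζ P EP EN) (p : P)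
    (A : TangentSpace 𝓘(ℝ, EN) (quotientMap P p)) : ∃ v, IsLift H ν EP p A v := by
  obtain ⟨ρ, hρ⟩ := h.exists_isExtensionAt p
  obtain ⟨e, he⟩ := h.isInvertible_liftForm hρ
  have h1 := (h.eventually_isLift_iff hρ).self_of_nhds p.2 A
  have h2 : Function.Surjective (liftForm H ν P EN (quotientMap P p) ρ (p : M)) := by
    rw [← he]
    exact e.surjective
  obtain ⟨v, hv⟩ := h2 (_, 0)
  exact ⟨v, (h1 v).2 hv⟩

theorem IsMomentReduction.exists_isLift' (h : IsMomentReduction H ν ζ P EP EN)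
    (hv : momentForm H ν (p : M) v = 0) :
    ∃ A : TangentSpace 𝓘(ℝ, EN) (quotientMap P p), IsLift H ν EP p A v := by
  obtain ⟨u, hu⟩ := h.exists_dIncl_eq p (congrArg Prod.snd hv)
  exact ⟨_, hv, u, hu, rfl⟩

theorem IsMomentReduction.lift_unique (h : IsMomentReduction H ν ζ P EP EN)
    (hv : IsLift H ν EP p A v) (hw : IsLift H ν EP p A w) : v = w := by
  obtain ⟨ρ, hρ⟩ := h.exists_isExtensionAt p
  obtain ⟨e, he⟩ := h.isInvertible_liftForm hρ
  have h1 := (h.eventually_isLift_iff hρ).self_of_nhds p.2 A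
  have h2 := ((h1 v).1 hv).trans ((h1 w).1 hw).symm
  rw [← he] at h2
  exact e.injective h2

theorem IsMomentReduction.base_unique (h : IsMomentReduction H ν ζ P EP EN)
    (hA : IsLift H ν EP p A v) (hB : IsLift H ν EP p B v) : A = B := by
  obtain ⟨-, u, hu, rfl⟩ := hA
  obtain ⟨-, u', hu', rfl⟩ := hB
  rw [h.dIncl_injective p (hu.trans hu'.symm)]

theorem IsMomentReduction.exists_lift (h : IsMomentReduction H ν ζ P EP EN) (p : P) :
    ∃ L : TangentSpace 𝓘(ℝ, EN) (quotientMap P p) →L[ℝ] TangentSpace 𝓘(ℝ, E) (p : M),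
      ∀ A, IsLift H ν EP p A (L A) := by
  choose L hL using h.exists_isLift p
  let L' : EN →ₗ[ℝ] E :=
    { toFun := L
      map_add' := fun A B => h.lift_unique (hL (A + B)) ((hL A).add (hL B))
      map_smul' := fun c A => h.lift_unique (hL (c • A)) ((hL A).smul c) }
  let L'' : EN →L[ℝ] E := LinearMap.toContinuousLinearMap L'
  exact ⟨L'', hL⟩

theorem IsMomentReduction.exists_complex (h : IsMomentReduction H ν ζ P EP EN) (a : Fin 3)
    (p : P) :
    ∃ J : TangentSpace 𝓘(ℝ, EN) (quotientMap P p) →L[ℝ] TangentSpace 𝓘(ℝ, EN) (quotientMap P p),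
      ∀ A v, IsLift H ν EP p A v → IsLift H ν EP p (J A) (H.J a p v) := by
  obtain ⟨L, hL⟩ := h.exists_lift p
  choose J hJ using fun A => h.exists_isLift' (momentForm_J_eq_zero h.moment a (hL A).1)
  have e₁ : ∀ A B, H.J a p (L A) + H.J a p (L B) = H.J a p (L (A + B)) := fun A B => by
    rw [map_add, map_add]
  have e₂ : ∀ (c : ℝ) A, c • H.J a p (L A) = H.J a p (L (c • A)) := fun c A => by
    rw [map_smul, map_smul]
  let J' : EN →ₗ[ℝ] EN :=
    { toFun := J
      map_add' := fun A B => h.base_unique (hJ (A + B)) (((hJ A).add (hJ B)).congr (e₁ A B))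
      map_smul' := fun c A => h.base_unique (hJ (c • A)) (((hJ A).smul c).congr (e₂ c A)) }
  let J'' : EN →L[ℝ] EN := LinearMap.toContinuousLinearMap J'
  refine ⟨J'', fun A v hv => ?_⟩
  rw [h.lift_unique hv (hL A)]
  exact hJ A

theorem mfderiv_smul_moment (hν : IsGMomentMap G H ν) (γ : G) (x : M) (a : Fin 3) (w : E) :
    mfderiv 𝓘(ℝ, E) 𝓘(ℝ, EG →L[ℝ] ℝ) (ν a) (γ • x) (dAction (E := E) γ x w) =
      coadjoint γ (mfderiv 𝓘(ℝ, E) 𝓘(ℝ, EG →L[ℝ] ℝ) (ν a) x w) := by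
  let C : (EG →L[ℝ] ℝ) →L[ℝ] (EG →L[ℝ] ℝ) :=
    (ContinuousLinearMap.compL ℝ EG EG ℝ).flip (adjoint γ⁻¹)
  have hγ : ContMDiff 𝓘(ℝ, E) 𝓘(ℝ, E) ∞ fun y : M => γ • y :=
    ContMDiff.smul (I := 𝓘(ℝ, EG)) (n := ∞) contMDiff_const contMDiff_id
  have h1 := HasMFDerivAt.comp x
    ((hν.smooth a).mdifferentiableAt (by simp) (x := γ • x)).hasMFDerivAt
    (hγ.mdifferentiableAt (by simp) (x := x)).hasMFDerivAt
  have h2 := HasMFDerivAt.comp x (C.hasMFDerivAt (x := ν a x))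
    ((hν.smooth a).mdifferentiableAt (by simp) (x := x)).hasMFDerivAt
  have h3 : (ν a ∘ fun y : M => γ • y) = C ∘ ν a := funext fun y => hν.equivariant γ a y
  rw [h3] at h1
  exact DFunLike.congr_fun (hasMFDerivAt_unique h1 h2) w

theorem coadjoint_zero (γ : G) : coadjoint γ (0 : EG →L[ℝ] ℝ) = 0 :=
  ContinuousLinearMap.zero_comp _

/-- Equivariance handles the dν_a; for α it is applied to I₁v, since `γ` commutes with I₁ and α =
−dν₁ ∘ I₁. -/
theorem momentForm_dAction (hν : IsGMomentMap G H ν) (hGH : PreservesHypercomplex G H) (γ : G)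
    {x : M} {v : TangentSpace 𝓘(ℝ, E) x} (hv : momentForm H ν x v = 0) :
    momentForm H ν (γ • x) (dAction γ x v) = 0 := by
  have h1 : ∀ a, ∀ w : TangentSpace 𝓘(ℝ, E) x, momentForm H ν x w = 0 →
      (momentForm H ν (γ • x) (dAction γ x w)).2 a = 0 := by
    intro a w hw
    refine (mfderiv_smul_moment hν γ x a w).trans ?_
    have : mfderiv 𝓘(ℝ, E) 𝓘(ℝ, EG →L[ℝ] ℝ) (ν a) x w = (0 : EG →L[ℝ] ℝ) :=
      congrFun (congrArg Prod.snd hw) a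
    exact (congrArg (coadjoint γ) this).trans (coadjoint_zero γ)
  refine Prod.ext ?_ (funext fun a => h1 a v hv)
  have h2 := momentForm_J_snd_self hν 0 (γ • x) (dAction γ x v)
  rw [← hGH γ 0 x v, h1 0 _ (momentForm_J_eq_zero hν 0 hv)] at h2
  exact neg_eq_zero.1 h2.symm

theorem quotientMap_smul (γ : G) (p : P) : quotientMap P (γ • p) = quotientMap P p :=
  (quotientMap_eq_iff).2 ⟨γ⁻¹, inv_smul_smul _ _⟩

/-- The quotient map is constant on orbits, so a translated lift projects to the same vector. This
makes structures defined by lifts independent of the point in the fibre. -/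
theorem IsMomentReduction.isLift_smul (h : IsMomentReduction H ν ζ P EP EN)
    (hGH : PreservesHypercomplex G H) (γ : G) (hA : IsLift H ν EP p A v) :
    IsLift (EN := EN) H ν EP (γ • p) A (dAction γ (p : M) v) := by
  obtain ⟨hv, u, rfl, rfl⟩ := hA
  have h1 := momentForm_dAction h.moment hGH γ hv
  obtain ⟨u', hu'⟩ := h.exists_dIncl_eq (γ • p) (congrArg Prod.snd h1)
  refine ⟨h1, u', hu', ?_⟩
  obtain ⟨ρ, hρ⟩ := h.exists_isExtensionAt (γ • p)
  have d1 : HasMFDerivAt 𝓘(ℝ, E) 𝓘(ℝ, EN) ρ (γ • (p : M))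
      (mfderiv 𝓘(ℝ, E) 𝓘(ℝ, EN) ρ (γ • (p : M))) :=
    (hρ.smooth.mdifferentiableAt (by simp)).hasMFDerivAt
  have hγ : ContMDiff 𝓘(ℝ, E) 𝓘(ℝ, E) ∞ fun y : M => γ • y :=
    ContMDiff.smul (I := 𝓘(ℝ, EG)) (n := ∞) contMDiff_const contMDiff_id
  have d2 : HasMFDerivAt 𝓘(ℝ, EP) 𝓘(ℝ, E) (fun q : P => γ • (q : M)) p
      ((dAction (E := E) γ (p : M)).comp (dIncl P p)) :=
    HasMFDerivAt.comp p (hγ.mdifferentiableAt (by simp)).hasMFDerivAt (h.hasMFDerivAt_incl p)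
  have d3 := HasMFDerivAt.comp p d1 d2
  have d4 := HasMFDerivAt.comp (γ • p) d1 (h.hasMFDerivAt_incl (γ • p))
  have e4 : (ρ ∘ fun q : P => (q : M)) =ᶠ[𝓝 (γ • p)] quotientMap P := by
    filter_upwards [continuous_subtype_val.continuousAt.eventually hρ.eq] with q hq
    exact hq q.2
  have e3 : (ρ ∘ fun q : P => γ • (q : M)) =ᶠ[𝓝 p] quotientMap P := by
    have hc : ContinuousAt (fun q : P => γ • (q : M)) p :=
      (hγ.continuous.comp continuous_subtype_val).continuousAt
    filter_upwards [hc.eventually hρ.eq] with q hq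
    exact (hq (P.smul_mem γ q.2)).trans (quotientMap_smul γ q)
  have f4 := (h.hasMFDerivAt_quotientMap (γ • p)).mfderiv.symm.trans
    (d4.congr_of_eventuallyEq e4.symm).mfderiv
  have f3 := (h.hasMFDerivAt_quotientMap p).mfderiv.symm.trans
    (d3.congr_of_eventuallyEq e3.symm).mfderiv
  refine (DFunLike.congr_fun f4 u').trans (Eq.trans ?_ (DFunLike.congr_fun f3 u).symm)
  exact congrArg (mfderiv 𝓘(ℝ, E) 𝓘(ℝ, EN) ρ (γ • (p : M)) : E →L[ℝ] EN) hu'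

/-- Complex structures on the quotient, given by those of `M` on horizontal lifts. -/
theorem IsMomentReduction.exists_reducedComplex (h : IsMomentReduction H ν ζ P EP EN)
    (hGH : PreservesHypercomplex G H) :
    ∃ J : Fin 3 → (n : ReducedSpace P) → TangentSpace 𝓘(ℝ, EN) n →L[ℝ] TangentSpace 𝓘(ℝ, EN) n,
      ∀ a p A v, IsLift H ν EP p A v → IsLift H ν EP p (J a (quotientMap P p) A) (H.J a p v) := by
  have key : ∀ a (n : ReducedSpace P), ∃ J : EN →L[ℝ] EN, ∀ p : P, quotientMap P p = n →
      ∀ (A : EN) (v : E), IsLift H ν EP p A v → IsLift H ν EP p (J A) (H.J a p v) := by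
    intro a n
    obtain ⟨p, rfl⟩ : ∃ p, quotientMap P p = n := Quotient.exists_rep n
    obtain ⟨J, hJ⟩ := h.exists_complex a p
    refine ⟨J, fun q hq A v hv => ?_⟩
    obtain ⟨γ, hγ⟩ := quotientMap_eq_iff.1 hq.symm
    obtain rfl : γ • p = q := Subtype.ext hγ
    obtain ⟨w, hw⟩ := h.exists_isLift p A
    obtain rfl := h.lift_unique (EN := EN) (A := A) hv (h.isLift_smul hGH γ hw)
    exact (h.isLift_smul hGH γ (hJ A w hw)).congr (hGH γ a p w)
  choose J hJ using key
  exact ⟨J, fun a p A v hv => hJ a _ p rfl A v hv⟩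

/-- A metric on the quotient, given by that of `M` on horizontal lifts. -/
theorem IsMomentReduction.exists_reducedInner (h : IsMomentReduction H ν ζ P EP EN)
    {g : Metric E M} (hGH : PreservesHypercomplex G H) (hGg : PreservesMetric G g) :
    ∃ B : (n : ReducedSpace P) → TangentSpace 𝓘(ℝ, EN) n →L[ℝ] TangentSpace 𝓘(ℝ, EN) n →L[ℝ] ℝ,
      ∀ p A A' v v', IsLift H ν EP p A v → IsLift H ν EP p A' v' →
        B (quotientMap P p) A A' = g.inner p v v' := by
  have key : ∀ (n : ReducedSpace P), ∃ B : EN →L[ℝ] EN →L[ℝ] ℝ, ∀ p : P, quotientMap P p = n →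
      ∀ (A A' : EN) (v v' : E), IsLift H ν EP p A v → IsLift H ν EP p A' v' →
        B A A' = g.inner p v v' := by
    intro n
    obtain ⟨p, rfl⟩ : ∃ p, quotientMap P p = n := Quotient.exists_rep n
    obtain ⟨L, hL⟩ := h.exists_lift p
    let L' : EN →L[ℝ] E := L
    let gp : E →L[ℝ] E →L[ℝ] ℝ := g.inner (p : M)
    let B : EN →L[ℝ] EN →L[ℝ] ℝ := ContinuousLinearMap.bilinearComp gp L' L'
    refine ⟨B, fun q hq A A' v v' hv hv' => ?_⟩
    obtain ⟨γ, hγ⟩ := quotientMap_eq_iff.1 hq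
    obtain rfl : γ • q = p := Subtype.ext hγ
    have h1 := h.lift_unique (hL A) (h.isLift_smul hGH γ hv)
    have h2 := h.lift_unique (hL A') (h.isLift_smul hGH γ hv')
    refine Eq.trans ?_ (hGg γ q v v')
    rw [← h1, ← h2]
    rfl
  choose B hB using key
  exact ⟨B, fun p A A' v v' => hB _ p rfl A A' v v'⟩

end Lift

/-! ### Horizontal lifts of vector fields and their brackets -/

section LiftField

variable {E : Type*} [NormedAddCommGroup E] [NormedSpace ℝ E] [FiniteDimensional ℝ E]
  {M : Type*} [TopologicalSpace M] [ChartedSpace E M] [IsManifold 𝓘(ℝ, E) ∞ M]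
  {EG : Type*} [NormedAddCommGroup EG] [NormedSpace ℝ EG] [FiniteDimensional ℝ EG]
  {G : Type*} [TopologicalSpace G] [ChartedSpace EG G] [Group G]
  [LieGroup 𝓘(ℝ, EG) ∞ G]
  [MulAction G M] [ContMDiffSMul 𝓘(ℝ, EG) 𝓘(ℝ, E) ∞ G M]
  {H : HypercomplexStructure E M} {ν : Fin 3 → M → (EG →L[ℝ] ℝ)} {ζ : Fin 3 → (EG →L[ℝ] ℝ)}
  {P : SubMulAction G M}
  {EP : Type} [NormedAddCommGroup EP] [NormedSpace ℝ EP] [FiniteDimensional ℝ EP]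
  {EN : Type*} [NormedAddCommGroup EN] [NormedSpace ℝ EN] [FiniteDimensional ℝ EN]
  [ChartedSpace EP P] [IsManifold 𝓘(ℝ, EP) ∞ P]
  [ChartedSpace EN (ReducedSpace P)] [IsManifold 𝓘(ℝ, EN) ∞ (ReducedSpace P)]

variable (H ν EP) in
/-- On the level set near `p`, the vector field `W` is the horizontal lift of the vector field `Y`
on the quotient. -/
def IsLiftField (p : P) (Y : (n : ReducedSpace P) → TangentSpace 𝓘(ℝ, EN) n)
    (W : (x : M) → TangentSpace 𝓘(ℝ, E) x) : Prop :=
  ∀ᶠ x in 𝓝 (p : M), ∀ hx : x ∈ P, IsLift H ν EP ⟨x, hx⟩ (Y (quotientMap P ⟨x, hx⟩)) (W x)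

variable {p : P} {Y Z : (n : ReducedSpace P) → TangentSpace 𝓘(ℝ, EN) n}
  {W W' : (x : M) → TangentSpace 𝓘(ℝ, E) x} {ρ : M → ReducedSpace P}

theorem IsLiftField.self (hW : IsLiftField H ν EP p Y W) :
    IsLift H ν EP p (Y (quotientMap P p)) (W p) :=
  hW.self_of_nhds p.2

/-- The horizontal lift to a neighbourhood of `p` in `M`. -/
def liftField (H : HypercomplexStructure E M) (ν : Fin 3 → M → (EG →L[ℝ] ℝ))
    (n : ReducedSpace P) (ρ : M → ReducedSpace P)
    (w : M → EN) (x : M) : TangentSpace 𝓘(ℝ, E) x :=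
  (liftForm H ν P EN n ρ x).inverse (w x, 0)

theorem IsMomentReduction.eventually_liftForm_liftField (h : IsMomentReduction H ν ζ P EP EN)
    (hρ : IsExtensionAt E P EN p ρ) (w : M → EN) :
    ∀ᶠ x in 𝓝 (p : M), liftForm H ν P EN (quotientMap P p) ρ x
      (liftField H ν (quotientMap P p) ρ w x) = (w x, 0) := by
  filter_upwards [(h.smoothFormAt_liftForm hρ).eventually_isInvertible
    (h.isInvertible_liftForm hρ)] with x hx
  exact hx.self_apply_inverse _

theorem IsMomentReduction.smoothAt_liftField (h : IsMomentReduction H ν ζ P EP EN)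
    (hρ : IsExtensionAt E P EN p ρ) {w : M → EN}
    (hw : ContMDiffAt 𝓘(ℝ, E) 𝓘(ℝ, EN) ∞ w (p : M)) :
    SmoothAt (liftField H ν (quotientMap P p) ρ w) (p : M) :=
  (h.smoothFormAt_liftForm hρ).smoothAt_inverse (h.isInvertible_liftForm hρ)
    (hw.prodMk_space contMDiffAt_const)

theorem IsMomentReduction.diffAt_liftField (h : IsMomentReduction H ν ζ P EP EN)
    (hρ : IsExtensionAt E P EN p ρ) {w : M → EN}
    (hw : MDifferentiableAt 𝓘(ℝ, E) 𝓘(ℝ, EN) w (p : M)) :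
    DiffAt (liftField H ν (quotientMap P p) ρ w) (p : M) :=
  (h.smoothFormAt_liftForm hρ).diffAt_inverse (h.isInvertible_liftForm hρ)
    (hw.prodMk_space mdifferentiableAt_const)

theorem IsMomentReduction.isLiftField_liftField (h : IsMomentReduction H ν ζ P EP EN)
    (hρ : IsExtensionAt E P EN p ρ) (Y : (n : ReducedSpace P) → TangentSpace 𝓘(ℝ, EN) n) :
    IsLiftField H ν EP p Y (liftField H ν (quotientMap P p) ρ
      (der (extChartAt 𝓘(ℝ, EN) (quotientMap P p)) Y ∘ ρ)) := by
  filter_upwards [h.eventually_isLift_iff hρ, h.eventually_liftForm_liftField hρ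
    (der (extChartAt 𝓘(ℝ, EN) (quotientMap P p)) Y ∘ ρ), hρ.eq] with x h1 h2 h3 hx
  refine (h1 hx _ _).2 (h2.trans (Prod.ext ?_ rfl))
  exact congrArg (der (extChartAt 𝓘(ℝ, EN) (quotientMap P p)) Y) (h3 hx)

theorem IsMomentReduction.exists_smooth_isLiftField (h : IsMomentReduction H ν ζ P EP EN)
    (hY : SmoothAt Y (quotientMap P p)) :
    ∃ W : (x : M) → TangentSpace 𝓘(ℝ, E) x, SmoothAt W (p : M) ∧ IsLiftField H ν EP p Y W := by
  obtain ⟨ρ, hρ⟩ := h.exists_isExtensionAt p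
  refine ⟨_, h.smoothAt_liftField hρ (ContMDiffAt.comp_of_eq ?_ hρ.smooth hρ.apply_self),
    h.isLiftField_liftField hρ Y⟩
  exact hY.contMDiffAt_der contMDiffAt_extChartAt

/-- The derivative along a horizontal lift of a function that descends to the quotient. -/
theorem IsMomentReduction.mfderiv_eq_of_descends (h : IsMomentReduction H ν ζ P EP EN)
    {F : Type*} [NormedAddCommGroup F] [NormedSpace ℝ F] {f : ReducedSpace P → F} {φ : M → F}
    (hf : MDifferentiableAt 𝓘(ℝ, EN) 𝓘(ℝ, F) f (quotientMap P p))
    (hφ : MDifferentiableAt 𝓘(ℝ, E) 𝓘(ℝ, F) φ (p : M))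
    (hfφ : ∀ᶠ x in 𝓝 (p : M), ∀ hx : x ∈ P, φ x = f (quotientMap P ⟨x, hx⟩)) {A : EN} {v : E}
    (hA : IsLift H ν EP p A v) :
    (mfderiv 𝓘(ℝ, E) 𝓘(ℝ, F) φ (p : M) : E →L[ℝ] F) v =
      (mfderiv 𝓘(ℝ, EN) 𝓘(ℝ, F) f (quotientMap P p) : EN →L[ℝ] F) A := by
  obtain ⟨-, u, rfl, rfl⟩ := hA
  have k1 := HasMFDerivAt.comp p hφ.hasMFDerivAt (h.hasMFDerivAt_incl p)
  have k2 := HasMFDerivAt.comp p hf.hasMFDerivAt (h.hasMFDerivAt_quotientMap p)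
  have k3 : (φ ∘ fun q : P => (q : M)) =ᶠ[𝓝 p] f ∘ quotientMap P := by
    filter_upwards [continuous_subtype_val.continuousAt.eventually hfφ] with q hq
    exact hq q.2
  exact DFunLike.congr_fun (k1.mfderiv.symm.trans (k2.congr_of_eventuallyEq k3).mfderiv) u

/-- Near the point, `f` is `φ` composed with a local section of the quotient map with values in `P`.
-/
theorem IsMomentReduction.contMDiffAt_of_descends (h : IsMomentReduction H ν ζ P EP EN)
    {F : Type*} [NormedAddCommGroup F] [NormedSpace ℝ F] {f : ReducedSpace P → F} {φ : M → F}
    (hφ : ContMDiffAt 𝓘(ℝ, E) 𝓘(ℝ, F) ∞ φ (p : M))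
    (hfφ : ∀ᶠ x in 𝓝 (p : M), ∀ hx : x ∈ P, φ x = f (quotientMap P ⟨x, hx⟩)) :
    ContMDiffAt 𝓘(ℝ, EN) 𝓘(ℝ, F) ∞ f (quotientMap P p) := by
  obtain ⟨s, V, hV, hpV, hs, hsp, hsP⟩ := h.sect p
  have hs0 := hs.contMDiffAt (hV.mem_nhds hpV)
  refine (ContMDiffAt.comp_of_eq hφ hs0 hsp).congr_of_eventuallyEq ?_
  have hs1 : Filter.Tendsto s (𝓝 (quotientMap P p)) (𝓝 (p : M)) := by
    have := hs0.continuousAt.tendsto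
    rwa [hsp] at this
  filter_upwards [hs1.eventually hfφ, hV.mem_nhds hpV] with n h1 h2
  obtain ⟨q, hq1, hq2⟩ := hsP n h2
  have hmem : s n ∈ P := hq1 ▸ q.2
  refine Eq.trans ?_ (h1 hmem).symm
  exact congrArg f (hq2.symm.trans (congrArg (quotientMap P) (Subtype.ext hq1)))

theorem IsMomentReduction.eventually_der_chart (h : IsMomentReduction H ν ζ P EP EN)
    (hρ : IsExtensionAt E P EN p ρ) (hW : IsLiftField H ν EP p Y W) :
    ∀ᶠ x in 𝓝 (p : M), ∀ hx : x ∈ P,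
      der (extChartAt 𝓘(ℝ, EN) (quotientMap P p) ∘ ρ) W x =
        der (extChartAt 𝓘(ℝ, EN) (quotientMap P p)) Y (quotientMap P ⟨x, hx⟩) := by
  filter_upwards [h.eventually_isLift_iff hρ, hW] with x h1 h2 hx
  exact congrArg Prod.fst ((h1 hx _ _).1 (h2 hx))

/-- The chart components of `Y` descend from smooth functions on `M`. The smoothness of the reduced
complex structures is read off in this way. -/
theorem IsMomentReduction.smoothAt_of_isLiftField (h : IsMomentReduction H ν ζ P EP EN)
    (hW : SmoothAt W (p : M)) (hYW : IsLiftField H ν EP p Y W) :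
    SmoothAt Y (quotientMap P p) := by
  obtain ⟨ρ, hρ⟩ := h.exists_isExtensionAt p
  let ψ := extChartAt 𝓘(ℝ, EN) (quotientMap P p)
  let θ : (n : ReducedSpace P) → TangentSpace 𝓘(ℝ, EN) n →L[ℝ] EN := fun n =>
    mfderiv 𝓘(ℝ, EN) 𝓘(ℝ, EN) ψ n
  have hθ : SmoothFormAt θ (quotientMap P p) := fun X hX =>
    hX.contMDiffAt_der contMDiffAt_extChartAt
  have hθi : (θ (quotientMap P p)).IsInvertible :=
    isInvertible_mfderiv_extChartAt (mem_extChartAt_source _)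
  have h1 : ContMDiffAt 𝓘(ℝ, EN) 𝓘(ℝ, EN) ∞ (der ψ Y) (quotientMap P p) :=
    h.contMDiffAt_of_descends (hW.contMDiffAt_der hρ.contMDiffAt_chart)
      (h.eventually_der_chart hρ hYW)
  refine (hθ.smoothAt_inverse hθi h1).congr ?_
  filter_upwards [hθ.eventually_isInvertible hθi] with n hn
  exact (hn.inverse_apply_self _).symm

/-- By the commutator formula, dν_a of the bracket is a difference of derivatives, along vectors
tangent to `P`, of functions that vanish on `P`. -/
theorem IsMomentReduction.momentForm_mlieBracket_snd (h : IsMomentReduction H ν ζ P EP EN)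
    (hW : DiffAt W (p : M)) (hW' : DiffAt W' (p : M))
    (hYW : IsLiftField H ν EP p Y W) (hZW : IsLiftField H ν EP p Z W') :
    (momentForm H ν (p : M) (mlieBracket 𝓘(ℝ, E) W W' p)).2 = 0 := by
  funext a
  have hν : ContMDiffAt 𝓘(ℝ, E) 𝓘(ℝ, EG →L[ℝ] ℝ) 2 (ν a) (p : M) :=
    (h.moment.smooth a p).of_le (by norm_cast)
  have hz : ∀ {Y W}, IsLiftField (EN := EN) H ν EP p Y W →
      ∀ᶠ x in 𝓝 (p : M), x ∈ P → der (ν a) W x = 0 := fun hYW => by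
    filter_upwards [hYW] with x h1 hx
    exact congrFun (congrArg Prod.snd (h1 hx).1) a
  refine (mfderiv_mlieBracket hν hW hW').trans ?_
  have e1 : der (der (ν a) W') W (p : M) = 0 := h.mfderiv_eq_zero p (DiffAt.der hν hW') (hz hZW) (congrArg Prod.snd hYW.self.1)
  have e2 : der (der (ν a) W) W' (p : M) = 0 := h.mfderiv_eq_zero p (DiffAt.der hν hW) (hz hYW) (congrArg Prod.snd hZW.self.1)
  rw [e1, e2, sub_zero]
  rfl

/-- Lie brackets of horizontal lifts project to Lie brackets. -/
theorem IsMomentReduction.liftForm_mlieBracket (h : IsMomentReduction H ν ζ P EP EN)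
    (hρ : IsExtensionAt E P EN p ρ) (hY : DiffAt Y (quotientMap P p))
    (hZ : DiffAt Z (quotientMap P p)) (hW : DiffAt W (p : M)) (hW' : DiffAt W' (p : M))
    (hYW : IsLiftField H ν EP p Y W) (hZW : IsLiftField H ν EP p Z W') :
    liftForm H ν P EN (quotientMap P p) ρ (p : M) (mlieBracket 𝓘(ℝ, E) W W' p) =
      ((mfderiv 𝓘(ℝ, EN) 𝓘(ℝ, EN) (extChartAt 𝓘(ℝ, EN) (quotientMap P p)) (quotientMap P p) :
        EN →L[ℝ] EN) (mlieBracket 𝓘(ℝ, EN) Y Z (quotientMap P p)),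
        ((momentForm H ν (p : M) (mlieBracket 𝓘(ℝ, E) W W' p)).1, 0)) := by
  have hψ : ContMDiffAt 𝓘(ℝ, EN) 𝓘(ℝ, EN) 2 (extChartAt 𝓘(ℝ, EN) (quotientMap P p))
      (quotientMap P p) := contMDiffAt_extChartAt.of_le (by norm_cast)
  have hr : ContMDiffAt 𝓘(ℝ, E) 𝓘(ℝ, EN) 2 (extChartAt 𝓘(ℝ, EN) (quotientMap P p) ∘ ρ) (p : M) :=
    hρ.contMDiffAt_chart.of_le (by norm_cast)
  refine Prod.ext ?_ (Prod.ext rfl (h.momentForm_mlieBracket_snd hW hW' hYW hZW))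
  refine (mfderiv_mlieBracket hr hW hW').trans (Eq.trans ?_ (mfderiv_mlieBracket hψ hY hZ).symm)
  exact congrArg₂ (· - ·)
    (h.mfderiv_eq_of_descends (DiffAt.der hψ hZ) (DiffAt.der hr hW')
      (h.eventually_der_chart hρ hZW) hYW.self)
    (h.mfderiv_eq_of_descends (DiffAt.der hψ hY) (DiffAt.der hr hW)
      (h.eventually_der_chart hρ hYW) hZW.self)

/-- Vertical vectors with prescribed moment form; the horizontal part of a Lie bracket of
horizontal lifts is the horizontal lift of the Lie bracket. -/
theorem IsMomentReduction.exists_vertical (h : IsMomentReduction H ν ζ P EP EN) (p : P) :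
    ∃ Ξ : (EG →L[ℝ] ℝ) →L[ℝ] TangentSpace 𝓘(ℝ, E) (p : M),
      ∀ Y Z : (n : ReducedSpace P) → TangentSpace 𝓘(ℝ, EN) n,
      ∀ W W' : (x : M) → TangentSpace 𝓘(ℝ, E) x, DiffAt Y (quotientMap P p) →
        DiffAt Z (quotientMap P p) → DiffAt W (p : M) → DiffAt W' (p : M) →
        IsLiftField H ν EP p Y W → IsLiftField H ν EP p Z W' →
        IsLift H ν EP p (mlieBracket 𝓘(ℝ, EN) Y Z (quotientMap P p))
          (mlieBracket 𝓘(ℝ, E) W W' p - Ξ (momentForm H ν (p : M) (mlieBracket 𝓘(ℝ, E) W W' p)).1) := by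
  obtain ⟨ρ, hρ⟩ := h.exists_isExtensionAt p
  have hinv := h.isInvertible_liftForm hρ
  -- The vertical vector of α-value μ solves `liftForm` = (0, (μ, 0)); subtracting it changes
  -- neither the projection nor dν.
  refine ⟨(liftForm H ν P EN (quotientMap P p) ρ (p : M)).inverse.comp
    ((ContinuousLinearMap.inr ℝ EN _).comp (ContinuousLinearMap.inl ℝ _ _)), ?_⟩
  intro Y Z W W' hY hZ hW hW' hYW hZW
  refine ((h.eventually_isLift_iff hρ).self_of_nhds p.2 _ _).2 ?_
  refine (map_sub (liftForm H ν P EN (quotientMap P p) ρ (p : M)) _ _).trans ?_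
  refine (congrArg₂ (· - ·) (h.liftForm_mlieBracket hρ hY hZ hW hW' hYW hZW)
    (hinv.self_apply_inverse _)).trans ?_
  refine Prod.ext (sub_zero _) (Prod.ext (sub_self _) (sub_self _))

end LiftField

/-- Compactness of the unit sphere bounds a positive form below by a multiple of the squared norm; a
bundle metric has to supply this boundedness. -/
theorem isVonNBounded_of_pos {F : Type*} [NormedAddCommGroup F] [NormedSpace ℝ F]
    [FiniteDimensional ℝ F] (B : F →L[ℝ] F →L[ℝ] ℝ) (hB : ∀ v, v ≠ 0 → 0 < B v v) :
    Bornology.IsVonNBounded ℝ {v : F | B v v < 1} := by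
  rw [NormedSpace.isVonNBounded_iff]
  have hcont : Continuous fun v => B v v := by fun_prop
  obtain ⟨c, hc, hcB⟩ : ∃ c > 0, ∀ v ∈ Metric.sphere (0 : F) 1, c ≤ B v v := by
    by_cases hne : (Metric.sphere (0 : F) 1).Nonempty
    · obtain ⟨v, hv, hmin⟩ := (isCompact_sphere (0 : F) 1).exists_isMinOn hne hcont.continuousOn
      refine ⟨B v v, hB v ?_, fun w hw => hmin hw⟩
      rintro rfl
      simp at hv
    · exact ⟨1, one_pos, fun v hv => absurd ⟨v, hv⟩ hne⟩
  refine (Metric.isBounded_iff_subset_closedBall 0).2 ⟨√c⁻¹, fun v hv => ?_⟩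
  rw [mem_closedBall_zero_iff]
  by_cases hv0 : v = 0
  · simp [hv0]
  have hn : 0 < ‖v‖ := norm_pos_iff.2 hv0
  have h1 := hcB (‖v‖⁻¹ • v) (by simp [norm_smul, hn.ne'])
  have hv' : B v v < 1 := hv
  refine Real.le_sqrt_of_sq_le ?_
  simp only [map_smul, smul_apply, smul_eq_mul] at h1
  rw [le_inv_comm₀ (by positivity) hc]
  rw [← mul_assoc, ← sq, inv_pow] at h1
  calc c ≤ (‖v‖ ^ 2)⁻¹ * B v v := h1
    _ ≤ (‖v‖ ^ 2)⁻¹ * 1 := by gcongr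
    _ = _ := mul_one _

/-! ### The reduced hypercomplex structure and metric -/

section ReducedStructure

variable {E : Type*} [NormedAddCommGroup E] [NormedSpace ℝ E] [FiniteDimensional ℝ E]
  {M : Type*} [TopologicalSpace M] [ChartedSpace E M] [IsManifold 𝓘(ℝ, E) ∞ M]
  {EG : Type*} [NormedAddCommGroup EG] [NormedSpace ℝ EG] [FiniteDimensional ℝ EG]
  {G : Type*} [TopologicalSpace G] [ChartedSpace EG G] [Group G]
  [LieGroup 𝓘(ℝ, EG) ∞ G]
  [MulAction G M] [ContMDiffSMul 𝓘(ℝ, EG) 𝓘(ℝ, E) ∞ G M]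
  {H : HypercomplexStructure E M} {ν : Fin 3 → M → (EG →L[ℝ] ℝ)} {ζ : Fin 3 → (EG →L[ℝ] ℝ)}
  {P : SubMulAction G M}
  {EP : Type} [NormedAddCommGroup EP] [NormedSpace ℝ EP] [FiniteDimensional ℝ EP]
  {EN : Type*} [NormedAddCommGroup EN] [NormedSpace ℝ EN] [FiniteDimensional ℝ EN]
  [ChartedSpace EP P] [IsManifold 𝓘(ℝ, EP) ∞ P]
  [ChartedSpace EN (ReducedSpace P)] [IsManifold 𝓘(ℝ, EN) ∞ (ReducedSpace P)]
  {p : P} {Y Z : (n : ReducedSpace P) → TangentSpace 𝓘(ℝ, EN) n}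
  {W W' : (x : M) → TangentSpace 𝓘(ℝ, E) x}

/-- Brackets of horizontal fields and complex structures: `[JW, W'] + [W, JW']` is horizontal. -/
theorem IsMomentReduction.momentForm_nijenhuis (h : IsMomentReduction H ν ζ P EP EN) (a : Fin 3)
    (hW : SmoothAt W (p : M)) (hW' : SmoothAt W' (p : M))
    {Y₁ Y₂ Z₁ Z₂ : (n : ReducedSpace P) → TangentSpace 𝓘(ℝ, EN) n}
    (hY₁ : IsLiftField H ν EP p Y₁ W) (hY₂ : IsLiftField H ν EP p Y₂ W')
    (hZ₁ : IsLiftField H ν EP p Z₁ (applyField (H.J a) W))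
    (hZ₂ : IsLiftField H ν EP p Z₂ (applyField (H.J a) W')) :
    (momentForm H ν (p : M) (mlieBracket 𝓘(ℝ, E) (applyField (H.J a) W) W' p)).1 +
        (momentForm H ν (p : M) (mlieBracket 𝓘(ℝ, E) W (applyField (H.J a) W') p)).1 = 0 ∧
      (momentForm H ν (p : M)
        (mlieBracket 𝓘(ℝ, E) (applyField (H.J a) W) (applyField (H.J a) W') p)).1 =
        (momentForm H ν (p : M) (mlieBracket 𝓘(ℝ, E) W W' p)).1 := by
  have hJW := (hW.applyField H a).diffAt
  have hJW' := (hW'.applyField H a).diffAt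
  have e1 := h.momentForm_mlieBracket_snd hJW hJW' hZ₁ hZ₂
  have e2 := h.momentForm_mlieBracket_snd hJW hW'.diffAt hZ₁ hY₂
  have e3 := h.momentForm_mlieBracket_snd hW.diffAt hJW' hY₁ hZ₂
  have e4 := h.momentForm_mlieBracket_snd hW.diffAt hW'.diffAt hY₁ hY₂
  have hN := H.integrable a p W W' hW hW'
  rw [nijenhuis] at hN
  set X₁ := mlieBracket 𝓘(ℝ, E) (applyField (H.J a) W) (applyField (H.J a) W') p
  set X₂ := mlieBracket 𝓘(ℝ, E) (applyField (H.J a) W) W' p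
  set X₃ := mlieBracket 𝓘(ℝ, E) W (applyField (H.J a) W') p
  set X₄ := mlieBracket 𝓘(ℝ, E) W W' p
  -- The integrability identity, all of whose brackets are tangent to `P`. Applying dν_a, which is
  -- −α after I_a, gives the first claim; applying α, which is dν_a after I_a, gives the second.
  have hX : X₁ - X₄ = H.J a p (X₂ + X₃) := by
    rw [map_add, ← sub_eq_zero, ← hN]; abel
  have h1 := momentForm_J_snd_self h.moment a p (X₂ + X₃)
  have h2 := momentForm_J_fst h.moment a p (X₂ + X₃)
  rw [← hX, map_sub, map_add] at h1 h2
  constructor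
  · rw [← neg_eq_zero, neg_add_rev]
    simpa [e1, e4] using h1.symm
  · simpa [e2, e3, sub_eq_zero] using h2

theorem IsLiftField.applyField
    {J : Fin 3 → (n : ReducedSpace P) → TangentSpace 𝓘(ℝ, EN) n →L[ℝ] TangentSpace 𝓘(ℝ, EN) n}
    (hJ : ∀ a p A v, IsLift H ν EP p A v → IsLift H ν EP p (J a (quotientMap P p) A) (H.J a p v))
    (a : Fin 3) (hY : IsLiftField H ν EP p Y W) :
    IsLiftField H ν EP p (applyField (J a) Y) (applyField (H.J a) W) := by
  filter_upwards [hY] with x h1 hx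
  exact hJ a _ _ _ (h1 hx)

/-- The hypercomplex structure of the quotient. -/
theorem IsMomentReduction.exists_hypercomplexStructure (h : IsMomentReduction H ν ζ P EP EN)
    (hGH : PreservesHypercomplex G H) :
    ∃ H' : HypercomplexStructure EN (ReducedSpace P),
      ∀ a p A v, IsLift H ν EP p A v →
        IsLift H ν EP p (H'.J a (quotientMap P p) A) (H.J a p v) := by
  obtain ⟨J, hJ⟩ := h.exists_reducedComplex hGH
  have hrep : ∀ n : ReducedSpace P, ∃ p, quotientMap P p = n := Quotient.exists_rep
  have hsm : ∀ a (p : P) Y, SmoothAt Y (quotientMap P p) →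
      SmoothAt (HKT.applyField (J a) Y) (quotientMap P p) := by
    intro a p Y hY
    obtain ⟨W, hW, hYW⟩ := h.exists_smooth_isLiftField hY
    exact h.smoothAt_of_isLiftField (hW.applyField H a) (hYW.applyField hJ a)
  refine ⟨⟨J, fun a n => ?_, fun a n A => ?_, fun n A => ?_, fun n A => ?_,
    fun a n Y Z hY hZ => ?_⟩, hJ⟩
  · obtain ⟨p, rfl⟩ := hrep n
    refine contMDiffAt_hom_of_apply (n := ⊤) fun Y hY => ?_
    exact hsm a p Y hY.self_of_nhds
  · obtain ⟨p, rfl⟩ := hrep n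
    obtain ⟨v, hv⟩ := h.exists_isLift p A
    exact h.base_unique ((hJ a p _ _ (hJ a p A v hv)).congr (H.sq a p v)) hv.neg
  · obtain ⟨p, rfl⟩ := hrep n
    obtain ⟨v, hv⟩ := h.exists_isLift p A
    exact h.base_unique ((hJ 0 p _ _ (hJ 1 p A v hv)).congr (H.mul p v)) (hJ 2 p A v hv)
  · obtain ⟨p, rfl⟩ := hrep n
    obtain ⟨v, hv⟩ := h.exists_isLift p A
    exact h.base_unique ((hJ 1 p _ _ (hJ 0 p A v hv)).congr (H.mul_rev p v)) (hJ 2 p A v hv).neg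
  · obtain ⟨p, rfl⟩ := hrep n
    obtain ⟨W, hW, hYW⟩ := h.exists_smooth_isLiftField hY
    obtain ⟨W', hW', hZW⟩ := h.exists_smooth_isLiftField hZ
    have hJY := hYW.applyField hJ a
    have hJZ := hZW.applyField hJ a
    obtain ⟨hm1, hm2⟩ := h.momentForm_nijenhuis a hW hW' hYW hZW hJY hJZ
    obtain ⟨Ξ, hΞ⟩ := h.exists_vertical p
    have hJW := (hW.applyField H a).diffAt
    have hJW' := (hW'.applyField H a).diffAt
    have l1 := hΞ _ _ _ _ (hsm a p Y hY).diffAt (hsm a p Z hZ).diffAt hJW hJW' hJY hJZ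
    have l2 := hΞ _ _ _ _ (hsm a p Y hY).diffAt hZ.diffAt hJW hW'.diffAt hJY hZW
    have l3 := hΞ _ _ _ _ hY.diffAt (hsm a p Z hZ).diffAt hW.diffAt hJW' hYW hJZ
    have l4 := hΞ _ _ _ _ hY.diffAt hZ.diffAt hW.diffAt hW'.diffAt hYW hZW
    have hN := H.integrable a p W W' hW hW'
    rw [nijenhuis] at hN ⊢
    -- This is a lift of minus the reduced Nijenhuis tensor. Its vertical corrections cancel by
    -- `hm1` and `hm2`, and what remains vanishes by integrability on `M`.
    have l5 := (hJ a p _ _ (l2.add l3)).add (l4.add l1.neg)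
    have e1 := h.base_unique (B := 0) (l5.congr (w := 0) ?_) ?_
    · rw [map_add] at e1
      rw [← neg_eq_zero, ← e1]
      abel
    · rw [hm2]
      rw [add_eq_zero_iff_eq_neg'] at hm1
      rw [hm1]
      simp only [map_add, map_sub, map_neg, neg_sub]
      rw [← neg_eq_zero, ← hN]
      abel
    · have := l1.add l1.neg
      rwa [add_neg_cancel, add_neg_cancel] at this

theorem IsMomentReduction.eq_zero_of_isLift (h : IsMomentReduction H ν ζ P EP EN)
    {A : TangentSpace 𝓘(ℝ, EN) (quotientMap P p)} (hA : IsLift H ν EP p A 0) : A = 0 := by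
  obtain ⟨v, hv⟩ := h.exists_isLift p A
  have := hv.add hv.neg
  rw [add_neg_cancel, add_neg_cancel] at this
  exact h.base_unique hA this

/-- The metric of the quotient. -/
theorem IsMomentReduction.exists_metric (h : IsMomentReduction H ν ζ P EP EN)
    {g : Metric E M} (hGH : PreservesHypercomplex G H) (hGg : PreservesMetric G g) :
    ∃ g' : Metric EN (ReducedSpace P), ∀ p A A' v v', IsLift H ν EP p A v →
      IsLift H ν EP p A' v' → g'.inner (quotientMap P p) A A' = g.inner p v v' := by
  obtain ⟨B, hB⟩ := h.exists_reducedInner hGH hGg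
  have hrep : ∀ n : ReducedSpace P, ∃ p, quotientMap P p = n := Quotient.exists_rep
  have hpos : ∀ n (A : TangentSpace 𝓘(ℝ, EN) n), A ≠ 0 → 0 < B n A A := by
    intro n A hA
    obtain ⟨p, rfl⟩ := hrep n
    obtain ⟨v, hv⟩ := h.exists_isLift p A
    rw [hB p A A v v hv hv]
    refine g.pos _ _ fun hv0 => hA ?_
    subst hv0
    exact h.eq_zero_of_isLift hv
  refine ⟨⟨B, fun n A A' => ?_, hpos, fun n => isVonNBounded_of_pos (F := EN) (B n) (hpos n), fun n => ?_⟩, hB⟩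
  · obtain ⟨p, rfl⟩ := hrep n
    obtain ⟨v, hv⟩ := h.exists_isLift p A
    obtain ⟨v', hv'⟩ := h.exists_isLift p A'
    rw [hB p A A' v v' hv hv', hB p A' A v' v hv' hv, g.symm]
  · obtain ⟨p, rfl⟩ := hrep n
    refine contMDiffAt_hom_of_apply (n := ⊤) fun Y hY =>
      contMDiffAt_hom_of_apply (n := ⊤) (V₂ := Bundle.Trivial _ ℝ) fun Z hZ => ?_
    refine (Bundle.contMDiffAt_section _).2 ?_
    obtain ⟨W, hW, hYW⟩ := h.exists_smooth_isLiftField (SmoothAt.congr (X := Y) hY.self_of_nhds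
      (Filter.Eventually.of_forall fun _ => rfl))
    obtain ⟨W', hW', hZW⟩ := h.exists_smooth_isLiftField (SmoothAt.congr (X := Z) hZ.self_of_nhds
      (Filter.Eventually.of_forall fun _ => rfl))
    refine h.contMDiffAt_of_descends (contMDiffAt_inner g hW hW') ?_
    filter_upwards [hYW, hZW] with x h1 h2 hx
    exact (hB _ _ _ _ _ (h1 hx) (h2 hx)).symm

end ReducedStructure

/-- Riesz representation: a positive form is injective into the dual, hence an isomorphism by
dimension. -/
theorem exists_representation {F : Type*} [NormedAddCommGroup F] [NormedSpace ℝ F]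
    [FiniteDimensional ℝ F] (q : F →L[ℝ] F →L[ℝ] ℝ) (hq : ∀ v, v ≠ 0 → 0 < q v v)
    (b : F →L[ℝ] F →L[ℝ] ℝ) : ∃ k : F →L[ℝ] F, ∀ v c, q (k v) c = b v c := by
  have hinj : Function.Injective q := by
    refine (injective_iff_map_eq_zero q).2 fun v hv => ?_
    by_contra hv0
    exact (hq v hv0).ne' (by rw [hv]; rfl)
  obtain ⟨e, he⟩ := isInvertible_of_injective q hinj finrank_dual.symm
  refine ⟨(e.symm : (F →L[ℝ] ℝ) →L[ℝ] F).comp b, fun v c => ?_⟩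
  rw [← he]
  exact DFunLike.congr_fun (e.apply_symm_apply (b v)) c

theorem metric_ext {E : Type*} [NormedAddCommGroup E] [NormedSpace ℝ E]
    {M : Type*} [TopologicalSpace M] [ChartedSpace E M] [IsManifold 𝓘(ℝ, E) ∞ M]
    (g : Metric E M) {x : M} {v w : TangentSpace 𝓘(ℝ, E) x}
    (h : ∀ c, g.inner x v c = g.inner x w c) : v = w := by
  by_contra hvw
  have h1 := g.pos x (v - w) (sub_ne_zero.2 hvw)
  have h2 := (DFunLike.congr_fun (map_sub (g.inner x) v w) (v - w)).trans (sub_eq_zero.2 (h _))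
  exact h1.ne' h2

/-! ### The curvature of the horizontal distribution and the reduced connection -/

section ReducedConnection

variable {E : Type*} [NormedAddCommGroup E] [NormedSpace ℝ E] [FiniteDimensional ℝ E]
  {M : Type*} [TopologicalSpace M] [ChartedSpace E M] [IsManifold 𝓘(ℝ, E) ∞ M]
  {EG : Type*} [NormedAddCommGroup EG] [NormedSpace ℝ EG] [FiniteDimensional ℝ EG]
  {G : Type*} [TopologicalSpace G] [ChartedSpace EG G] [Group G]
  [LieGroup 𝓘(ℝ, EG) ∞ G]
  [MulAction G M] [ContMDiffSMul 𝓘(ℝ, EG) 𝓘(ℝ, E) ∞ G M]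
  {H : HypercomplexStructure E M} {ν : Fin 3 → M → (EG →L[ℝ] ℝ)} {ζ : Fin 3 → (EG →L[ℝ] ℝ)}
  {P : SubMulAction G M}
  {EP : Type} [NormedAddCommGroup EP] [NormedSpace ℝ EP] [FiniteDimensional ℝ EP]
  {EN : Type*} [NormedAddCommGroup EN] [NormedSpace ℝ EN] [FiniteDimensional ℝ EN]
  [ChartedSpace EP P] [IsManifold 𝓘(ℝ, EP) ∞ P]
  [ChartedSpace EN (ReducedSpace P)] [IsManifold 𝓘(ℝ, EN) ∞ (ReducedSpace P)]
  {p : P} {Y Z : (n : ReducedSpace P) → TangentSpace 𝓘(ℝ, EN) n}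
  {W W' : (x : M) → TangentSpace 𝓘(ℝ, E) x}
  {g : Metric E M} {K : ((y : M) → TangentSpace 𝓘(ℝ, E) y) →
      (TangentSpace 𝓘(ℝ, E) (p : M) →L[ℝ] TangentSpace 𝓘(ℝ, E) (p : M))}
  {H' : HypercomplexStructure EN (ReducedSpace P)} {g' : Metric EN (ReducedSpace P)}

theorem IsMomentReduction.exists_isLiftField_through (h : IsMomentReduction H ν ζ P EP EN)
    {v : TangentSpace 𝓘(ℝ, E) (p : M)} (hv : momentForm H ν (p : M) v = 0) :
    ∃ (Y : (n : ReducedSpace P) → TangentSpace 𝓘(ℝ, EN) n)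
      (W : (x : M) → TangentSpace 𝓘(ℝ, E) x), SmoothAt Y (quotientMap P p) ∧
      SmoothAt W (p : M) ∧ IsLiftField H ν EP p Y W ∧ W p = v := by
  obtain ⟨A, hA⟩ := h.exists_isLift' hv
  obtain ⟨Y, hY, rfl⟩ := exists_smoothAt_eq A
  obtain ⟨W, hW, hYW⟩ := h.exists_smooth_isLiftField hY
  exact ⟨Y, W, hY, hW, hYW, h.lift_unique hYW.self hA⟩

/-- The connection on tangent directions of the level set depends only on the restriction of a
vector field to the level set. -/
theorem IsMomentReduction.connection_congr (h : IsMomentReduction H ν ζ P EP EN)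
    (hK : HKTConnAt H g (p : M) K) (hW : SmoothAt W (p : M)) (hW' : SmoothAt W' (p : M))
    (hWW' : ∀ᶠ x in 𝓝 (p : M), x ∈ P → W x = W' x) {v : TangentSpace 𝓘(ℝ, E) (p : M)}
    (hv : (momentForm H ν (p : M) v).2 = 0) : K W v = K W' v := by
  have hD : SmoothAt (W + -W') (p : M) := hW.add hW'.neg
  have h1 := hK.add W' (W + -W') hW'.diffAt hD.diffAt
  have h2 : W' + (W + -W') = W := by abel
  rw [h2] at h1
  rw [h1, add_apply]
  refine add_eq_left.2 (metric_ext g fun c => ?_)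
  obtain ⟨X, hX, rfl⟩ := exists_smoothAt_eq c
  -- The difference `W − W'` vanishes on `P`, so metric compatibility turns its covariant
  -- derivative, paired with `X`, into the derivative along `P` of a function that is zero there.
  have h3 := hK.metric _ X hD hX v
  have h4 : (mfderiv 𝓘(ℝ, E) 𝓘(ℝ, ℝ) (fun y => g.inner y ((W + -W') y) (X y)) (p : M) :
      E →L[ℝ] ℝ) v = 0 := by
    refine h.mfderiv_eq_zero p (mdifferentiableAt_inner g hD.diffAt hX.diffAt) ?_ hv
    filter_upwards [hWW'] with x hx hxP
    have : (W + -W') x = 0 := by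
      change W x + -W' x = 0
      rw [hx hxP, add_neg_cancel]
    rw [this, map_zero, zero_apply]
  have h5 : (W + -W') p = 0 := by
    change W p + -W' p = 0
    rw [hWW'.self_of_nhds p.2, add_neg_cancel]
  have h6 := h4.symm.trans h3
  rw [h5, map_zero] at h6
  have h7 : (0 : ℝ) = g.inner (p : M) (K (W + -W') v) (X p) := h6.trans (add_zero (M := ℝ) _)
  rw [map_zero, zero_apply, ← h7]

/-- The vertical part of the Lie bracket of horizontal fields, as a tensor. -/
theorem IsMomentReduction.exists_curvature (h : IsMomentReduction H ν ζ P EP EN)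
    (hJ : ∀ a p A v, IsLift H ν EP p A v →
      IsLift H ν EP p (H'.J a (quotientMap P p) A) (H.J a p v)) (p : P) :
    ∃ Ω : TangentSpace 𝓘(ℝ, E) (p : M) →L[ℝ] TangentSpace 𝓘(ℝ, E) (p : M) →L[ℝ] (EG →L[ℝ] ℝ),
      (∀ (Y Z : (n : ReducedSpace P) → TangentSpace 𝓘(ℝ, EN) n)
        (W W' : (x : M) → TangentSpace 𝓘(ℝ, E) x), DiffAt W (p : M) → DiffAt W' (p : M) →
        IsLiftField H ν EP p Y W → IsLiftField H ν EP p Z W' →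
        Ω (W p) (W' p) = -(momentForm H ν (p : M) (mlieBracket 𝓘(ℝ, E) W W' p)).1) ∧
      (∀ v w, momentForm H ν (p : M) v = 0 → momentForm H ν (p : M) w = 0 →
        Ω v w = -Ω w v) ∧
      ∀ a v w, momentForm H ν (p : M) v = 0 → momentForm H ν (p : M) w = 0 →
        Ω (H.J a p v) w = -Ω v (H.J a p w) := by
  -- Ω is dα. On lifts the two derivative terms drop out, since the moment form of a lift vanishes
  -- along `P`, and minus α of the bracket is left.
  obtain ⟨Ω, hΩ⟩ := exists_extDerivOne_eq (smoothFormAt_momentForm h.moment (p : M))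
  let Ω' : E →L[ℝ] E →L[ℝ] ((EG →L[ℝ] ℝ) × (Fin 3 → (EG →L[ℝ] ℝ))) := Ω
  let Ω₁ : E →L[ℝ] E →L[ℝ] (EG →L[ℝ] ℝ) :=
    (ContinuousLinearMap.compL ℝ E _ _ (ContinuousLinearMap.fst ℝ _ _)).comp Ω'
  have h1 : ∀ (Y Z : (n : ReducedSpace P) → TangentSpace 𝓘(ℝ, EN) n)
      (W W' : (x : M) → TangentSpace 𝓘(ℝ, E) x), DiffAt W (p : M) → DiffAt W' (p : M) →
      IsLiftField H ν EP p Y W → IsLiftField H ν EP p Z W' →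
      Ω₁ (W p) (W' p) = -(momentForm H ν (p : M) (mlieBracket 𝓘(ℝ, E) W W' p)).1 := by
    intro Y Z W W' hW hW' hYW hZW
    have key : ∀ {Y W}, DiffAt W (p : M) → IsLiftField (EN := EN) H ν EP p Y W →
        ∀ {v : E}, momentForm H ν (p : M) v = 0 →
        (mfderiv 𝓘(ℝ, E) 𝓘(ℝ, (EG →L[ℝ] ℝ) × (Fin 3 → (EG →L[ℝ] ℝ)))
          (fun y => momentForm H ν y (W y)) (p : M) :
            E →L[ℝ] (EG →L[ℝ] ℝ) × (Fin 3 → (EG →L[ℝ] ℝ))) v = 0 := by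
      intro Y W hW hYW v hv
      refine h.mfderiv_eq_zero p ((smoothFormAt_momentForm h.moment _).mdifferentiableAt hW) ?_
        (congrArg Prod.snd hv)
      filter_upwards [hYW] with x hx hxP
      exact (hx hxP).1
    have e1 : der (fun y => momentForm H ν y (W' y)) W (p : M) = 0 := key hW' hZW hYW.self.1
    have e2 : der (fun y => momentForm H ν y (W y)) W' (p : M) = 0 := key hW hYW hZW.self.1
    have e3 := hΩ W W' hW hW'
    rw [extDerivOne, e1, e2, sub_zero, zero_sub] at e3
    exact congrArg Prod.fst e3
  have h2 : ∀ v w : E, momentForm H ν (p : M) v = 0 → momentForm H ν (p : M) w = 0 →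
      Ω₁ v w = -Ω₁ w v := by
    intro v w hv hw
    obtain ⟨Y, W, hY, hW, hYW, rfl⟩ := h.exists_isLiftField_through (EN := EN) hv
    obtain ⟨Z, W', hZ, hW', hZW, rfl⟩ := h.exists_isLiftField_through (EN := EN) hw
    rw [h1 Y Z W W' hW.diffAt hW'.diffAt hYW hZW, h1 Z Y W' W hW'.diffAt hW.diffAt hZW hYW,
      mlieBracket_swap_apply, map_neg, Prod.fst_neg]
  -- Type (1,1) for each I_a is the first half of `momentForm_nijenhuis`, evaluated on lifts through
  -- `v` and `w`.
  have h3 : ∀ a, ∀ v w : TangentSpace 𝓘(ℝ, E) (p : M), momentForm H ν (p : M) v = 0 →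
      momentForm H ν (p : M) w = 0 → Ω₁ (H.J a p v) w = -Ω₁ v (H.J a p w) := by
    intro a v w hv hw
    obtain ⟨Y, W, hY, hW, hYW, rfl⟩ := h.exists_isLiftField_through (EN := EN) hv
    obtain ⟨Z, W', hZ, hW', hZW, rfl⟩ := h.exists_isLiftField_through (EN := EN) hw
    have hn := (h.momentForm_nijenhuis a hW hW' hYW hZW (hYW.applyField hJ a)
      (hZW.applyField hJ a)).1
    refine (h1 _ _ _ _ (hW.applyField H a).diffAt hW'.diffAt (hYW.applyField hJ a) hZW).trans ?_
    refine Eq.trans ?_ (congrArg (- ·) (h1 _ _ _ _ hW.diffAt (hW'.applyField H a).diffAt hYW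
      (hZW.applyField hJ a))).symm
    rw [neg_neg]
    exact neg_eq_iff_add_eq_zero.2 hn
  exact ⟨Ω₁, h1, h2, h3⟩

theorem liftField_add (n : ReducedSpace P) (ρ : M → ReducedSpace P) (w w' : M → EN) :
    liftField H ν n ρ (w + w') = liftField H ν n ρ w + liftField H ν n ρ w' := by
  funext x
  refine Eq.trans ?_ (map_add (liftForm H ν P EN n ρ x).inverse _ _)
  have hw : (((w + w') x, 0) : EN × ((EG →L[ℝ] ℝ) × (Fin 3 → (EG →L[ℝ] ℝ)))) =
    (w x, 0) + (w' x, 0) := Prod.ext rfl (add_zero _).symm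
  exact congrArg _ hw

theorem liftField_smul (n : ReducedSpace P) (ρ : M → ReducedSpace P) (f : M → ℝ) (w : M → EN) :
    liftField H ν n ρ (f • w) = f • liftField H ν n ρ w := by
  funext x
  refine Eq.trans ?_ (map_smul (liftForm H ν P EN n ρ x).inverse (f x) _)
  have hw : (((f • w) x, 0) : EN × ((EG →L[ℝ] ℝ) × (Fin 3 → (EG →L[ℝ] ℝ)))) =
    f x • (w x, 0) := Prod.ext rfl (smul_zero _).symm
  exact congrArg _ hw

theorem IsMomentReduction.isHyperHermitian (h : IsMomentReduction H ν ζ P EP EN)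
    (hH : IsHyperHermitian H g)
    (hJ : ∀ a p A v, IsLift H ν EP p A v →
      IsLift H ν EP p (H'.J a (quotientMap P p) A) (H.J a p v))
    (hg : ∀ p A A' v v', IsLift H ν EP p A v →
      IsLift H ν EP p A' v' → g'.inner (quotientMap P p) A A' = g.inner p v v') :
    IsHyperHermitian H' g' := by
  intro a n A B
  obtain ⟨p, rfl⟩ : ∃ p, quotientMap P p = n := Quotient.exists_rep n
  obtain ⟨v, hv⟩ := h.exists_isLift p A
  obtain ⟨w, hw⟩ := h.exists_isLift p B
  rw [hg p _ _ _ _ (hJ a p A v hv) (hJ a p B w hw), hg p _ _ _ _ hv hw, hH]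

end ReducedConnection

theorem IsHyperHermitian.inner_J_left {E : Type*} [NormedAddCommGroup E] [NormedSpace ℝ E]
    {M : Type*} [TopologicalSpace M] [ChartedSpace E M] [IsManifold 𝓘(ℝ, E) ∞ M]
    {H : HypercomplexStructure E M} {g : Metric E M} (hH : IsHyperHermitian H g) (a : Fin 3) (x : M)
    (v w : TangentSpace 𝓘(ℝ, E) x) : g.inner x (H.J a x v) w = -g.inner x v (H.J a x w) := by
  have h1 := hH a x v (H.J a x w)
  rw [H.sq, map_neg] at h1
  rw [← h1, neg_neg]

section ReducedConnection

variable {E : Type*} [NormedAddCommGroup E] [NormedSpace ℝ E] [FiniteDimensional ℝ E]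
  {M : Type*} [TopologicalSpace M] [ChartedSpace E M] [IsManifold 𝓘(ℝ, E) ∞ M]
  {EG : Type*} [NormedAddCommGroup EG] [NormedSpace ℝ EG] [FiniteDimensional ℝ EG]
  {G : Type*} [TopologicalSpace G] [ChartedSpace EG G] [Group G]
  [LieGroup 𝓘(ℝ, EG) ∞ G]
  [MulAction G M] [ContMDiffSMul 𝓘(ℝ, EG) 𝓘(ℝ, E) ∞ G M]
  {H : HypercomplexStructure E M} {ν : Fin 3 → M → (EG →L[ℝ] ℝ)} {ζ : Fin 3 → (EG →L[ℝ] ℝ)}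
  {P : SubMulAction G M}
  {EP : Type} [NormedAddCommGroup EP] [NormedSpace ℝ EP] [FiniteDimensional ℝ EP]
  {EN : Type*} [NormedAddCommGroup EN] [NormedSpace ℝ EN] [FiniteDimensional ℝ EN]
  [ChartedSpace EP P] [IsManifold 𝓘(ℝ, EP) ∞ P]
  [ChartedSpace EN (ReducedSpace P)] [IsManifold 𝓘(ℝ, EN) ∞ (ReducedSpace P)]
  {p : P} {g : Metric E M} {K : ((y : M) → TangentSpace 𝓘(ℝ, E) y) →
      (TangentSpace 𝓘(ℝ, E) (p : M) →L[ℝ] TangentSpace 𝓘(ℝ, E) (p : M))}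
  {H' : HypercomplexStructure EN (ReducedSpace P)} {g' : Metric EN (ReducedSpace P)}

/-- The connection of the quotient: the horizontal part of the connection of `M`, corrected by
the curvature of the horizontal distribution. -/
theorem IsMomentReduction.exists_hktConnAt (h : IsMomentReduction H ν ζ P EP EN)
    (hH : IsHyperHermitian H g)
    (hJ : ∀ a p A v, IsLift H ν EP p A v →
      IsLift H ν EP p (H'.J a (quotientMap P p) A) (H.J a p v))
    (hg : ∀ p A A' v v', IsLift H ν EP p A v →
      IsLift H ν EP p A' v' → g'.inner (quotientMap P p) A A' = g.inner p v v')
    (hK : HKTConnAt H g (p : M) K) :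
    ∃ K', HKTConnAt H' g' (quotientMap P p) K' := by
  have hH' := h.isHyperHermitian hH hJ hg
  obtain ⟨ρ, hρ⟩ := h.exists_isExtensionAt p
  obtain ⟨L, hL⟩ := h.exists_lift p
  obtain ⟨Ξ, hΞ⟩ := h.exists_vertical p
  obtain ⟨Ω, hΩ, hΩs, hΩJ⟩ := h.exists_curvature hJ p
  let lift : ((n : ReducedSpace P) → TangentSpace 𝓘(ℝ, EN) n) →
      ((x : M) → TangentSpace 𝓘(ℝ, E) x) := fun Y =>
    liftField H ν (quotientMap P p) ρ (der (extChartAt 𝓘(ℝ, EN) (quotientMap P p)) Y ∘ ρ)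
  have hlift : ∀ Y, IsLiftField H ν EP p Y (lift Y) := h.isLiftField_liftField hρ
  have hliftp : ∀ Y, L (Y (quotientMap P p)) = lift Y p := fun Y => h.lift_unique (hL _) (hlift Y).self
  have hliftd : ∀ Y, DiffAt Y (quotientMap P p) → DiffAt (lift Y) (p : M) := fun Y hY =>
    h.diffAt_liftField hρ (MDifferentiableAt.comp_of_eq (p : M)
      (DiffAt.der (contMDiffAt_extChartAt.of_le (by norm_cast)) hY)
      (hρ.smooth.mdifferentiableAt (by simp)) hρ.apply_self)
  have hlifts : ∀ Y, SmoothAt Y (quotientMap P p) → SmoothAt (lift Y) (p : M) := fun Y hY =>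
    h.smoothAt_liftField hρ (ContMDiffAt.comp_of_eq (hY.contMDiffAt_der contMDiffAt_extChartAt)
      hρ.smooth hρ.apply_self)
  let Ξ' : (EG →L[ℝ] ℝ) →L[ℝ] E := Ξ
  let Ω' : E →L[ℝ] E →L[ℝ] (EG →L[ℝ] ℝ) := Ω
  let L' : EN →L[ℝ] E := L
  let gp : E →L[ℝ] E →L[ℝ] ℝ := g.inner (p : M)
  let Ψ : E →L[ℝ] E →L[ℝ] E := (ContinuousLinearMap.compL ℝ E _ _ Ξ').comp Ω'
  let k : ((n : ReducedSpace P) → TangentSpace 𝓘(ℝ, EN) n) → E →L[ℝ] E := fun Y => K (lift Y)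
  let l : ((n : ReducedSpace P) → TangentSpace 𝓘(ℝ, EN) n) → E := fun Y => lift Y p
  let Jp : Fin 3 → E →L[ℝ] E := fun a => H.J a p
  have hgp : ∀ v w, gp v w = gp w v := g.symm (p : M)
  have hl : ∀ Y, L' (Y (quotientMap P p)) = l Y := hliftp
  have hl0 : ∀ Y, momentForm H ν (p : M) (l Y) = 0 := fun Y => (hlift Y).self.1
  have hL0 : ∀ A, momentForm H ν (p : M) (L' A) = 0 := fun A => (hL A).1
  have hΨs : ∀ v w : E, momentForm H ν (p : M) v = 0 → momentForm H ν (p : M) w = 0 →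
      Ψ v w = -Ψ w v := fun v w hv hw =>
    (congrArg Ξ' (hΩs v w hv hw)).trans (map_neg Ξ' (Ω' w v))
  have hΨJ : ∀ a (v w : E), momentForm H ν (p : M) v = 0 →
      momentForm H ν (p : M) w = 0 → Ψ (Jp a v) w = -Ψ v (Jp a w) := fun a v w hv hw =>
    (congrArg Ξ' (hΩJ a v w hv hw)).trans (map_neg Ξ' (Ω' v (H.J a p w)))
  -- On lifts, `Ψ` is minus the vertical part of the bracket. The correction term would vanish if
  -- horizontal and vertical spaces were orthogonal, which is not assumed.
  have hex : ∀ Y : (n : ReducedSpace P) → TangentSpace 𝓘(ℝ, EN) n, ∃ k' : EN →L[ℝ] EN,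
      ∀ A C : EN, g'.inner (quotientMap P p) (k' A) C =
        gp (k Y (L' A)) (L' C) - gp (L' A) (Ψ (l Y) (L' C)) := by
    intro Y
    exact exists_representation (F := EN) (g'.inner (quotientMap P p)) (g'.pos _)
      (gp.bilinearComp ((k Y).comp L') L' - gp.bilinearComp L' ((Ψ (l Y)).comp L'))
  choose K₀ hK₀ using hex
  let K' : ((n : ReducedSpace P) → TangentSpace 𝓘(ℝ, EN) n) →
    (TangentSpace 𝓘(ℝ, EN) (quotientMap P p) →L[ℝ] TangentSpace 𝓘(ℝ, EN) (quotientMap P p)) := K₀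
  have hK' : ∀ Y A C, g'.inner (quotientMap P p) (K' Y A) C =
    gp (k Y (L' A)) (L' C) - gp (L' A) (Ψ (l Y) (L' C)) := hK₀
  let br : ((n : ReducedSpace P) → TangentSpace 𝓘(ℝ, EN) n) →
    ((n : ReducedSpace P) → TangentSpace 𝓘(ℝ, EN) n) → E := fun X Y =>
      mlieBracket 𝓘(ℝ, E) (lift X) (lift Y) (p : M)
  have hg' : ∀ A C, g'.inner (quotientMap P p) A C = gp (L' A) (L' C) := fun A C =>
    hg p A C _ _ (hL A) (hL C)
  have hbr : ∀ X Y, SmoothAt X (quotientMap P p) → SmoothAt Y (quotientMap P p) →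
      L' (mlieBracket 𝓘(ℝ, EN) X Y (quotientMap P p)) =
        br X Y + Ψ (l X) (l Y) := by
    intro X Y hX hY
    have e1 := h.lift_unique (hL _) (hΞ X Y _ _ hX.diffAt hY.diffAt (hlifts X hX).diffAt
      (hlifts Y hY).diffAt (hlift X) (hlift Y))
    have e2 := congrArg Ξ (hΩ X Y _ _ (hlifts X hX).diffAt (hlifts Y hY).diffAt (hlift X) (hlift Y))
    refine e1.trans ?_
    rw [sub_eq_add_neg]
    exact congrArg (br X Y + ·)
      ((map_neg Ξ _).symm.trans e2.symm)
  -- The `Ψ`-terms come from the two corrections and from the lift of the bracket. Together they are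
  -- minus the cyclic sum of g(X, Ψ(Y, Z)), totally skew because `Ψ` is.
  have htor : ∀ X Y Z, SmoothAt X (quotientMap P p) → SmoothAt Y (quotientMap P p) →
      g'.inner (quotientMap P p) (torsionAt K' X Y) (Z (quotientMap P p)) =
        gp (torsionAt K (lift X) (lift Y)) (l Z) - gp (l X) (Ψ (l Y) (l Z))
          + gp (l Y) (Ψ (l X) (l Z)) - gp (l Z) (Ψ (l X) (l Y)) := by
    intro X Y Z hX hY
    have e1 : g'.inner (quotientMap P p) (torsionAt K' X Y) (Z (quotientMap P p)) =
        g'.inner (quotientMap P p) (K' Y (X (quotientMap P p))) (Z (quotientMap P p))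
        - g'.inner (quotientMap P p) (K' X (Y (quotientMap P p))) (Z (quotientMap P p))
        - g'.inner (quotientMap P p) (mlieBracket 𝓘(ℝ, EN) X Y (quotientMap P p))
          (Z (quotientMap P p)) := by
      rw [torsionAt, map_sub, map_sub, sub_apply, sub_apply]
    have e2 : gp (torsionAt K (lift X) (lift Y)) (l Z) = gp (k Y (l X)) (l Z)
        - gp (k X (l Y)) (l Z) - gp (br X Y) (l Z) := by
      refine (congrArg (gp · (l Z)) (show (torsionAt K (lift X) (lift Y) : E) =
        k Y (l X) - k X (l Y) - br X Y
          from rfl)).trans ?_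
      simp only [map_sub, sub_apply]
    have e3 := hK' Y (X (quotientMap P p)) (Z (quotientMap P p))
    have e4 := hK' X (Y (quotientMap P p)) (Z (quotientMap P p))
    have e5 := hg' (mlieBracket 𝓘(ℝ, EN) X Y (quotientMap P p)) (Z (quotientMap P p))
    rw [hl, hl] at e3 e4
    have e6 : gp (L' (mlieBracket 𝓘(ℝ, EN) X Y (quotientMap P p))) (L' (Z (quotientMap P p))) =
        gp (br X Y) (l Z) + gp (Ψ (l X) (l Y)) (l Z) :=
      (congrArg₂ (fun a b => gp a b) (hbr X Y hX hY) (hl Z)).trans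
        (DFunLike.congr_fun (map_add gp _ _) (l Z))
    rw [e1, e2, e3, e4, e5, e6, hgp (Ψ (l X) (l Y))]
    ring
  refine ⟨K', ?_, ?_, ?_, ?_, ?_⟩
  · intro X Y hX hY
    refine ContinuousLinearMap.ext fun A => metric_ext g' fun C => ?_
    have e1 : lift (X + Y) = lift X + lift Y := by
      refine Eq.trans (congrArg (liftField H ν (quotientMap P p) ρ) ?_) (liftField_add _ _ _ _)
      funext x
      exact map_add (mfderiv 𝓘(ℝ, EN) 𝓘(ℝ, EN) (extChartAt 𝓘(ℝ, EN) (quotientMap P p)) (ρ x) :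
        EN →L[ℝ] EN) _ _
    have e2 : k (X + Y) = k X + k Y :=
      (congrArg K e1).trans (hK.add _ _ (hliftd X hX) (hliftd Y hY))
    have e3 : l (X + Y) = l X + l Y := congrFun e1 (p : M)
    have e4 : g'.inner (quotientMap P p) ((K' X + K' Y) A) C =
        g'.inner (quotientMap P p) (K' X A) C + g'.inner (quotientMap P p) (K' Y A) C := by
      rw [add_apply, map_add, add_apply]
    refine (hK' (X + Y) A C).trans (Eq.trans ?_ e4.symm)
    refine Eq.trans ?_ (congrArg₂ (· + ·) (hK' X A C) (hK' Y A C)).symm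
    rw [e2, e3]
    simp only [map_add, add_apply]
    ring
  · intro f X hf hX A
    refine metric_ext g' fun C => ?_
    have e1 : lift (f • X) = (f ∘ ρ) • lift X := by
      refine Eq.trans (congrArg (liftField H ν (quotientMap P p) ρ) ?_) (liftField_smul _ _ _ _)
      funext x
      exact map_smul (mfderiv 𝓘(ℝ, EN) 𝓘(ℝ, EN) (extChartAt 𝓘(ℝ, EN) (quotientMap P p)) (ρ x) :
        EN →L[ℝ] EN) _ _
    have hfρ : MDifferentiableAt 𝓘(ℝ, E) 𝓘(ℝ, ℝ) (f ∘ ρ) (p : M) :=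
      MDifferentiableAt.comp_of_eq (p : M) hf (hρ.smooth.mdifferentiableAt (by simp)) hρ.apply_self
    have e0 : f (ρ p) = f (quotientMap P p) := congrArg f hρ.apply_self
    have e2 : k (f • X) (L' A) = f (quotientMap P p) • k X (L' A) +
        (mvfderiv 𝓘(ℝ, EN) f (quotientMap P p) A : ℝ) • l X := by
      refine (DFunLike.congr_fun (congrArg K e1) (L' A)).trans ?_
      refine (hK.leibniz (f ∘ ρ) (lift X) hfρ (hliftd X hX) (L' A)).trans ?_
      refine congrArg₂ (fun (a b : ℝ) => a • k X (L' A) + b • l X) e0 ?_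
      refine h.mfderiv_eq_of_descends hf hfρ ?_ (hL A)
      filter_upwards [hρ.eq] with x hx hxP
      exact congrArg f (hx hxP)
    have e3 : l (f • X) = f (quotientMap P p) • l X :=
      (congrFun e1 (p : M)).trans (congrArg (· • l X) e0)
    have e4 : g'.inner (quotientMap P p) (f (quotientMap P p) • K' X A +
        (mvfderiv 𝓘(ℝ, EN) f (quotientMap P p) A : ℝ) • X (quotientMap P p)) C =
        f (quotientMap P p) * g'.inner (quotientMap P p) (K' X A) C +
        (mvfderiv 𝓘(ℝ, EN) f (quotientMap P p) A : ℝ) *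
          g'.inner (quotientMap P p) (X (quotientMap P p)) C := by
      rw [map_add, map_smul, map_smul, add_apply, smul_apply, smul_apply]
      rfl
    refine (hK' (f • X) A C).trans (Eq.trans ?_ e4.symm)
    have e5 : g'.inner (quotientMap P p) (X (quotientMap P p)) C = gp (l X) (L' C) :=
      (hg' _ _).trans (congrArg (fun v => gp v (L' C)) (hl X))
    have e6 := hK' X A C
    refine Eq.trans ?_ (congrArg₂ (fun a b : ℝ => f (quotientMap P p) * a +
      (mvfderiv 𝓘(ℝ, EN) f (quotientMap P p) A : ℝ) * b) e6 e5).symm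
    rw [e2, e3]
    simp only [map_add, add_apply, map_smul, smul_apply, smul_eq_mul]
    ring
  · intro X Y hX hY A
    have hW := hlifts X hX
    have hW' := hlifts Y hY
    have e1 : (mvfderiv 𝓘(ℝ, EN) (fun n => g'.inner n (X n) (Y n)) (quotientMap P p) A : ℝ) =
        gp (k X (L' A)) (l Y) + gp (l X) (k Y (L' A)) := by
      refine Eq.trans (h.mfderiv_eq_of_descends (mdifferentiableAt_inner g' hX.diffAt hY.diffAt)
        (mdifferentiableAt_inner g hW.diffAt hW'.diffAt) ?_ (hL A)).symm
        (hK.metric _ _ hW hW' (L' A))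
      filter_upwards [hlift X, hlift Y] with x h1 h2 hx
      exact (hg _ _ _ _ _ (h1 hx) (h2 hx)).symm
    have e2 := hK' X A (Y (quotientMap P p))
    have e3 := (g'.symm _ (X (quotientMap P p)) (K' Y A)).trans (hK' Y A (X (quotientMap P p)))
    rw [hl] at e2 e3
    refine e1.trans (Eq.trans ?_ (congrArg₂ (· + ·) e2 e3).symm)
    rw [hΨs (l X) (l Y) (hl0 X) (hl0 Y), map_neg, hgp (l X)]
    ring
  · intro a X hX A
    refine metric_ext g' fun C => ?_
    have hJX : SmoothAt (applyField (H'.J a) X) (quotientMap P p) := hX.applyField H' a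
    let JX : (x : M) → TangentSpace 𝓘(ℝ, E) x := applyField (H.J a) (lift X)
    have hJW : SmoothAt JX (p : M) := (hlifts X hX).applyField H a
    have hJl : IsLiftField H ν EP p (applyField (H'.J a) X) JX := (hlift X).applyField hJ a
    -- The lift of the rotated field and the rotated lift agree only on `P`, which suffices for
    -- derivatives in directions tangent to `P`.
    have e1 : k (applyField (H'.J a) X) (L' A) = Jp a (k X (L' A)) := by
      refine Eq.trans ?_ (hK.complex a _ (hlifts X hX) (L' A))
      refine h.connection_congr hK (hlifts _ hJX) hJW ?_ (congrArg Prod.snd (hL0 A))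
      filter_upwards [hlift (applyField (H'.J a) X), hJl] with x h1 h2 hx
      exact h.lift_unique (h1 hx) (h2 hx)
    have e2 : l (applyField (H'.J a) X) = Jp a (l X) := h.lift_unique (hlift _).self hJl.self
    have e3 : L' (H'.J a (quotientMap P p) C) = Jp a (L' C) :=
      h.lift_unique (hL _) (hJ a p C _ (hL C))
    have e4 : g'.inner (quotientMap P p) (H'.J a (quotientMap P p) (K' X A)) C =
        -g'.inner (quotientMap P p) (K' X A) (H'.J a (quotientMap P p) C) := by
      exact hH'.inner_J_left a _ _ _
    have e5 : ∀ v w, gp (Jp a v) w = -gp v (Jp a w) := hH.inner_J_left a (p : M)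
    refine (hK' (applyField (H'.J a) X) A C).trans (Eq.trans ?_ e4.symm)
    refine Eq.trans ?_ (congrArg (- ·) (hK' X A (H'.J a (quotientMap P p) C))).symm
    -- Type (1,1) of `Ψ` makes the correction compatible with I_a.
    rw [e1, e2, e3, hΨJ a _ _ (hl0 X) (hL0 C), e5, map_neg]
    ring
  · intro X Y Z hX hY hZ
    refine (htor X Y Z hX hY).trans (Eq.trans ?_ (congrArg (- ·) (htor X Z Y hX hZ)).symm)
    have e1 : gp (torsionAt K (lift X) (lift Y)) (l Z) =
        -gp (torsionAt K (lift X) (lift Z)) (l Y) :=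
      hK.torsion _ _ _ (hlifts X hX) (hlifts Y hY) (hlifts Z hZ)
    rw [e1, hΨs (l Y) (l Z) (hl0 Y) (hl0 Z), map_neg]
    ring

end ReducedConnection

/-! ### The reduced HKT structure -/

section ReducedHKT

variable {E : Type*} [NormedAddCommGroup E] [NormedSpace ℝ E] [FiniteDimensional ℝ E]
  {M : Type*} [TopologicalSpace M] [ChartedSpace E M] [IsManifold 𝓘(ℝ, E) ∞ M]
  {EG : Type*} [NormedAddCommGroup EG] [NormedSpace ℝ EG] [FiniteDimensional ℝ EG]
  {G : Type*} [TopologicalSpace G] [ChartedSpace EG G] [Group G]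
  [LieGroup 𝓘(ℝ, EG) ∞ G]
  [MulAction G M] [ContMDiffSMul 𝓘(ℝ, EG) 𝓘(ℝ, E) ∞ G M]
  {H : HypercomplexStructure E M} {ν : Fin 3 → M → (EG →L[ℝ] ℝ)} {ζ : Fin 3 → (EG →L[ℝ] ℝ)}
  {P : SubMulAction G M}
  {EP : Type} [NormedAddCommGroup EP] [NormedSpace ℝ EP] [FiniteDimensional ℝ EP]
  {EN : Type*} [NormedAddCommGroup EN] [NormedSpace ℝ EN] [FiniteDimensional ℝ EN]
  [ChartedSpace EP P] [IsManifold 𝓘(ℝ, EP) ∞ P]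
  [ChartedSpace EN (ReducedSpace P)] [IsManifold 𝓘(ℝ, EN) ∞ (ReducedSpace P)]
  {g : Metric E M}
  {H' : HypercomplexStructure EN (ReducedSpace P)} {g' : Metric EN (ReducedSpace P)}

theorem IsMomentReduction.isHorizontal_iff (h : IsMomentReduction H ν ζ P EP EN) (p : P)
    (u : TangentSpace 𝓘(ℝ, EP) p) :
    IsHorizontal H ν P p u ↔ IsLift (EN := EN) H ν EP p (dQuot P p u) (dIncl P p u) := by
  constructor
  · intro hu
    exact ⟨Prod.ext ((momentForm_fst h.moment 0 _ _).trans (hu 0)) (h.momentForm_dIncl_snd p u),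
      u, rfl, rfl⟩
  · intro hu a
    rw [← momentForm_fst h.moment, hu.1]
    rfl

theorem IsMomentReduction.isInducedByHorizontalLifts (h : IsMomentReduction H ν ζ P EP EN)
    (hJ : ∀ a p A v, IsLift H ν EP p A v →
      IsLift H ν EP p (H'.J a (quotientMap P p) A) (H.J a p v))
    (hg : ∀ p A A' v v', IsLift H ν EP p A v →
      IsLift H ν EP p A' v' → g'.inner (quotientMap P p) A A' = g.inner p v v') :
    IsInducedByHorizontalLifts (EP := EP) H g ν P H' g' where
  lift p A := by
    obtain ⟨v, hv⟩ := h.exists_isLift p A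
    obtain ⟨-, u, rfl, rfl⟩ := id hv
    refine ⟨u, ⟨(h.isHorizontal_iff p u).2 hv, rfl⟩, fun u' hu' => ?_⟩
    have h1 := (h.isHorizontal_iff p u').1 hu'.1
    rw [hu'.2] at h1
    exact h.dIncl_injective p (h.lift_unique h1 hv)
  complex a p u hu := by
    have h1 := hJ a p _ _ ((h.isHorizontal_iff p u).1 hu)
    obtain ⟨-, u', h2, h3⟩ := id h1
    refine ⟨u', (h.isHorizontal_iff p u').2 ?_, h2, h3.symm⟩
    rw [h2, h3]
    exact h1
  metric p u v hu hv :=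
    hg p _ _ _ _ ((h.isHorizontal_iff p u).1 hu) ((h.isHorizontal_iff p v).1 hv)

/-- The hypercomplex structure and the metric of the quotient, and their properties. -/
theorem IsMomentReduction.exists_isHKT (h : IsMomentReduction H ν ζ P EP EN) (hHKT : IsHKT H g)
    (hGH : PreservesHypercomplex G H) (hGg : PreservesMetric G g) :
    ∃ (H' : HypercomplexStructure EN (ReducedSpace P)) (g' : Metric EN (ReducedSpace P)),
      IsInducedByHorizontalLifts (EP := EP) H g ν P H' g' ∧ IsHKT H' g' ∧
        ZeroThreePartVanishes (H'.J 0) (omegaOne H' g') := by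
  obtain ⟨H', hJ⟩ := h.exists_hypercomplexStructure hGH
  obtain ⟨g', hg⟩ := h.exists_metric hGH hGg
  obtain ⟨hH, D, hD⟩ := hHKT
  have hH' := h.isHyperHermitian hH hJ hg
  have hK : ∀ n, ∃ K, HKTConnAt H' g' n K := by
    intro n
    obtain ⟨p, rfl⟩ : ∃ p, quotientMap P p = n := Quotient.exists_rep n
    exact h.exists_hktConnAt hH hJ hg (hD.hktConnAt (p : M))
  exact ⟨H', g', h.isInducedByHorizontalLifts hJ hg, isHKT_of_hktConnAt hH' hK,
    zeroThreePartVanishes_omegaOne hH' hK⟩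

end ReducedHKT

end HKT

end

theorem mainTheorem1
    {E : Type*} [NormedAddCommGroup E] [NormedSpace ℝ E] [FiniteDimensional ℝ E]
    {M : Type*} [TopologicalSpace M] [ChartedSpace E M] [IsManifold 𝓘(ℝ, E) ∞ M]
    [T2Space M] [SecondCountableTopology M]
    {EG : Type*} [NormedAddCommGroup EG] [NormedSpace ℝ EG] [FiniteDimensional ℝ EG]
    {G : Type*} [TopologicalSpace G] [ChartedSpace EG G] [Group G]
    [LieGroup 𝓘(ℝ, EG) ∞ G] [CompactSpace G]
    [MulAction G M] [ContMDiffSMul 𝓘(ℝ, EG) 𝓘(ℝ, E) ∞ G M]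
    (H : HKT.HypercomplexStructure E M) (g : HKT.Metric E M) (hHKT : HKT.IsHKT H g)
    (hGH : HKT.PreservesHypercomplex G H) (hGg : HKT.PreservesMetric G g)
    (ν : Fin 3 → M → (EG →L[ℝ] ℝ)) (hν : HKT.IsGMomentMap G H ν)
    (ζ : Fin 3 → (EG →L[ℝ] ℝ))
    (hinv : ∀ (γ : G) (x : M), (∀ a, ν a x = ζ a) → ∀ a, ν a (γ • x) = ζ a)
    (hfree : ∀ (γ : G) (x : M), (∀ a, ν a x = ζ a) → γ • x = x → γ = 1) :
    T2Space (HKT.ReducedSpace (HKT.levelSet G ν ζ hinv)) ∧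
    SecondCountableTopology (HKT.ReducedSpace (HKT.levelSet G ν ζ hinv)) ∧
    ∃ (_ : ChartedSpace (HKT.LevelModel E EG) (HKT.levelSet G ν ζ hinv))
      (_ : IsManifold 𝓘(ℝ, HKT.LevelModel E EG) ∞ (HKT.levelSet G ν ζ hinv))
      (_ : ChartedSpace (HKT.ReducedModel E EG) (HKT.ReducedSpace (HKT.levelSet G ν ζ hinv)))
      (_ : IsManifold 𝓘(ℝ, HKT.ReducedModel E EG) ∞
        (HKT.ReducedSpace (HKT.levelSet G ν ζ hinv))),
      Manifold.IsSmoothEmbedding 𝓘(ℝ, HKT.LevelModel E EG) 𝓘(ℝ, E) ∞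
        (fun p : HKT.levelSet G ν ζ hinv => (p : M)) ∧
      Manifold.IsSubmersion 𝓘(ℝ, HKT.LevelModel E EG) 𝓘(ℝ, HKT.ReducedModel E EG) ∞
        (HKT.quotientMap (HKT.levelSet G ν ζ hinv)) ∧
      ∃ (H' : HKT.HypercomplexStructure (HKT.ReducedModel E EG)
          (HKT.ReducedSpace (HKT.levelSet G ν ζ hinv)))
        (g' : HKT.Metric (HKT.ReducedModel E EG)
          (HKT.ReducedSpace (HKT.levelSet G ν ζ hinv))),
        HKT.IsInducedByHorizontalLifts (EP := HKT.LevelModel E EG) H g ν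
          (HKT.levelSet G ν ζ hinv) H' g' ∧
        HKT.IsHKT H' g' ∧
        HKT.ZeroThreePartVanishes (H'.J 0) (HKT.omegaOne H' g') := by
  set P := HKT.levelSet G ν ζ hinv with hPdef
  have hmem : ∀ x, x ∈ P ↔ ∀ a, ν a x = ζ a := fun x => Iff.rfl
  have hM : ContinuousSMul G M :=
    ⟨(contMDiff_smul (I := 𝓘(ℝ, EG)) (I' := 𝓘(ℝ, E)) (n := ∞)).continuous⟩
  have hPc : ContinuousSMul G P :=
    ⟨((continuous_fst.smul (continuous_subtype_val.comp continuous_snd)).subtype_mk _)⟩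
  have : SecondCountableTopology P := Topology.IsEmbedding.subtypeVal.secondCountableTopology
  -- Properness of the action makes the quotient Hausdorff.
  have : ProperSMul G P := HKT.properSMul_of_compactSpace
  refine ⟨inferInstance, ContinuousConstSMul.secondCountableTopology, ?_⟩
  obtain ⟨c₁, m₁, c₂, m₂, hR⟩ := HKT.exists_isReduction hν hmem (fun γ x hx => hfree γ x hx)
  have hred : HKT.IsMomentReduction H ν ζ P (HKT.LevelModel E EG) (HKT.ReducedModel E EG) :=
    { hR with
      moment := hν
      mem_iff := hmem
      finrank_level := fun p => by
        have := HKT.four_mul_finrank_le hν hmem p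
        rw [finrank_euclideanSpace, Fintype.card_fin]
        omega
      finrank_reduced := fun p => by
        have := HKT.four_mul_finrank_le hν hmem p
        rw [finrank_euclideanSpace, Fintype.card_fin]
        omega }
  exact ⟨c₁, m₁, c₂, m₂, hR.embedding, hR.submersion, hred.exists_isHKT hHKT hGH hGg⟩
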